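/- **Local energy inequality for the critical Burgers equation.** Let $N\ge 2$ and let $\theta:[-4,0]\times\mathbb R^N\to\mathbb R$ be a weak solution of $$\partial_t\theta+\sum_{j=1}^N\theta\,\partial_j\theta=-(-\Delta)^{1/2}\theta ,$$ that is, $\theta\in L^\infty(-4,0;L^2(\mathbb R^N))\cap L^2(-4,0;\dot H^{1/2}(\mathbb R^N))$ and $$\int_{-4}^0\int_{\mathbb R^N}\Big(\theta\,\partial_t\varphi+\tfrac12\theta^2\sum_{j=1}^N\partial_j\varphi-\theta\,(-\Delta)^{1/2}\varphi\Big)\,dx\,dt=0\qquad\text{for all }\varphi\in C_c^\infty((-4,0)\times\mathbb R^N).$$ Assume that $\|\theta\|_{L^\infty}:=\|\theta\|_{L^\infty([-4,0]\times\mathbb R^N)}<\infty$. Let $B_4=[-4,4]^N$ and $B_4^*=B_4\times[0,4]$. For a function $f$ on $\mathbb R^N$ let $f^*$ be its harmonic extension (Poisson integral) to $\mathbb R^N\times[0,\infty)$, and write $g_+=\max(g,0)$. Let $C_N$ be the best constant in the Sobolev inequality $\|f\|^2_{L^{2N/(N-1)}(\mathbb R^N)}\le C_N\|f\|^2_{\dot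 H^{1/2}(\mathbb R^N)}$, where $\|f\|_{\dot H^{1/2}}=\|(-\Delta)^{1/4}f\|_{L^2}$. Let $\beta>0$ and $L\in\mathbb R$, put $u=\beta(\theta-L)$, with $u^*(t,\cdot)=(u(t,\cdot))^*$ and $u^*_+=(u^*)_+$, and let $\eta=\eta(x,z)$ be any smooth function on $\mathbb R^N\times[0,\infty)$ supported in $B_4^*$ (not necessarily vanishing at $z=0$). Then $$\begin{aligned} &\frac12\int_\sigma^t\!\int_{B_4^*}|\nabla(\eta u_+^*)|^2\,dx\,dz\,ds+\frac12\int_{B_4}\big(\eta(x,0)\,u_+(t,x)\big)^2dx\\ &\quad\le\frac12\int_{B_4}\big(\eta(x,0)\,u_+(\sigma,x)\big)^2dx+2NC_N\big(|L|+\|\theta\|_{L^\infty}\big)^2\int_\sigma^t\!\int_{B_4}|\nabla_x\eta(x,0)|^2u_+^2\,dx\,ds\\ &\qquad+\int_\sigma^t\!\int_{B_4^*}|\nabla\eta|^2(u_+^*)^2\,dx\,dz\,ds \end{aligned}$$ for all $\sigma\le t$ in a set $S\subseteq[-4,0]$ of full measure that does not depend on $\beta$, $L$ or $\eta$. If moreover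 $t\mapsto\theta(t,\cdot)$ is weakly continuous on $[-4,0]$ with values in $L^2(\mathbb R^N)$, then the inequality holds for all $-4\le\sigma\le t\le0$. -/

import Mathlib

open MeasureTheory Set
open scoped ENNReal

noncomputable section

namespace CriticalBurgers

/-- The space `ℝ^N` with its Euclidean norm. -/
abbrev Space (N : ℕ) := EuclideanSpace ℝ (Fin N)

/-- The constant `Γ((N+1)/2) / π^((N+1)/2)`: it normalizes the Poisson kernel of the upper half
space, and it is also the constant in the singular integral for `(-Δ)^(1/2)` on `ℝ^N`. -/
def poissonConst (N : ℕ) : ℝ :=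
  Real.Gamma (((N : ℝ) + 1) / 2) / Real.pi ^ (((N : ℝ) + 1) / 2)

/-- The Poisson kernel `P(x, z)` of the half space `ℝ^N × (0, ∞)`. -/
def poissonKernel {N : ℕ} (x : Space N) (z : ℝ) : ℝ :=
  poissonConst N * (z / (z ^ 2 + ‖x‖ ^ 2) ^ (((N : ℝ) + 1) / 2))

/-- The harmonic extension `H f` of a function `f` on `ℝ^N` to `ℝ^N × [0, ∞)`, that is, its
Poisson integral for `z > 0`, with the boundary values `f` at `z = 0`. -/
def harmonicExt {N : ℕ} (f : Space N → ℝ) (p : Space N × ℝ) : ℝ :=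
  if 0 < p.2 then ∫ y, poissonKernel (p.1 - y) p.2 * f y else f p.1

/-- The half Laplacian `(-Δ)^(1/2) f`, as the (absolutely convergent) singular integral
in its second-difference form. It is applied only to smooth compactly supported `f`. -/
def halfLaplacian {N : ℕ} (f : Space N → ℝ) (x : Space N) : ℝ :=
  poissonConst N / 2 * ∫ y, (2 * f x - f (x + y) - f (x - y)) / ‖y‖ ^ (N + 1)

/-- The squared homogeneous Sobolev seminorm `‖f‖²` of `Ḣ^(1/2)(ℝ^N)`, a number in `[0, ∞]`.
The constant is the one for which it equals `‖(-Δ)^(1/4) f‖²` in `L²`. -/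
def hHalfSq {N : ℕ} (f : Space N → ℝ) : ℝ≥0∞ :=
  ENNReal.ofReal (poissonConst N / 2) *
    ∫⁻ x, ∫⁻ y, ENNReal.ofReal ((f x - f y) ^ 2 / ‖x - y‖ ^ (N + 1))

/-- The best constant `C_N` in the Sobolev inequality
`‖f‖²_{L^(2N/(N-1))} ≤ C_N ‖f‖²_{Ḣ^(1/2)}` on `ℝ^N` (for `N ≥ 2`). -/
def sobolevConst (N : ℕ) : ℝ≥0∞ :=
  sInf {C : ℝ≥0∞ | ∀ f : Space N → ℝ, MemLp f 2 →
    eLpNorm f (ENNReal.ofReal (2 * (N : ℝ) / ((N : ℝ) - 1))) volume ^ 2 ≤ C * hHalfSq f}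

/-- The norm of `θ` in `L^∞([a, b] × ℝ^N)`. -/
def supNorm {N : ℕ} (a b : ℝ) (θ : ℝ → Space N → ℝ) : ℝ≥0∞ :=
  eLpNorm (Function.uncurry θ) ⊤ (volume.restrict (Icc a b ×ˢ univ))

/-- Weak solutions of `∂ₜθ + ∑ⱼ θ ∂ⱼθ = -(-Δ)^(1/2) θ` on `[a, b] × ℝ^N`, in the class
`L^∞(a, b; L²) ∩ L²(a, b; Ḣ^(1/2))`. The nonlinear term is `∑ⱼ ∂ⱼ(θ²/2)`. -/
structure IsWeakSolution {N : ℕ} (a b : ℝ) (θ : ℝ → Space N → ℝ) : Prop where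
  measurable : AEStronglyMeasurable (Function.uncurry θ) (volume.restrict (Icc a b ×ˢ univ))
  bounded_L2 : ∃ M : ℝ≥0∞, M < ⊤ ∧
    ∀ᵐ t ∂(volume.restrict (Icc a b)), eLpNorm (θ t) 2 volume ≤ M
  finite_dissipation : ∫⁻ t in Icc a b, hHalfSq (θ t) < ⊤
  weak_eq : ∀ φ : ℝ × Space N → ℝ, ContDiff ℝ (⊤ : ℕ∞) φ → HasCompactSupport φ →
    tsupport φ ⊆ Ioo a b ×ˢ univ →
    ∫ t in Icc a b, ∫ x,
      (θ t x * deriv (fun s => φ (s, x)) t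
        + θ t x ^ 2 / 2 *
          ∑ j : Fin N, fderiv ℝ (fun y => φ (t, y)) x (EuclideanSpace.single j 1)
        - θ t x * halfLaplacian (fun y => φ (t, y)) x) = 0

/-- `t ↦ θ(t)` is weakly continuous on `[a, b]` with values in `L²(ℝ^N)`. -/
def WeaklyContinuous {N : ℕ} (a b : ℝ) (θ : ℝ → Space N → ℝ) : Prop :=
  (∀ t ∈ Icc a b, MemLp (θ t) 2) ∧
    ∀ g : Space N → ℝ, MemLp g 2 → ContinuousOn (fun t => ∫ x, θ t x * g x) (Icc a b)

/-- The cube `B₄ = [-4, 4]^N`. -/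
def B4 (N : ℕ) : Set (Space N) := {x | ∀ i, x i ∈ Icc (-4 : ℝ) 4}

/-- `B₄* = B₄ × [0, 4]`. -/
def B4star (N : ℕ) : Set (Space N × ℝ) := B4 N ×ˢ Icc 0 4

/-- `η` is a smooth function on the closed half space `ℝ^N × [0, ∞)` (the restriction of a smooth
function on `ℝ^N × ℝ`) that is supported in `B₄*`. It need not vanish on the bottom `z = 0`. -/
structure IsCutoff {N : ℕ} (η : Space N × ℝ → ℝ) : Prop where
  smooth : ContDiff ℝ (⊤ : ℕ∞) η
  support : ∀ p : Space N × ℝ, 0 ≤ p.2 → p ∉ B4star N → η p = 0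

/-- `|∇F|²`, with the full Euclidean gradient in `(x, z)`. Below it is used for smooth functions
and for functions that are locally Lipschitz in `z > 0`, hence differentiable almost everywhere
there, with the weak gradient. -/
def gradSq {N : ℕ} (F : Space N × ℝ → ℝ) (p : Space N × ℝ) : ℝ :=
  ‖fderiv ℝ (fun x => F (x, p.2)) p.1‖ ^ 2 + deriv (fun z => F (p.1, z)) p.2 ^ 2

/-- The local energy inequality between the times `σ` and `t` for `u`, with the cut-off `η` and
the constant `K` in front of `∫∫ |∇η|² u₊²`. All the integrals are taken in `[0, ∞]`. -/
def LocalEnergyInequality {N : ℕ} (u : ℝ → Space N → ℝ) (η : Space N × ℝ → ℝ) (K : ℝ≥0∞)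
    (σ t : ℝ) : Prop :=
  1 / 2 * (∫⁻ s in Icc σ t, ∫⁻ p in B4star N,
        ENNReal.ofReal (gradSq (fun q => η q * max (harmonicExt (u s) q) 0) p))
      + 1 / 2 * ∫⁻ x in B4 N, ENNReal.ofReal ((η (x, 0) * max (u t x) 0) ^ 2)
    ≤ 1 / 2 * (∫⁻ x in B4 N, ENNReal.ofReal ((η (x, 0) * max (u σ x) 0) ^ 2))
      + K * (∫⁻ s in Icc σ t, ∫⁻ x in B4 N,
          ENNReal.ofReal (‖fderiv ℝ (fun y => η (y, 0)) x‖ ^ 2 * max (u s x) 0 ^ 2))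
      + ∫⁻ s in Icc σ t, ∫⁻ p in B4star N,
          ENNReal.ofReal (gradSq η p * max (harmonicExt (u s) p) 0 ^ 2)

end CriticalBurgers

end

open CriticalBurgers

noncomputable section

namespace CriticalBurgers

open Filter Topology

variable {N : ℕ}

/-! ### The Poisson kernel -/

lemma poissonConst_pos (N : ℕ) : 0 < poissonConst N := by
  unfold poissonConst
  have : 0 < Real.Gamma (((N : ℝ) + 1) / 2) := Real.Gamma_pos_of_pos (by positivity)
  have := Real.pi_pos
  positivity

/-- The power `(z² + |x|²)^(-(N+1)/2)` of the distance to the origin of the half space. -/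
def decay (z : ℝ) (x : Space N) : ℝ := (z ^ 2 + ‖x‖ ^ 2) ^ (-(((N : ℝ) + 1) / 2))

/-- The vertical derivative of the Poisson kernel. -/
def poissonDz (z : ℝ) (x : Space N) : ℝ :=
  poissonConst N * (decay z x
    - (N + 1) * z ^ 2 * (z ^ 2 + ‖x‖ ^ 2) ^ (-(((N : ℝ) + 3) / 2)))

/-- The horizontal gradient of the Poisson kernel. -/
def poissonDx (z : ℝ) (x : Space N) : Space N :=
  (-(poissonConst N * (N + 1) * z * (z ^ 2 + ‖x‖ ^ 2) ^ (-(((N : ℝ) + 3) / 2)))) • x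

lemma poissonKernel_eq (z : ℝ) (x : Space N) :
    poissonKernel x z = poissonConst N * z * decay z x := by
  unfold poissonKernel decay
  rw [Real.rpow_neg (by positivity)]
  ring

lemma decay_nonneg (z : ℝ) (x : Space N) : 0 ≤ decay z x := by
  unfold decay; positivity

lemma poissonKernel_nonneg {z : ℝ} (hz : 0 ≤ z) (x : Space N) : 0 ≤ poissonKernel x z := by
  rw [poissonKernel_eq]
  have := poissonConst_pos N
  have := decay_nonneg z x
  positivity

lemma poissonDz_neg (z : ℝ) (x : Space N) : poissonDz z (-x) = poissonDz z x := by
  simp [poissonDz, decay]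

lemma poissonKernel_neg (z : ℝ) (x : Space N) : poissonKernel (-x) z = poissonKernel x z := by
  simp [poissonKernel]

lemma decay_le_decay {z z' : ℝ} (hz : 0 < z) (h : z ≤ z') (x : Space N) :
    decay z' x ≤ decay z x := by
  unfold decay
  apply Real.rpow_le_rpow_of_nonpos (by positivity)
  · gcongr
  · have : (0 : ℝ) ≤ N := Nat.cast_nonneg N
    linarith

lemma decay_shift_le {z : ℝ} (hz : 0 < z) {x y : Space N} (h : ‖x - y‖ ≤ z / 2) :
    decay z x ≤ 2 ^ (((N : ℝ) + 1) / 2) * decay z y := by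
  unfold decay
  rw [Real.rpow_neg (by positivity), Real.rpow_neg (by positivity), ← div_eq_mul_inv,
    ← one_div, div_le_div_iff₀ (by positivity) (by positivity), one_mul,
    ← Real.mul_rpow (by norm_num) (by positivity)]
  apply Real.rpow_le_rpow (by positivity) _ (by positivity)
  have h1 : ‖y‖ ≤ ‖x‖ + z / 2 := by
    have := norm_sub_norm_le y x
    rw [norm_sub_rev] at this
    linarith
  have h2 : ‖y‖ ^ 2 ≤ (‖x‖ + z / 2) ^ 2 := by gcongr
  nlinarith [sq_nonneg (‖x‖ - z / 2)]

lemma mul_rpow_shift {a : ℝ} (ha : 0 < a) (r : ℝ) : a * a ^ (-((r + 3) / 2)) =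
    a ^ (-((r + 1) / 2)) := by
  nth_rewrite 1 [← Real.rpow_one a]
  rw [← Real.rpow_add ha]
  congr 1
  ring

lemma abs_poissonDz_le {z : ℝ} (hz : 0 < z) (x : Space N) :
    |poissonDz z x| ≤ poissonConst N * (N + 1) * decay z x := by
  have hc := poissonConst_pos N
  have hA : 0 < z ^ 2 + ‖x‖ ^ 2 := by positivity
  have h := mul_rpow_shift hA N
  unfold poissonDz
  rw [abs_mul, abs_of_pos hc, mul_assoc (poissonConst N) ((N : ℝ) + 1)]
  refine mul_le_mul_of_nonneg_left ?_ hc.le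
  unfold decay
  rw [← h]
  set B := (z ^ 2 + ‖x‖ ^ 2) ^ (-(((N : ℝ) + 3) / 2))
  have hB : 0 ≤ B := by positivity
  have hN : (0 : ℝ) ≤ N := Nat.cast_nonneg N
  rw [abs_le]
  constructor <;> nlinarith [mul_nonneg hB (sq_nonneg z), mul_nonneg hB (sq_nonneg ‖x‖),
    mul_nonneg hN (mul_nonneg hB (sq_nonneg z)), mul_nonneg hN (mul_nonneg hB (sq_nonneg ‖x‖))]

lemma norm_poissonDx_le {z : ℝ} (hz : 0 < z) (x : Space N) :
    ‖poissonDx z x‖ ≤ poissonConst N * (N + 1) * decay z x := by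
  have hc := poissonConst_pos N
  have hA : 0 < z ^ 2 + ‖x‖ ^ 2 := by positivity
  have h := mul_rpow_shift hA N
  unfold poissonDx decay
  rw [norm_smul, Real.norm_eq_abs, abs_neg, abs_of_nonneg (by positivity), ← h]
  set B := (z ^ 2 + ‖x‖ ^ 2) ^ (-(((N : ℝ) + 3) / 2))
  have hB : 0 ≤ B := by positivity
  have : poissonConst N * (N + 1) * z * B * ‖x‖ = poissonConst N * (N + 1) * (z * ‖x‖ * B) := by ring
  rw [this]
  gcongr
  nlinarith [sq_nonneg (z - ‖x‖), norm_nonneg x]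

lemma hasDerivAt_poissonKernel {z : ℝ} (hz : 0 < z) (x : Space N) :
    HasDerivAt (fun z => poissonKernel x z) (poissonDz z x) z := by
  have hA : 0 < z ^ 2 + ‖x‖ ^ 2 := by positivity
  have h1 : HasDerivAt (fun z : ℝ => z ^ 2 + ‖x‖ ^ 2) (2 * z) z := by
    simpa using (hasDerivAt_pow 2 z).add_const (‖x‖ ^ 2)
  have h2 := h1.rpow_const (p := -(((N : ℝ) + 1) / 2)) (Or.inl hA.ne')
  have h3 := ((hasDerivAt_id z).mul h2).const_mul (poissonConst N)
  have e : (fun z => poissonKernel x z) = fun z => poissonConst N *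
      (id z * (z ^ 2 + ‖x‖ ^ 2) ^ (-(((N : ℝ) + 1) / 2))) := by
    funext z; rw [poissonKernel_eq]; simp [decay, mul_assoc]
  rw [e]
  refine h3.congr_deriv ?_
  have : -(((N : ℝ) + 1) / 2) - 1 = -(((N : ℝ) + 3) / 2) := by ring
  rw [this]
  simp only [poissonDz, decay, id]
  ring

lemma hasFDerivAt_rpow_norm_sq {z : ℝ} (hz : 0 < z) (a : ℝ) (x : Space N) :
    HasFDerivAt (fun x : Space N => (z ^ 2 + ‖x‖ ^ 2) ^ (-a))
      ((-(2 * a) * (z ^ 2 + ‖x‖ ^ 2) ^ (-a - 1)) • innerSL ℝ x) x := by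
  have hA : 0 < z ^ 2 + ‖x‖ ^ 2 := by positivity
  have h1 : HasFDerivAt (fun x : Space N => z ^ 2 + ‖x‖ ^ 2) (2 • innerSL ℝ x) x :=
    (hasStrictFDerivAt_norm_sq x).hasFDerivAt.const_add _
  have h2 := h1.rpow_const (p := -a) (Or.inl hA.ne')
  refine h2.congr_fderiv ?_
  ext v
  simp
  ring

lemma hasFDerivAt_poissonKernel {z : ℝ} (hz : 0 < z) (x : Space N) :
    HasFDerivAt (fun x => poissonKernel x z) (innerSL ℝ (poissonDx z x)) x := by
  have h2 := (hasFDerivAt_rpow_norm_sq hz (((N : ℝ) + 1) / 2) x).const_mul (poissonConst N * z)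
  have e : (fun x : Space N => poissonKernel x z) = fun x => poissonConst N * z *
      (z ^ 2 + ‖x‖ ^ 2) ^ (-(((N : ℝ) + 1) / 2)) := by
    funext z; rw [poissonKernel_eq]; simp [decay, mul_assoc]
  rw [e]
  refine h2.congr_fderiv ?_
  have : -(((N : ℝ) + 1) / 2) - 1 = -(((N : ℝ) + 3) / 2) := by ring
  rw [this]
  ext v
  simp [poissonDx]
  ring

lemma integrable_decay {z : ℝ} (hz : 0 < z) : Integrable (fun x : Space N => decay z x) := by
  have h := integrable_rpow_neg_one_add_norm_sq (E := Space N) (μ := volume)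
    (r := (N : ℝ) + 1) (by simp)
  have h2 := (h.comp_smul (R := z⁻¹) (by positivity)).const_mul ((z ^ 2) ^ (-(((N : ℝ) + 1) / 2)))
  refine h2.congr (Eventually.of_forall fun x => ?_)
  simp only [decay]
  rw [neg_div, ← Real.mul_rpow (by positivity) (by positivity), norm_smul]
  congr 1
  simp only [norm_inv, Real.norm_eq_abs, mul_pow, inv_pow, sq_abs]
  field_simp

lemma measurable_poissonKernel : Measurable (fun p : ℝ × Space N => poissonKernel p.2 p.1) := by
  unfold poissonKernel; fun_prop

lemma measurable_poissonDz : Measurable (fun p : ℝ × Space N => poissonDz p.1 p.2) := by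
  unfold poissonDz decay; fun_prop

lemma measurable_poissonDx : Measurable (fun p : ℝ × Space N => poissonDx p.1 p.2) := by
  unfold poissonDx; fun_prop

lemma integral_decay {z : ℝ} (hz : 0 < z) :
    poissonConst N * z * ∫ x : Space N, decay z x = 1 := by
  set a : ℝ := ((N : ℝ) + 1) / 2 with ha
  have ha0 : 0 < a := by positivity
  have hmeas : AEStronglyMeasurable (Function.uncurry fun (x : Space N) (t : ℝ) =>
      t ^ (a - 1) * Real.exp (-((z ^ 2 + ‖x‖ ^ 2) * t)))
      ((volume : Measure (Space N)).prod (volume.restrict (Ioi 0))) := by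
    apply Measurable.aestronglyMeasurable
    unfold Function.uncurry
    fun_prop
  have hin : ∀ x : Space N, ∫ t in Ioi (0:ℝ), t ^ (a - 1) * Real.exp (-((z ^ 2 + ‖x‖ ^ 2) * t))
      = decay z x * Real.Gamma a := by
    intro x
    rw [Real.integral_rpow_mul_exp_neg_mul_Ioi ha0 (by positivity)]
    simp only [decay, ← ha, Real.rpow_neg (show 0 ≤ z ^ 2 + ‖x‖ ^ 2 by positivity), one_div,
      Real.inv_rpow (show 0 ≤ z ^ 2 + ‖x‖ ^ 2 by positivity)]
  have hint : Integrable (Function.uncurry fun (x : Space N) (t : ℝ) =>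
      t ^ (a - 1) * Real.exp (-((z ^ 2 + ‖x‖ ^ 2) * t)))
      ((volume : Measure (Space N)).prod (volume.restrict (Ioi 0))) := by
    rw [integrable_prod_iff hmeas]
    constructor
    · refine Eventually.of_forall fun x => ?_
      by_contra hcon
      have h1 := integral_undef hcon
      simp only [Function.uncurry] at h1
      rw [hin x] at h1
      have : 0 < decay z x * Real.Gamma a :=
        mul_pos (by unfold decay; positivity) (Real.Gamma_pos_of_pos ha0)
      linarith
    · refine ((integrable_decay hz).mul_const (Real.Gamma a)).congr (Eventually.of_forall fun x => ?_)
      refine (hin x).symm.trans ?_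
      refine setIntegral_congr_fun measurableSet_Ioi fun t (ht : 0 < t) => ?_
      exact (Real.norm_of_nonneg (by positivity)).symm
  have hswap := integral_integral_swap hint
  rw [integral_congr_ae (Eventually.of_forall hin), integral_mul_const] at hswap
  have hg : ∀ t ∈ Ioi (0:ℝ), (∫ x : Space N, t ^ (a - 1) * Real.exp (-((z ^ 2 + ‖x‖ ^ 2) * t)))
      = Real.pi ^ ((N : ℝ) / 2) * (t ^ ((1:ℝ) / 2 - 1) * Real.exp (-(z ^ 2 * t))) := by
    intro t ht
    have ht' : 0 < t := ht
    have e : ∀ x : Space N, t ^ (a - 1) * Real.exp (-((z ^ 2 + ‖x‖ ^ 2) * t))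
        = t ^ (a - 1) * Real.exp (-(z ^ 2 * t)) * Real.exp (-t * ‖x‖ ^ 2) := by
      intro x; rw [mul_assoc, ← Real.exp_add]; ring_nf
    simp_rw [e]
    rw [integral_const_mul, GaussianFourier.integral_rexp_neg_mul_sq_norm ht']
    simp only [finrank_euclideanSpace, Fintype.card_fin]
    rw [Real.div_rpow Real.pi_pos.le ht'.le]
    have : t ^ (a - 1) = t ^ ((1:ℝ) / 2 - 1) * t ^ ((N:ℝ) / 2) := by
      rw [← Real.rpow_add ht']; congr 1; rw [ha]; ring
    rw [this]
    field_simp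
  rw [setIntegral_congr_fun measurableSet_Ioi hg, integral_const_mul,
    Real.integral_rpow_mul_exp_neg_mul_Ioi (by norm_num) (by positivity),
    Real.Gamma_one_half_eq] at hswap
  have hz2 : (1 / z ^ 2) ^ ((1:ℝ) / 2) = 1 / z := by
    rw [← Real.sqrt_eq_rpow, Real.sqrt_div zero_le_one, Real.sqrt_sq hz.le, Real.sqrt_one]
  have hpi : Real.pi ^ ((N:ℝ) / 2) * √Real.pi = Real.pi ^ a := by
    rw [Real.sqrt_eq_rpow, ← Real.rpow_add Real.pi_pos, ha]; congr 1; ring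
  have hpa : 0 < Real.pi ^ a := Real.rpow_pos_of_pos Real.pi_pos a
  have : (∫ x : Space N, decay z x) * Real.Gamma a = Real.pi ^ a / z := by
    rw [hswap, hz2, ← hpi]; ring
  unfold poissonConst
  rw [← ha]
  calc Real.Gamma a / Real.pi ^ a * z * ∫ x : Space N, decay z x
      = ((∫ x : Space N, decay z x) * Real.Gamma a) * z / Real.pi ^ a := by ring
    _ = 1 := by rw [this]; field_simp

lemma integrable_poissonKernel {z : ℝ} (hz : 0 < z) :
    Integrable (fun x : Space N => poissonKernel x z) := by
  simp_rw [poissonKernel_eq]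
  exact (integrable_decay hz).const_mul _

lemma integral_poissonKernel {z : ℝ} (hz : 0 < z) :
    ∫ x : Space N, poissonKernel x z = 1 := by
  simp_rw [poissonKernel_eq]
  rw [integral_const_mul, integral_decay hz]

lemma integrable_poissonDz {z : ℝ} (hz : 0 < z) :
    Integrable (fun x : Space N => poissonDz z x) :=
  ((integrable_decay hz).const_mul _).mono'
    (measurable_poissonDz.comp (measurable_const.prodMk measurable_id)).aestronglyMeasurable
    (Eventually.of_forall fun x => by simpa using abs_poissonDz_le hz x)

lemma integrable_poissonDx {z : ℝ} (hz : 0 < z) :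
    Integrable (fun x : Space N => poissonDx z x) :=
  ((integrable_decay hz).const_mul _).mono'
    (measurable_poissonDx.comp (measurable_const.prodMk measurable_id)).aestronglyMeasurable
    (Eventually.of_forall fun x => by simpa using norm_poissonDx_le hz x)

/-! ### The harmonic extension of a bounded function -/

/-- The horizontal gradient of the harmonic extension. -/
def extDx (g : Space N → ℝ) (p : Space N × ℝ) : Space N :=
  ∫ y, g y • poissonDx p.2 (p.1 - y)

/-- The vertical derivative of the harmonic extension. -/
def extDz (g : Space N → ℝ) (p : Space N × ℝ) : ℝ :=
  ∫ y, poissonDz p.2 (p.1 - y) * g y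

lemma harmonicExt_of_pos (g : Space N → ℝ) {p : Space N × ℝ} (hz : 0 < p.2) :
    harmonicExt g p = ∫ y, poissonKernel (p.1 - y) p.2 * g y := by
  simp [harmonicExt, hz]

lemma measurable_sub_poissonKernel (z : ℝ) (x : Space N) :
    Measurable fun y => poissonKernel (x - y) z := by
  have h : Measurable fun y : Space N => (z, x - y) := by fun_prop
  exact measurable_poissonKernel.comp h

lemma measurable_sub_poissonDz (z : ℝ) (x : Space N) : Measurable fun y => poissonDz z (x - y) := by
  unfold poissonDz decay; fun_prop

lemma measurable_sub_poissonDx (z : ℝ) (x : Space N) : Measurable fun y => poissonDx z (x - y) := by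
  have h : Measurable fun y : Space N => (z, x - y) := by fun_prop
  exact measurable_poissonDx.comp h

section Bounded

variable {g : Space N → ℝ} {B : ℝ}

lemma integrable_kernel_mul {k : Space N → ℝ} (hk : Integrable k) (hg : Measurable g)
    (hB : ∀ x, |g x| ≤ B) (x : Space N) : Integrable (fun y => k (x - y) * g y) :=
  (hk.comp_sub_left x).mul_bdd (c := B) hg.aestronglyMeasurable
    (Eventually.of_forall fun y => by simpa using hB y)

lemma integrable_smul_poissonDx {z : ℝ} (hz : 0 < z) (hg : Measurable g)
    (hB : ∀ x, |g x| ≤ B) (x : Space N) : Integrable (fun y => g y • poissonDx z (x - y)) :=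
  ((integrable_poissonDx hz).comp_sub_left x).bdd_smul B hg.aestronglyMeasurable
    (Eventually.of_forall fun y => by simpa using hB y)

lemma hasFDerivAt_harmonicExt (hg : Measurable g) (hB : ∀ x, |g x| ≤ B)
    {p : Space N × ℝ} (hz : 0 < p.2) :
    HasFDerivAt (fun x => harmonicExt g (x, p.2)) (innerSL ℝ (extDx g p)) p.1 := by
  obtain ⟨x₀, z⟩ := p
  simp only at hz ⊢
  have e : (fun x => harmonicExt g (x, z)) = fun x => ∫ y, poissonKernel (x - y) z * g y := by
    funext x; exact harmonicExt_of_pos g hz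
  have e2 : innerSL ℝ (extDx g (x₀, z)) = ∫ y, g y • innerSL ℝ (poissonDx z (x₀ - y)) := by
    rw [extDx, ← ContinuousLinearMap.integral_comp_comm _ (integrable_smul_poissonDx hz hg hB x₀)]
    simp
  rw [e, e2]
  have hB0 : 0 ≤ B := (abs_nonneg _).trans (hB 0)
  apply hasFDerivAt_integral_of_dominated_of_fderiv_le
    (F' := fun x y => g y • innerSL ℝ (poissonDx z (x - y)))
    (bound := fun y => B * (poissonConst N * (N + 1) *
      (2 ^ (((N : ℝ) + 1) / 2) * decay z (x₀ - y))))
    (Metric.ball_mem_nhds x₀ (half_pos hz))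
  · exact Eventually.of_forall fun x =>
      (((measurable_sub_poissonKernel z x).mul hg)).aestronglyMeasurable
  · exact integrable_kernel_mul (integrable_poissonKernel hz) hg hB x₀
  · exact hg.aestronglyMeasurable.smul ((innerSL ℝ).continuous.comp_aestronglyMeasurable
      (measurable_sub_poissonDx z x₀).aestronglyMeasurable)
  · refine Eventually.of_forall fun y x hx => ?_
    rw [norm_smul, innerSL_apply_norm]
    have h1 := norm_poissonDx_le hz (x - y)
    have h2 : decay z (x - y) ≤ 2 ^ (((N : ℝ) + 1) / 2) * decay z (x₀ - y) := by
      apply decay_shift_le hz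
      rw [sub_sub_sub_cancel_right]
      exact (mem_ball_iff_norm.mp hx).le
    have hc := poissonConst_pos N
    exact mul_le_mul (hB y) (h1.trans (mul_le_mul_of_nonneg_left h2 (by positivity)))
      (norm_nonneg _) hB0
  · exact (((((integrable_decay hz).comp_sub_left x₀).const_mul _).const_mul _).const_mul _)
  · refine Eventually.of_forall fun y x _ => ?_
    have h := (hasFDerivAt_poissonKernel hz (x - y)).comp x ((hasFDerivAt_id x).sub_const y)
    refine (h.mul_const (g y)).congr_fderiv ?_
    ext v; simp

lemma hasDerivAt_harmonicExt (hg : Measurable g) (hB : ∀ x, |g x| ≤ B)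
    {p : Space N × ℝ} (hz : 0 < p.2) :
    HasDerivAt (fun z => harmonicExt g (p.1, z)) (extDz g p) p.2 := by
  obtain ⟨x, z₀⟩ := p
  simp only at hz ⊢
  have e : (fun z => harmonicExt g (x, z)) =ᶠ[𝓝 z₀]
      fun z => ∫ y, poissonKernel (x - y) z * g y := by
    filter_upwards [lt_mem_nhds hz] with z hz
    exact harmonicExt_of_pos g hz
  refine HasDerivAt.congr_of_eventuallyEq ?_ e
  have hB0 : 0 ≤ B := (abs_nonneg _).trans (hB 0)
  have hs : Metric.ball z₀ (z₀ / 2) ∈ 𝓝 z₀ := Metric.ball_mem_nhds z₀ (half_pos hz)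
  have hs' : ∀ z ∈ Metric.ball z₀ (z₀ / 2), z₀ / 2 ≤ z := by
    intro z h
    rw [Metric.mem_ball, Real.dist_eq, abs_lt] at h
    linarith
  refine (hasDerivAt_integral_of_dominated_loc_of_deriv_le
    (F' := fun z y => poissonDz z (x - y) * g y)
    (bound := fun y => poissonConst N * (N + 1) * decay (z₀ / 2) (x - y) * B)
    hs ?_ ?_ ?_ ?_ ?_ ?_).2
  · exact Eventually.of_forall fun z =>
      ((measurable_sub_poissonKernel z x).mul hg).aestronglyMeasurable
  · exact integrable_kernel_mul (integrable_poissonKernel hz) hg hB x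
  · exact ((measurable_sub_poissonDz z₀ x).mul hg).aestronglyMeasurable
  · refine Eventually.of_forall fun y z h => ?_
    have hz1 := hs' z h
    rw [norm_mul, Real.norm_eq_abs, Real.norm_eq_abs]
    have hc := poissonConst_pos N
    have h1 := abs_poissonDz_le (by linarith : 0 < z) (x - y)
    have h2 := decay_le_decay (half_pos hz) hz1 (x - y)
    exact mul_le_mul (h1.trans (mul_le_mul_of_nonneg_left h2 (by positivity))) (hB y)
      (abs_nonneg _) (mul_nonneg (by positivity) (decay_nonneg _ _))
  · exact (((integrable_decay (half_pos hz)).comp_sub_left x).const_mul _).mul_const _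
  · refine Eventually.of_forall fun y z h => ?_
    have hz1 := hs' z h
    exact (hasDerivAt_poissonKernel (by linarith : 0 < z) (x - y)).mul_const (g y)

lemma abs_harmonicExt_le (hB : ∀ x, |g x| ≤ B) (p : Space N × ℝ) :
    |harmonicExt g p| ≤ B := by
  by_cases hz : 0 < p.2
  · rw [harmonicExt_of_pos g hz]
    calc |∫ y, poissonKernel (p.1 - y) p.2 * g y|
        ≤ ∫ y, poissonKernel (p.1 - y) p.2 * B := by
          rw [← Real.norm_eq_abs]
          refine norm_integral_le_of_norm_le
            (((integrable_poissonKernel hz).comp_sub_left p.1).mul_const B)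
            (Eventually.of_forall fun y => ?_)
          rw [norm_mul, Real.norm_of_nonneg (poissonKernel_nonneg hz.le _)]
          exact mul_le_mul_of_nonneg_left (hB y) (poissonKernel_nonneg hz.le _)
      _ = B := by
          rw [integral_mul_const, integral_sub_left_eq_self (fun y => poissonKernel y p.2),
            integral_poissonKernel hz, one_mul]
  · simp [harmonicExt, hz, hB]

lemma decay_eq_poissonKernel {z : ℝ} (hz : 0 < z) (x : Space N) :
    poissonConst N * (N + 1) * decay z x = (N + 1) / z * poissonKernel x z := by
  rw [poissonKernel_eq]; field_simp

lemma abs_extDz_le (hB : ∀ x, |g x| ≤ B) {p : Space N × ℝ} (hz : 0 < p.2) :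
    |extDz g p| ≤ (N + 1) / p.2 * B := by
  calc |extDz g p| ≤ ∫ y, (N + 1) / p.2 * poissonKernel (p.1 - y) p.2 * B := by
        rw [← Real.norm_eq_abs]
        refine norm_integral_le_of_norm_le
          ((((integrable_poissonKernel hz).comp_sub_left p.1).const_mul _).mul_const B)
          (Eventually.of_forall fun y => ?_)
        rw [norm_mul, ← decay_eq_poissonKernel hz]
        have hc := poissonConst_pos N
        exact mul_le_mul (abs_poissonDz_le hz _) (hB y) (abs_nonneg _)
          (mul_nonneg (by positivity) (decay_nonneg _ _))
    _ = (N + 1) / p.2 * B := by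
        rw [integral_mul_const, integral_const_mul,
          integral_sub_left_eq_self (fun y => poissonKernel y p.2),
          integral_poissonKernel hz, mul_one]

lemma lipschitzOn_harmonicExt_vert (hg : Measurable g) (hB : ∀ x, |g x| ≤ B) {ε : ℝ} (hε : 0 < ε)
    (x : Space N) :
    LipschitzOnWith ((N + 1) / ε * B).toNNReal (fun z => harmonicExt g (x, z)) (Ici ε) := by
  have hB0 : 0 ≤ B := (abs_nonneg _).trans (hB 0)
  refine (convex_Ici ε).lipschitzOnWith_of_nnnorm_hasDerivWithin_le
    (f' := fun z => extDz g (x, z)) (fun z hz => ?_) (fun z hz => ?_)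
  · exact (hasDerivAt_harmonicExt hg hB (p := (x, z)) (hε.trans_le hz)).hasDerivWithinAt
  · rw [← NNReal.coe_le_coe, coe_nnnorm, Real.coe_toNNReal _ (by positivity)]
    refine (abs_extDz_le hB (p := (x, z)) (hε.trans_le hz)).trans ?_
    have : ε ≤ z := hz
    simp only
    gcongr

end Bounded

lemma integral_poissonDz {z : ℝ} (hz : 0 < z) : ∫ x : Space N, poissonDz z x = 0 := by
  have h1 := hasDerivAt_harmonicExt (g := fun _ : Space N => (1 : ℝ)) (B := 1) measurable_const
    (by simp) (p := (0, z)) hz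
  have e : (fun z => harmonicExt (fun _ : Space N => (1 : ℝ)) (0, z)) = fun _ => 1 := by
    funext z
    by_cases hz : 0 < z
    · rw [harmonicExt_of_pos _ (by exact hz)]
      simp only [mul_one]
      rw [integral_sub_left_eq_self (fun y => poissonKernel y z), integral_poissonKernel hz]
    · simp [harmonicExt, hz]
  simp only [e] at h1
  have h2 := h1.unique (hasDerivAt_const z (1 : ℝ))
  simp only [extDz, mul_one] at h2
  rwa [integral_sub_left_eq_self (fun y => poissonDz z y)] at h2

/-- The harmonic extension as an average of dilated copies, valid for all real heights. -/
lemma harmonicExt_eq_integral_dilate (g : Space N → ℝ) (p : Space N × ℝ) :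
    harmonicExt g p = ∫ h, poissonKernel h 1 * g (p.1 + max p.2 0 • h) := by
  by_cases hz : 0 < p.2
  · rw [harmonicExt_of_pos g hz, max_eq_left hz.le,
      ← integral_sub_left_eq_self (fun y => poissonKernel (p.1 - y) p.2 * g y) volume p.1,
      ← integral_neg_eq_self]
    have := Measure.integral_comp_smul (μ := (volume : Measure (Space N)))
      (fun y => poissonKernel (p.1 - (p.1 - -y)) p.2 * g (p.1 - -y)) p.2
    simp only [sub_neg_eq_add, sub_add_cancel_left] at this ⊢
    rw [finrank_euclideanSpace, Fintype.card_fin] at this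
    have hzN : 0 < p.2 ^ N := by positivity
    rw [abs_of_pos (by positivity), smul_eq_mul, eq_inv_mul_iff_mul_eq₀ hzN.ne'] at this
    rw [← this, ← integral_const_mul]
    congr 1
    funext h
    rw [poissonKernel_neg, ← mul_assoc]
    congr 1
    rw [poissonKernel_eq, poissonKernel_eq]
    unfold decay
    rw [norm_smul, mul_pow, Real.norm_eq_abs, sq_abs,
      show p.2 ^ 2 + p.2 ^ 2 * ‖h‖ ^ 2 = p.2 ^ 2 * (1 ^ 2 + ‖h‖ ^ 2) by ring,
      Real.mul_rpow (by positivity) (by positivity), ← Real.rpow_natCast p.2 2,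
      ← Real.rpow_mul hz.le]
    have : p.2 ^ N * p.2 * p.2 ^ (((2 : ℕ) : ℝ) * -(((N : ℝ) + 1) / 2)) = 1 := by
      rw [← Real.rpow_natCast p.2 N]
      nth_rewrite 2 [← Real.rpow_one p.2]
      rw [← Real.rpow_add hz, ← Real.rpow_add hz, ← Real.rpow_zero p.2]
      congr 1
      push_cast; ring
    linear_combination (poissonConst N * (1 ^ 2 + ‖h‖ ^ 2) ^ (-(((N : ℝ) + 1) / 2))) * this
  · rw [max_eq_right (not_lt.mp hz)]
    simp only [harmonicExt, hz, if_false, zero_smul, add_zero]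
    rw [integral_mul_const, integral_poissonKernel one_pos, one_mul]

lemma continuous_harmonicExt {g : Space N → ℝ} {B : ℝ} (hg : Continuous g) (hB : ∀ x, |g x| ≤ B) :
    Continuous (harmonicExt g) := by
  have e : harmonicExt g = fun p : Space N × ℝ =>
      ∫ h, poissonKernel h 1 * g (p.1 + max p.2 0 • h) :=
    funext (harmonicExt_eq_integral_dilate g)
  rw [e]
  have hm : AEStronglyMeasurable (fun h : Space N => poissonKernel h 1) :=
    (integrable_poissonKernel one_pos).aestronglyMeasurable
  refine continuous_of_dominated (bound := fun h => poissonKernel h 1 * B) (fun p => ?_)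
    (fun p => Eventually.of_forall fun h => ?_) ((integrable_poissonKernel one_pos).mul_const B)
    (Eventually.of_forall fun h => by fun_prop)
  · exact hm.mul (by fun_prop)
  · rw [norm_mul, Real.norm_of_nonneg (poissonKernel_nonneg zero_le_one _)]
    exact mul_le_mul_of_nonneg_left (hB _) (poissonKernel_nonneg zero_le_one _)

lemma lipschitz_harmonicExt_horiz {g : Space N → ℝ} {B : ℝ} {K : NNReal} (hg : LipschitzWith K g)
    (hB : ∀ x, |g x| ≤ B) (z : ℝ) : LipschitzWith K (fun x => harmonicExt g (x, z)) := by
  refine LipschitzWith.of_dist_le_mul fun x x' => ?_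
  have hi : ∀ x, Integrable (fun h => poissonKernel h 1 * g (x + max z 0 • h)) := fun x =>
    (integrable_poissonKernel one_pos).mul_bdd (c := B)
      (hg.continuous.comp (by fun_prop)).aestronglyMeasurable
      (Eventually.of_forall fun y => by simpa using hB _)
  rw [Real.dist_eq, harmonicExt_eq_integral_dilate, harmonicExt_eq_integral_dilate,
    ← integral_sub (hi x) (hi x'), ← Real.norm_eq_abs]
  refine (norm_integral_le_of_norm_le
    ((integrable_poissonKernel one_pos).mul_const (K * dist x x'))
    (Eventually.of_forall fun h => ?_)).trans_eq ?_
  · rw [← mul_sub, norm_mul, Real.norm_of_nonneg (poissonKernel_nonneg zero_le_one _)]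
    refine mul_le_mul_of_nonneg_left ?_ (poissonKernel_nonneg zero_le_one _)
    have := hg.dist_le_mul (x + max z 0 • h) (x' + max z 0 • h)
    rwa [dist_add_right, Real.dist_eq] at this
  · rw [integral_mul_const, integral_poissonKernel one_pos, one_mul]

section Limits

variable {g : Space N → ℝ} {G : ℕ → Space N → ℝ} {B : ℝ}

lemma tendsto_harmonicExt (hG : ∀ n, Measurable (G n)) (hB : ∀ n x, |G n x| ≤ B)
    (hlim : ∀ᵐ x, Tendsto (fun n => G n x) atTop (𝓝 (g x))) {p : Space N × ℝ} (hz : 0 < p.2) :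
    Tendsto (fun n => harmonicExt (G n) p) atTop (𝓝 (harmonicExt g p)) := by
  simp_rw [harmonicExt_of_pos _ hz]
  refine tendsto_integral_of_dominated_convergence
    (fun y => poissonKernel (p.1 - y) p.2 * B)
    (fun n => ((measurable_sub_poissonKernel p.2 p.1).mul (hG n)).aestronglyMeasurable)
    (((integrable_poissonKernel hz).comp_sub_left p.1).mul_const B)
    (fun n => Eventually.of_forall fun y => ?_) ?_
  · rw [norm_mul, Real.norm_of_nonneg (poissonKernel_nonneg hz.le _)]
    exact mul_le_mul_of_nonneg_left (hB n y) (poissonKernel_nonneg hz.le _)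
  · filter_upwards [hlim] with y hy using hy.const_mul _

lemma tendsto_extDz (hG : ∀ n, Measurable (G n)) (hB : ∀ n x, |G n x| ≤ B)
    (hlim : ∀ᵐ x, Tendsto (fun n => G n x) atTop (𝓝 (g x))) {p : Space N × ℝ} (hz : 0 < p.2) :
    Tendsto (fun n => extDz (G n) p) atTop (𝓝 (extDz g p)) := by
  refine tendsto_integral_of_dominated_convergence
    (fun y => |poissonDz p.2 (p.1 - y)| * B)
    (fun n => ((measurable_sub_poissonDz p.2 p.1).mul (hG n)).aestronglyMeasurable)
    (((integrable_poissonDz hz).comp_sub_left p.1).abs.mul_const B)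
    (fun n => Eventually.of_forall fun y => ?_) ?_
  · rw [norm_mul]
    exact mul_le_mul_of_nonneg_left (hB n y) (abs_nonneg _)
  · filter_upwards [hlim] with y hy using hy.const_mul _

lemma tendsto_extDx (hG : ∀ n, Measurable (G n)) (hB : ∀ n x, |G n x| ≤ B)
    (hlim : ∀ᵐ x, Tendsto (fun n => G n x) atTop (𝓝 (g x))) {p : Space N × ℝ} (hz : 0 < p.2) :
    Tendsto (fun n => extDx (G n) p) atTop (𝓝 (extDx g p)) := by
  refine tendsto_integral_of_dominated_convergence
    (fun y => B * ‖poissonDx p.2 (p.1 - y)‖)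
    (fun n => ((hG n).smul (measurable_sub_poissonDx p.2 p.1)).aestronglyMeasurable)
    (((integrable_poissonDx hz).comp_sub_left p.1).norm.const_mul B)
    (fun n => Eventually.of_forall fun y => ?_) ?_
  · rw [norm_smul]
    exact mul_le_mul_of_nonneg_right (hB n y) (norm_nonneg _)
  · filter_upwards [hlim] with y hy using hy.smul_const _

end Limits

/-! ### Green's formula above a positive height -/

/-- The second vertical derivative of the Poisson kernel; the kernel being harmonic, this is also
minus the divergence of its horizontal gradient. -/
def poissonDzz (z : ℝ) (x : Space N) : ℝ :=
  poissonConst N * (N + 1) * z * (-3 * (z ^ 2 + ‖x‖ ^ 2) ^ (-(((N : ℝ) + 3) / 2))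
    + (N + 3) * z ^ 2 * (z ^ 2 + ‖x‖ ^ 2) ^ (-(((N : ℝ) + 3) / 2) - 1))

lemma hasDerivAt_poissonDz {z : ℝ} (hz : 0 < z) (x : Space N) :
    HasDerivAt (fun z => poissonDz z x) (poissonDzz z x) z := by
  have hA : 0 < z ^ 2 + ‖x‖ ^ 2 := by positivity
  have h1 : HasDerivAt (fun z : ℝ => z ^ 2 + ‖x‖ ^ 2) (2 * z) z := by
    simpa using (hasDerivAt_pow 2 z).add_const (‖x‖ ^ 2)
  have h2 := h1.rpow_const (p := -(((N : ℝ) + 1) / 2)) (Or.inl hA.ne')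
  have h3 := h1.rpow_const (p := -(((N : ℝ) + 3) / 2)) (Or.inl hA.ne')
  have h4 := (hasDerivAt_pow 2 z).const_mul ((N : ℝ) + 1)
  have h5 := (h2.sub (h4.mul h3)).const_mul (poissonConst N)
  refine h5.congr_deriv ?_
  have : -(((N : ℝ) + 1) / 2) - 1 = -(((N : ℝ) + 3) / 2) := by ring
  rw [this]
  simp only [poissonDzz]
  push_cast
  ring

lemma poissonDx_apply (z : ℝ) (x : Space N) (j : Fin N) : poissonDx z x j =
    -(poissonConst N * (N + 1) * z) * ((z ^ 2 + ‖x‖ ^ 2) ^ (-(((N : ℝ) + 3) / 2)) * x j) := by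
  simp only [poissonDx, PiLp.smul_apply, smul_eq_mul]; ring

lemma hasFDerivAt_poissonDx_apply {z : ℝ} (hz : 0 < z) (x : Space N) (j : Fin N) :
    HasFDerivAt (fun x => poissonDx z x j)
      (-(poissonConst N * (N + 1) * z) •
        ((z ^ 2 + ‖x‖ ^ 2) ^ (-(((N : ℝ) + 3) / 2)) • (EuclideanSpace.proj j : Space N →L[ℝ] ℝ)
        + x j • (-(2 * (((N : ℝ) + 3) / 2)) * (z ^ 2 + ‖x‖ ^ 2) ^ (-(((N : ℝ) + 3) / 2) - 1)) •
          innerSL ℝ x)) x := by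
  have h1 := hasFDerivAt_rpow_norm_sq hz (((N : ℝ) + 3) / 2) x
  have h2 : HasFDerivAt (fun x : Space N => x j) (EuclideanSpace.proj j : Space N →L[ℝ] ℝ) x :=
    (EuclideanSpace.proj j : Space N →L[ℝ] ℝ).hasFDerivAt
  have h3 := (h1.mul h2).const_mul (-(poissonConst N * (N + 1) * z))
  have e : (fun x : Space N => poissonDx z x j) = fun x => -(poissonConst N * (N + 1) * z) *
      ((z ^ 2 + ‖x‖ ^ 2) ^ (-(((N : ℝ) + 3) / 2)) * x j) :=
    funext fun x => poissonDx_apply z x j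
  rw [e]
  exact h3

lemma exists_lipschitz_poissonDx_apply {z : ℝ} (hz : 0 < z) (j : Fin N) :
    ∃ K, LipschitzWith K (fun x : Space N => poissonDx z x j) := by
  have hc := poissonConst_pos N
  set C : ℝ := poissonConst N * (N + 1) * z * ((N + 4) * (z ^ 2) ^ (-(((N : ℝ) + 3) / 2)))
  have hC : 0 ≤ C := by positivity
  refine ⟨C.toNNReal, lipschitzWith_of_nnnorm_fderiv_le
    (fun x => (hasFDerivAt_poissonDx_apply hz x j).differentiableAt) fun x => ?_⟩
  rw [(hasFDerivAt_poissonDx_apply hz x j).fderiv, ← NNReal.coe_le_coe, coe_nnnorm,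
    Real.coe_toNNReal _ hC]
  have hA : 0 < z ^ 2 + ‖x‖ ^ 2 := by positivity
  set b : ℝ := ((N : ℝ) + 3) / 2 with hb
  have hxj : ‖x j‖ ≤ ‖x‖ := PiLp.norm_apply_le x j
  have hp : ‖(EuclideanSpace.proj j : Space N →L[ℝ] ℝ)‖ ≤ 1 :=
    ContinuousLinearMap.opNorm_le_bound _ zero_le_one fun v => by
      simpa using PiLp.norm_apply_le v j
  have hm : (z ^ 2 + ‖x‖ ^ 2) ^ (-b) ≤ (z ^ 2) ^ (-b) :=
    Real.rpow_le_rpow_of_nonpos (by positivity) (by nlinarith [sq_nonneg ‖x‖]) (by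
      rw [hb]; have : (0 : ℝ) ≤ N := Nat.cast_nonneg N
      linarith)
  have hs : (z ^ 2 + ‖x‖ ^ 2) ^ (-b - 1) * (z ^ 2 + ‖x‖ ^ 2) = (z ^ 2 + ‖x‖ ^ 2) ^ (-b) := by
    nth_rewrite 2 [← Real.rpow_one (z ^ 2 + ‖x‖ ^ 2)]
    rw [← Real.rpow_add hA]; ring_nf
  set D := (z ^ 2 + ‖x‖ ^ 2) ^ (-b - 1)
  have hD : 0 ≤ D := by positivity
  rw [norm_smul, norm_neg, Real.norm_of_nonneg (by positivity : 0 ≤ poissonConst N * (N + 1) * z)]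
  refine mul_le_mul_of_nonneg_left ?_ (by positivity)
  refine (norm_add_le _ _).trans ?_
  rw [norm_smul, norm_smul, norm_smul, innerSL_apply_norm, norm_mul, norm_neg,
    Real.norm_of_nonneg (by positivity : 0 ≤ 2 * b), Real.norm_of_nonneg hD,
    Real.norm_of_nonneg (by positivity : 0 ≤ (z ^ 2 + ‖x‖ ^ 2) ^ (-b))]
  calc (z ^ 2 + ‖x‖ ^ 2) ^ (-b) * ‖(EuclideanSpace.proj j : Space N →L[ℝ] ℝ)‖
        + ‖x j‖ * (2 * b * D * ‖x‖)
      ≤ (z ^ 2 + ‖x‖ ^ 2) ^ (-b) * 1 + ‖x‖ * (2 * b * D * ‖x‖) := by gcongr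
    _ ≤ (z ^ 2 + ‖x‖ ^ 2) ^ (-b) + 2 * b * (D * (z ^ 2 + ‖x‖ ^ 2)) := by
        have : 0 ≤ 2 * b * (D * z ^ 2) := by positivity
        nlinarith
    _ ≤ (N + 4) * (z ^ 2) ^ (-b) := by
        rw [hs, show 2 * b = N + 3 by rw [hb]; ring]
        nlinarith [mul_le_mul_of_nonneg_left hm (by positivity : (0:ℝ) ≤ N + 4)]

lemma clm_apply_eq_sum (A : Space N →L[ℝ] ℝ) (v : Space N) :
    A v = ∑ j, A (EuclideanSpace.single j 1) * v j := by
  conv_lhs => rw [← (EuclideanSpace.basisFun (Fin N) ℝ).sum_repr v]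
  simp [mul_comm]

/-- Horizontal integration by parts against the gradient of the Poisson kernel. -/
lemma integral_fderiv_poissonDx {w : Space N → ℝ} {K : NNReal} (hw : LipschitzWith K w)
    (hc : HasCompactSupport w) {z : ℝ} (hz : 0 < z) (y : Space N) :
    ∫ x, fderiv ℝ w x (poissonDx z (x - y)) = ∫ x, w x * poissonDzz z (x - y) := by
  have hl : ∀ j, ∃ K, LipschitzWith K (fun x : Space N => poissonDx z (x - y) j) := fun j => by
    obtain ⟨K, hK⟩ := exists_lipschitz_poissonDx_apply hz j
    exact ⟨_, hK.comp (LipschitzWith.id.sub (LipschitzWith.const y))⟩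
  have hb : ∀ j, ∃ C, ∀ x : Space N, ‖poissonDx z (x - y) j‖ ≤ C := fun j =>
    ⟨poissonConst N * (N + 1) * decay z (0 : Space N), fun x => by
      refine (PiLp.norm_apply_le _ j).trans ((norm_poissonDx_le hz _).trans ?_)
      have := poissonConst_pos N
      gcongr
      unfold decay
      refine Real.rpow_le_rpow_of_nonpos (by positivity) (by simp) ?_
      have : (0 : ℝ) ≤ N := Nat.cast_nonneg N
      linarith⟩
  have hwi : Integrable w := hw.continuous.integrable_of_hasCompactSupport hc
  have hm : ∀ j, AEStronglyMeasurable (fun x : Space N => poissonDx z (x - y) j) := fun j =>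
    (hl j).choose_spec.continuous.aestronglyMeasurable
  have hld : ∀ (u : Space N → ℝ) (C : NNReal), LipschitzWith C u → ∀ v, 
      AEStronglyMeasurable (fun x => lineDeriv ℝ u x v) ∧ ∀ x, ‖lineDeriv ℝ u x v‖ ≤ C * ‖v‖ :=
    fun u C hu v => ⟨(measurable_lineDeriv hu.continuous).aestronglyMeasurable,
      fun x => norm_lineDeriv_le_of_lipschitz ℝ hu⟩
  have hdd : ∀ x j, lineDeriv ℝ w x (EuclideanSpace.single j 1) ≠ 0 → x ∈ tsupport w := by
    intro x j hne
    by_contra hx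
    have h0 : w =ᶠ[𝓝 x] fun _ => 0 := by
      rw [notMem_tsupport_iff_eventuallyEq] at hx; exact hx
    apply hne
    rw [h0.lineDeriv_eq]
    simp [lineDeriv]
  have key : ∀ j, Integrable (fun x => lineDeriv ℝ w x (EuclideanSpace.single j 1) *
      poissonDx z (x - y) j) := fun j => by
    obtain ⟨C, hC⟩ := hb j
    have h1 : Integrable (fun x => lineDeriv ℝ w x (EuclideanSpace.single j 1)) := by
      have : IntegrableOn (fun x => lineDeriv ℝ w x (EuclideanSpace.single j 1)) (tsupport w) :=
        Measure.integrableOn_of_bounded hc.isCompact.measure_lt_top.ne (hld w K hw _).1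
          (ae_of_all _ (hld w K hw _).2)
      rwa [integrableOn_iff_integrable_of_support_subset] at this
      intro x hx
      exact hdd x j hx
    exact h1.mul_bdd (c := C) (hm j) (ae_of_all _ hC)
  have e1 : ∫ x, fderiv ℝ w x (poissonDx z (x - y)) =
      ∫ x, ∑ j, lineDeriv ℝ w x (EuclideanSpace.single j 1) * poissonDx z (x - y) j := by
    refine integral_congr_ae ?_
    filter_upwards [hw.ae_differentiableAt] with x hx
    rw [clm_apply_eq_sum]
    simp_rw [hx.lineDeriv_eq_fderiv]
  have e2 : ∀ j, ∫ x, lineDeriv ℝ w x (EuclideanSpace.single j 1) * poissonDx z (x - y) j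
      = -∫ x, fderiv ℝ (fun x => poissonDx z x j) (x - y) (EuclideanSpace.single j 1) * w x := by
    intro j
    obtain ⟨K', hK'⟩ := hl j
    have h := hK'.integral_lineDeriv_mul_eq (μ := volume) hw hc (EuclideanSpace.single j 1)
    simp_rw [lineDeriv_neg, neg_mul, integral_neg] at h
    rw [← neg_eq_iff_eq_neg.mpr h]
    congr 2
    funext x
    congr 1
    have h1 := (hasFDerivAt_poissonDx_apply hz (x - y) j)
    have h2 := h1.comp x ((hasFDerivAt_id x).sub_const y)
    rw [h1.fderiv]
    exact (h2.hasLineDerivAt (EuclideanSpace.single j 1)).lineDeriv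
  have key2 : ∀ j, Integrable (fun x =>
      fderiv ℝ (fun x => poissonDx z x j) (x - y) (EuclideanSpace.single j 1) * w x) := by
    intro j
    obtain ⟨K', hK'⟩ := exists_lipschitz_poissonDx_apply hz j
    refine hwi.bdd_mul (c := K' * ‖(EuclideanSpace.single j 1 : Space N)‖) ?_
      (ae_of_all _ fun x => ?_)
    · exact ((measurable_fderiv_apply_const ℝ _ _).comp
        (measurable_id.sub_const y)).aestronglyMeasurable
    · refine (ContinuousLinearMap.le_opNorm _ _).trans ?_
      gcongr
      exact norm_fderiv_le_of_lipschitz ℝ hK'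
  rw [e1, integral_finsetSum _ fun j _ => key j, Finset.sum_congr rfl fun j _ => e2 j,
    Finset.sum_neg_distrib, ← integral_finsetSum _ fun j _ => key2 j, ← integral_neg]
  congr 1
  funext x
  rw [Finset.sum_congr rfl fun j _ => by rw [(hasFDerivAt_poissonDx_apply hz (x - y) j).fderiv]]
  rw [← Finset.sum_mul, ← neg_mul, mul_comm]
  congr 1
  set X := x - y
  have hX : ∑ j, X j ^ 2 = ‖X‖ ^ 2 := by rw [EuclideanSpace.real_norm_sq_eq]
  have hA : 0 < z ^ 2 + ‖X‖ ^ 2 := by positivity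
  have hs : (z ^ 2 + ‖X‖ ^ 2) ^ (-(((N : ℝ) + 3) / 2)) =
      (z ^ 2 + ‖X‖ ^ 2) ^ (-(((N : ℝ) + 3) / 2) - 1) * (z ^ 2 + ‖X‖ ^ 2) := by
    nth_rewrite 3 [← Real.rpow_one (z ^ 2 + ‖X‖ ^ 2)]
    rw [← Real.rpow_add hA]; ring_nf
  have hterm : ∀ j : Fin N, (-(poissonConst N * (N + 1) * z) •
        ((z ^ 2 + ‖X‖ ^ 2) ^ (-(((N : ℝ) + 3) / 2)) • (EuclideanSpace.proj j : Space N →L[ℝ] ℝ)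
        + X j • (-(2 * (((N : ℝ) + 3) / 2)) * (z ^ 2 + ‖X‖ ^ 2) ^ (-(((N : ℝ) + 3) / 2) - 1)) •
          innerSL ℝ X)) (EuclideanSpace.single j 1)
      = -(poissonConst N * (N + 1) * z) * (z ^ 2 + ‖X‖ ^ 2) ^ (-(((N : ℝ) + 3) / 2))
        + (poissonConst N * (N + 1) * z) * ((N : ℝ) + 3)
          * (z ^ 2 + ‖X‖ ^ 2) ^ (-(((N : ℝ) + 3) / 2) - 1) * X j ^ 2 := by
    intro j
    have hin : inner ℝ X (EuclideanSpace.single j 1) = X j := by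
      simp [EuclideanSpace.inner_single_right]
    simp [hin]
    ring
  simp_rw [hterm]
  rw [Finset.sum_add_distrib, ← Finset.mul_sum, ← Finset.mul_sum, hX]
  simp only [Finset.sum_const, Finset.card_univ, Fintype.card_fin, nsmul_eq_mul, poissonDzz]
  rw [hs]
  ring

/-- Test functions on the closed half space: continuous, horizontally Lipschitz, vertically
Lipschitz away from the bottom, and vanishing for `‖x‖ ≥ R` and for `z ≥ Z`. -/
structure IsTest (w : Space N × ℝ → ℝ) (R Z : ℝ) (K : NNReal) : Prop where
  cont : Continuous w
  horiz : ∀ z, 0 ≤ z → LipschitzWith K (fun x => w (x, z))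
  vert : ∀ ε, 0 < ε → ∃ K' : NNReal, ∀ x, LipschitzOnWith K' (fun z => w (x, z)) (Icc ε Z)
  eq_zero : ∀ p : Space N × ℝ, 0 ≤ p.2 → (R ≤ ‖p.1‖ ∨ Z ≤ p.2) → w p = 0

/-- The region of the half space above height `ε` in which a test function lives. -/
def slab (N : ℕ) (R Z ε : ℝ) : Set (Space N × ℝ) := Metric.closedBall 0 R ×ˢ Ioo ε Z

lemma measurableSet_slab (R Z ε : ℝ) : MeasurableSet (slab N R Z ε) :=
  measurableSet_closedBall.prod measurableSet_Ioo

lemma volume_restrict_slab (R Z ε : ℝ) :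
    (volume.restrict (slab N R Z ε) : Measure (Space N × ℝ)) =
      (volume.restrict (Metric.closedBall 0 R)).prod (volume.restrict (Ioo ε Z)) := by
  rw [slab, Measure.volume_eq_prod, Measure.prod_restrict]

instance isFiniteMeasure_slab (R Z ε : ℝ) :
    IsFiniteMeasure (volume.restrict (slab N R Z ε) : Measure (Space N × ℝ)) := by
  rw [volume_restrict_slab]
  have : IsFiniteMeasure (volume.restrict (Metric.closedBall (0 : Space N) R)) :=
    ⟨by simpa using measure_closedBall_lt_top⟩
  infer_instance

lemma measurable_fderiv_horiz {w : Space N × ℝ → ℝ} (hw : Continuous w) :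
    Measurable (fun p : Space N × ℝ => fderiv ℝ (fun x => w (x, p.2)) p.1) := by
  have h : Continuous (Function.uncurry fun (z : ℝ) (x : Space N) => w (x, z)) := by
    unfold Function.uncurry; fun_prop
  exact (measurable_fderiv_with_param ℝ h).comp measurable_swap

lemma measurable_deriv_vert {w : Space N × ℝ → ℝ} (hw : Continuous w) :
    Measurable (fun p : Space N × ℝ => deriv (fun z => w (p.1, z)) p.2) := by
  have h : Continuous (Function.uncurry fun (x : Space N) (z : ℝ) => w (x, z)) := by
    unfold Function.uncurry; fun_prop
  exact measurable_deriv_with_param h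

namespace IsTest

variable {w : Space N × ℝ → ℝ} {R Z : ℝ} {K : NNReal}

lemma hasCompactSupport (hw : IsTest w R Z K) {z : ℝ} (hz : 0 ≤ z) :
    HasCompactSupport (fun x => w (x, z)) := by
  refine HasCompactSupport.of_support_subset_isCompact (isCompact_closedBall (0 : Space N) R) ?_
  intro x hx
  by_contra hR
  rw [mem_closedBall_zero_iff, not_le] at hR
  exact hx (hw.eq_zero (x, z) hz (Or.inl hR.le))

lemma norm_fderiv_le (hw : IsTest w R Z K) {p : Space N × ℝ} (hz : 0 ≤ p.2) :
    ‖fderiv ℝ (fun x => w (x, p.2)) p.1‖ ≤ K :=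
  norm_fderiv_le_of_lipschitz ℝ (hw.horiz p.2 hz)

lemma fderiv_eq_zero (hw : IsTest w R Z K) {p : Space N × ℝ} (hz : 0 ≤ p.2) (hx : R < ‖p.1‖) :
    fderiv ℝ (fun x => w (x, p.2)) p.1 = 0 := by
  have : (fun x => w (x, p.2)) =ᶠ[𝓝 p.1] fun _ => 0 := by
    filter_upwards [continuous_norm.continuousAt.eventually (lt_mem_nhds hx)] with x hx
    exact hw.eq_zero (x, p.2) hz (Or.inl hx.le)
  rw [this.fderiv_eq]; simp

lemma exists_bound (hw : IsTest w R Z K) : ∃ B, 0 ≤ B ∧ ∀ p : Space N × ℝ, 0 ≤ p.2 → |w p| ≤ B := by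
  obtain ⟨B, hB⟩ := ((isCompact_closedBall (0 : Space N) R).prod
    (isCompact_Icc (a := (0 : ℝ)) (b := Z))).exists_bound_of_continuousOn hw.cont.continuousOn
  refine ⟨max B 0, le_max_right _ _, fun p hp => ?_⟩
  by_cases h : R ≤ ‖p.1‖ ∨ Z ≤ p.2
  · rw [hw.eq_zero p hp h]; simp
  · push Not at h
    exact (hB p ⟨by simpa using h.1.le, hp, h.2.le⟩).trans (le_max_left _ _)

lemma norm_deriv_le (hw : IsTest w R Z K) {ε : ℝ} (hε : 0 < ε) :
    ∃ K' : NNReal, ∀ p : Space N × ℝ, p.2 ∈ Ioo ε Z → ‖deriv (fun z => w (p.1, z)) p.2‖ ≤ K' := by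
  obtain ⟨K', hK'⟩ := hw.vert ε hε
  exact ⟨K', fun p hp => norm_deriv_le_of_lipschitzOn (Icc_mem_nhds hp.1 hp.2) (hK' p.1)⟩

end IsTest

lemma decay_le_decay_zero (z : ℝ) {ε : ℝ} (hε : 0 < ε) (h : ε ≤ z) (x : Space N) :
    decay z x ≤ decay ε (0 : Space N) := by
  unfold decay
  refine Real.rpow_le_rpow_of_nonpos (by positivity) ?_ ?_
  · have : ε ^ 2 ≤ z ^ 2 := by gcongr
    simp only [norm_zero]
    nlinarith [sq_nonneg ‖x‖]
  · have : (0 : ℝ) ≤ N := Nat.cast_nonneg N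
    linarith

lemma exists_bound_poissonDzz {ε Z : ℝ} (hε : 0 < ε) : ∃ C, ∀ z ∈ Icc ε Z, ∀ x : Space N,
    |poissonDzz z x| ≤ C := by
  have hc := poissonConst_pos N
  refine ⟨poissonConst N * (N + 1) * Z * ((N + 6) * (ε ^ 2) ^ (-(((N : ℝ) + 3) / 2))),
    fun z hz x => ?_⟩
  have hz0 : 0 < z := hε.trans_le hz.1
  have hZ0 : 0 < Z := hz0.trans_le hz.2
  have hA : 0 < z ^ 2 + ‖x‖ ^ 2 := by positivity
  set b : ℝ := ((N : ℝ) + 3) / 2 with hb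
  have hm : (z ^ 2 + ‖x‖ ^ 2) ^ (-b) ≤ (ε ^ 2) ^ (-b) :=
    Real.rpow_le_rpow_of_nonpos (by positivity) (by
      have : ε ^ 2 ≤ z ^ 2 := pow_le_pow_left₀ hε.le hz.1 2
      nlinarith [sq_nonneg ‖x‖]) (by
      rw [hb]; have : (0 : ℝ) ≤ N := Nat.cast_nonneg N
      linarith)
  have hs : (z ^ 2 + ‖x‖ ^ 2) ^ (-b - 1) * (z ^ 2 + ‖x‖ ^ 2) = (z ^ 2 + ‖x‖ ^ 2) ^ (-b) := by
    nth_rewrite 2 [← Real.rpow_one (z ^ 2 + ‖x‖ ^ 2)]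
    rw [← Real.rpow_add hA]; ring_nf
  set D := (z ^ 2 + ‖x‖ ^ 2) ^ (-b - 1)
  have hD : 0 ≤ D := by positivity
  unfold poissonDzz
  rw [abs_mul, abs_of_nonneg (by positivity : 0 ≤ poissonConst N * (N + 1) * z)]
  refine mul_le_mul (by have := hz.2; gcongr) ?_ (abs_nonneg _) (by positivity)
  refine le_trans ?_ (mul_le_mul_of_nonneg_left hm (by positivity))
  rw [← hs]
  have hN : (0 : ℝ) ≤ N := Nat.cast_nonneg N
  have h1 : 0 ≤ D * z ^ 2 := by positivity
  have h2 : 0 ≤ D * ‖x‖ ^ 2 := by positivity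
  rw [abs_le]
  constructor <;> nlinarith [mul_nonneg hN h1, mul_nonneg hN h2]

lemma measurable_clm_apply {α : Type*} [MeasurableSpace α] {A : α → Space N →L[ℝ] ℝ}
    {v : α → Space N} (hA : Measurable A) (hv : Measurable v) : Measurable fun a => A a (v a) := by
  simp_rw [fun a => clm_apply_eq_sum (A a) (v a)]
  refine Finset.measurable_sum _ fun j _ => (hA.apply_continuousLinearMap _).mul ?_
  exact (EuclideanSpace.proj j : Space N →L[ℝ] ℝ).continuous.measurable.comp hv

lemma measurable_poissonDx_comp {α : Type*} [MeasurableSpace α] {f : α → ℝ} {u : α → Space N}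
    (hf : Measurable f) (hu : Measurable u) : Measurable fun a => poissonDx (f a) (u a) := by
  unfold poissonDx; fun_prop

lemma measurable_poissonDz_comp {α : Type*} [MeasurableSpace α] {f : α → ℝ} {u : α → Space N}
    (hf : Measurable f) (hu : Measurable u) : Measurable fun a => poissonDz (f a) (u a) := by
  unfold poissonDz decay; fun_prop

lemma measurable_poissonDzz_comp {α : Type*} [MeasurableSpace α] {f : α → ℝ} {u : α → Space N}
    (hf : Measurable f) (hu : Measurable u) : Measurable fun a => poissonDzz (f a) (u a) := by
  unfold poissonDzz; fun_prop

lemma integrable_mul_kernel {a k : Space N → ℝ} (ha : Integrable a) (hk : Integrable k) :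
    Integrable (fun p : Space N × Space N => a p.1 * k (p.1 - p.2)) (volume.prod volume) := by
  have h := (Integrable.convolution_integrand (ContinuousLinearMap.mul ℝ ℝ) ha hk.comp_neg).swap
  simpa [Function.comp_def] using h

namespace IsTest

variable {w : Space N × ℝ → ℝ} {R Z : ℝ} {K : NNReal}

/-- Vertical integration by parts against the Poisson kernel. -/
lemma integral_deriv_poissonDz (hw : IsTest w R Z K) {ε : ℝ} (hε : 0 < ε) (hεZ : ε ≤ Z)
    (x y : Space N) :
    ∫ z in Ioo ε Z, deriv (fun z => w (x, z)) z * poissonDz z (x - y)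
      = - (w (x, ε) * poissonDz ε (x - y)) - ∫ z in Ioo ε Z, w (x, z) * poissonDzz z (x - y) := by
  obtain ⟨K', hK'⟩ := hw.vert ε hε
  obtain ⟨C, hC⟩ := exists_bound_poissonDzz (N := N) (Z := Z) hε
  have hac1 : AbsolutelyContinuousOnInterval (fun z => w (x, z)) ε Z :=
    LipschitzOnWith.absolutelyContinuousOnInterval (K := K') (by rw [uIcc_of_le hεZ]; exact hK' x)
  have hd : ∀ z ∈ Icc ε Z, HasDerivAt (fun z => poissonDz z (x - y)) (poissonDzz z (x - y)) z :=
    fun z hz => hasDerivAt_poissonDz (hε.trans_le hz.1) _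
  have hac2 : AbsolutelyContinuousOnInterval (fun z => poissonDz z (x - y)) ε Z := by
    refine LipschitzOnWith.absolutelyContinuousOnInterval (K := C.toNNReal) ?_
    rw [uIcc_of_le hεZ]
    refine (convex_Icc ε Z).lipschitzOnWith_of_nnnorm_hasDerivWithin_le
      (fun z hz => (hd z hz).hasDerivWithinAt) fun z hz => ?_
    rw [← NNReal.coe_le_coe, coe_nnnorm]
    exact (hC z hz _).trans (Real.le_coe_toNNReal C)
  have h := hac2.integral_mul_deriv_eq_deriv_mul hac1
  rw [intervalIntegral.integral_of_le hεZ, intervalIntegral.integral_of_le hεZ,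
    integral_Ioc_eq_integral_Ioo, integral_Ioc_eq_integral_Ioo,
    hw.eq_zero (x, Z) (hε.le.trans hεZ) (Or.inr le_rfl)] at h
  have h2 : ∫ z in Ioo ε Z, deriv (fun z => poissonDz z (x - y)) z * w (x, z)
      = ∫ z in Ioo ε Z, w (x, z) * poissonDzz z (x - y) := by
    refine setIntegral_congr_fun measurableSet_Ioo fun z hz => ?_
    beta_reduce
    rw [(hd z (Ioo_subset_Icc_self hz)).deriv, mul_comm]
  rw [h2] at h
  simp_rw [mul_comm (deriv _ _)]
  rw [h]
  ring

/-- Green's formula against the Poisson kernel with a fixed pole. -/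
lemma green_kernel (hw : IsTest w R Z K) {ε : ℝ} (hε : 0 < ε) (hεZ : ε ≤ Z) (y : Space N) :
    ∫ p in slab N R Z ε, (fderiv ℝ (fun x => w (x, p.2)) p.1 (poissonDx p.2 (p.1 - y))
      + deriv (fun z => w (p.1, z)) p.2 * poissonDz p.2 (p.1 - y))
    = - ∫ x, w (x, ε) * poissonDz ε (x - y) := by
  obtain ⟨K', hK'⟩ := hw.norm_deriv_le hε
  obtain ⟨C, hC⟩ := exists_bound_poissonDzz (N := N) (Z := Z) hε
  obtain ⟨B, hB0, hB⟩ := hw.exists_bound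
  have hc := poissonConst_pos N
  have hms := measurableSet_slab (N := N) R Z ε
  have hm1 : Measurable fun p : Space N × ℝ =>
      fderiv ℝ (fun x => w (x, p.2)) p.1 (poissonDx p.2 (p.1 - y)) :=
    measurable_clm_apply (measurable_fderiv_horiz hw.cont)
      (measurable_poissonDx_comp measurable_snd (measurable_fst.sub_const y))
  have hm2 : Measurable fun p : Space N × ℝ =>
      deriv (fun z => w (p.1, z)) p.2 * poissonDz p.2 (p.1 - y) :=
    (measurable_deriv_vert hw.cont).mul
      (measurable_poissonDz_comp measurable_snd (measurable_fst.sub_const y))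
  have hm3 : Measurable fun p : Space N × ℝ => w p * poissonDzz p.2 (p.1 - y) :=
    hw.cont.measurable.mul
      (measurable_poissonDzz_comp measurable_snd (measurable_fst.sub_const y))
  have hdec : ∀ p ∈ slab N R Z ε, decay p.2 (p.1 - y) ≤ decay ε (0 : Space N) := fun p hp =>
    decay_le_decay_zero p.2 hε hp.2.1.le _
  have hi1 : Integrable (fun p : Space N × ℝ =>
      fderiv ℝ (fun x => w (x, p.2)) p.1 (poissonDx p.2 (p.1 - y)))
      (volume.restrict (slab N R Z ε)) := by
    refine Integrable.of_bound hm1.aestronglyMeasurable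
      (K * (poissonConst N * (N + 1) * decay ε (0 : Space N)))
      ((ae_restrict_iff' hms).mpr (ae_of_all _ fun p hp => ?_))
    have hz : 0 < p.2 := hε.trans hp.2.1
    refine (ContinuousLinearMap.le_opNorm _ _).trans ?_
    gcongr
    · exact hw.norm_fderiv_le hz.le
    · exact (norm_poissonDx_le hz _).trans (by gcongr; exact hdec p hp)
  have hi2 : Integrable (fun p : Space N × ℝ =>
      deriv (fun z => w (p.1, z)) p.2 * poissonDz p.2 (p.1 - y))
      (volume.restrict (slab N R Z ε)) := by
    refine Integrable.of_bound hm2.aestronglyMeasurable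
      (K' * (poissonConst N * (N + 1) * decay ε (0 : Space N)))
      ((ae_restrict_iff' hms).mpr (ae_of_all _ fun p hp => ?_))
    have hz : 0 < p.2 := hε.trans hp.2.1
    rw [norm_mul]
    gcongr
    · exact hK' p hp.2
    · exact (abs_poissonDz_le hz _).trans (by gcongr; exact hdec p hp)
  have hi3 : Integrable (fun p : Space N × ℝ => w p * poissonDzz p.2 (p.1 - y))
      (volume.restrict (slab N R Z ε)) := by
    refine Integrable.of_bound hm3.aestronglyMeasurable (B * C)
      ((ae_restrict_iff' hms).mpr (ae_of_all _ fun p hp => ?_))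
    rw [norm_mul]
    gcongr
    · exact hB p (hε.trans hp.2.1).le
    · exact hC p.2 (Ioo_subset_Icc_self hp.2) _
  rw [integral_add hi1 hi2]
  rw [volume_restrict_slab] at hi1 hi2 hi3 ⊢
  have e1 : ∫ p, fderiv ℝ (fun x => w (x, p.2)) p.1 (poissonDx p.2 (p.1 - y))
        ∂(volume.restrict (Metric.closedBall 0 R)).prod (volume.restrict (Ioo ε Z))
      = ∫ p, w p * poissonDzz p.2 (p.1 - y)
        ∂(volume.restrict (Metric.closedBall 0 R)).prod (volume.restrict (Ioo ε Z)) := by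
    rw [integral_prod_symm _ hi1, integral_prod_symm _ hi3]
    refine setIntegral_congr_fun measurableSet_Ioo fun z hz => ?_
    have hz0 : 0 < z := hε.trans hz.1
    simp only
    rw [setIntegral_eq_integral_of_forall_compl_eq_zero,
      setIntegral_eq_integral_of_forall_compl_eq_zero]
    · exact integral_fderiv_poissonDx (hw.horiz z hz0.le) (hw.hasCompactSupport hz0.le) hz0 y
    · intro x hx
      rw [mem_closedBall_zero_iff, not_le] at hx
      rw [hw.eq_zero (x, z) hz0.le (Or.inl hx.le), zero_mul]
    · intro x hx
      rw [mem_closedBall_zero_iff, not_le] at hx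
      have := hw.fderiv_eq_zero (p := (x, z)) hz0.le hx
      simp only at this
      rw [this]; simp
  have e2 : ∫ p, deriv (fun z => w (p.1, z)) p.2 * poissonDz p.2 (p.1 - y)
        ∂(volume.restrict (Metric.closedBall 0 R)).prod (volume.restrict (Ioo ε Z))
      = (-∫ x, w (x, ε) * poissonDz ε (x - y)) - ∫ p, w p * poissonDzz p.2 (p.1 - y)
        ∂(volume.restrict (Metric.closedBall 0 R)).prod (volume.restrict (Ioo ε Z)) := by
    have hwi : Integrable (fun x => w (x, ε)) :=
      (hw.horiz ε hε.le).continuous.integrable_of_hasCompactSupport (hw.hasCompactSupport hε.le)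
    have hwi2 : Integrable (fun x => w (x, ε) * poissonDz ε (x - y)) :=
      hwi.mul_bdd (c := poissonConst N * (N + 1) * decay ε (0 : Space N))
        (measurable_poissonDz_comp measurable_const
          (measurable_id.sub_const y)).aestronglyMeasurable
        (ae_of_all _ fun x => (abs_poissonDz_le hε _).trans (by
          gcongr; exact decay_le_decay_zero ε hε le_rfl _))
    have e3 : -∫ x, w (x, ε) * poissonDz ε (x - y)
        = ∫ x in Metric.closedBall 0 R, -(w (x, ε) * poissonDz ε (x - y)) := by
      rw [integral_neg, setIntegral_eq_integral_of_forall_compl_eq_zero]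
      intro x hx
      rw [mem_closedBall_zero_iff, not_le] at hx
      rw [hw.eq_zero (x, ε) hε.le (Or.inl hx.le), zero_mul]
    rw [e3, integral_prod _ hi2, integral_prod _ hi3]
    refine Eq.trans ?_ (integral_sub hwi2.integrableOn.neg hi3.integral_prod_left)
    refine setIntegral_congr_fun measurableSet_closedBall fun x _ => ?_
    exact hw.integral_deriv_poissonDz hε hεZ x y
  rw [e1, e2]
  ring

/-- Green's formula in the half space above height `ε`. -/
lemma green (hw : IsTest w R Z K) {g : Space N → ℝ} {B : ℝ} (hg : Measurable g)
    (hB : ∀ x, |g x| ≤ B) {ε : ℝ} (hε : 0 < ε) (hεZ : ε ≤ Z) :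
    IntegrableOn (fun p => fderiv ℝ (fun x => w (x, p.2)) p.1 (extDx g p)
      + deriv (fun z => w (p.1, z)) p.2 * extDz g p) (slab N R Z ε) ∧
    ∫ p in slab N R Z ε, (fderiv ℝ (fun x => w (x, p.2)) p.1 (extDx g p)
      + deriv (fun z => w (p.1, z)) p.2 * extDz g p)
    = - ∫ x, w (x, ε) * extDz g (x, ε) := by
  obtain ⟨K', hK'⟩ := hw.norm_deriv_le hε
  have hc := poissonConst_pos N
  have hB0 : 0 ≤ B := (abs_nonneg _).trans (hB 0)
  have hms := measurableSet_slab (N := N) R Z ε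
  set k : Space N × ℝ → Space N → ℝ := fun p y =>
    (fderiv ℝ (fun x => w (x, p.2)) p.1 (poissonDx p.2 (p.1 - y))
      + deriv (fun z => w (p.1, z)) p.2 * poissonDz p.2 (p.1 - y)) * g y with hk
  have hkm : Measurable (Function.uncurry k) := by
    refine Measurable.mul (Measurable.add ?_ ?_) (hg.comp measurable_snd)
    · exact measurable_clm_apply ((measurable_fderiv_horiz hw.cont).comp measurable_fst)
        (measurable_poissonDx_comp (measurable_snd.comp measurable_fst)
          ((measurable_fst.comp measurable_fst).sub measurable_snd))
    · exact ((measurable_deriv_vert hw.cont).comp measurable_fst).mul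
        (measurable_poissonDz_comp (measurable_snd.comp measurable_fst)
          ((measurable_fst.comp measurable_fst).sub measurable_snd))
  set C : ℝ := (K + K') * (poissonConst N * (N + 1)) * B with hC
  have hkb : ∀ p ∈ slab N R Z ε, ∀ y, ‖k p y‖ ≤ C * decay ε (p.1 - y) := by
    intro p hp y
    have hz : 0 < p.2 := hε.trans hp.2.1
    have hd : decay p.2 (p.1 - y) ≤ decay ε (p.1 - y) := decay_le_decay hε hp.2.1.le _
    have h1 : ‖fderiv ℝ (fun x => w (x, p.2)) p.1 (poissonDx p.2 (p.1 - y))‖ ≤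
        K * (poissonConst N * (N + 1) * decay ε (p.1 - y)) :=
      (ContinuousLinearMap.le_opNorm _ _).trans (mul_le_mul (hw.norm_fderiv_le hz.le)
        ((norm_poissonDx_le hz _).trans (by gcongr)) (norm_nonneg _) K.2)
    have h2 : ‖deriv (fun z => w (p.1, z)) p.2 * poissonDz p.2 (p.1 - y)‖ ≤
        K' * (poissonConst N * (N + 1) * decay ε (p.1 - y)) := by
      rw [norm_mul]
      exact mul_le_mul (hK' p hp.2) ((abs_poissonDz_le hz _).trans (by gcongr))
        (norm_nonneg _) K'.2
    rw [hk]
    simp only [norm_mul]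
    calc _ ≤ (K * (poissonConst N * (N + 1) * decay ε (p.1 - y))
          + K' * (poissonConst N * (N + 1) * decay ε (p.1 - y))) * B :=
          mul_le_mul ((norm_add_le _ _).trans (add_le_add h1 h2)) (hB y) (abs_nonneg _) (by
            have := decay_nonneg ε (p.1 - y)
            have := K.2
            have := K'.2
            positivity)
      _ = _ := by rw [hC]; ring
  have hdint : ∀ x : Space N, Integrable (fun y => C * decay ε (x - y)) := fun x =>
    ((integrable_decay hε).comp_sub_left x).const_mul C
  have hki : ∀ p ∈ slab N R Z ε, Integrable (k p) := fun p hp =>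
    (hdint p.1).mono' (hkm.comp measurable_prodMk_left).aestronglyMeasurable (ae_of_all _ (hkb p hp))
  have hkint : Integrable (Function.uncurry k)
      ((volume.restrict (slab N R Z ε)).prod volume) := by
    rw [integrable_prod_iff hkm.aestronglyMeasurable]
    refine ⟨(ae_restrict_iff' hms).mpr (ae_of_all _ hki), ?_⟩
    refine Integrable.of_bound hkm.aestronglyMeasurable.norm.integral_prod_right'
      (C * ∫ y : Space N, decay ε y) ((ae_restrict_iff' hms).mpr (ae_of_all _ fun p hp => ?_))
    rw [Real.norm_of_nonneg (integral_nonneg fun _ => norm_nonneg _),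
      ← integral_sub_left_eq_self (fun y => decay ε y) volume p.1, ← integral_const_mul]
    exact integral_mono_of_nonneg (ae_of_all _ fun _ => norm_nonneg _) (hdint p.1)
      (ae_of_all _ (hkb p hp))
  have hkeq : ∀ p ∈ slab N R Z ε, ∫ y, k p y = fderiv ℝ (fun x => w (x, p.2)) p.1 (extDx g p)
      + deriv (fun z => w (p.1, z)) p.2 * extDz g p := by
    intro p hp
    have hz : 0 < p.2 := hε.trans hp.2.1
    have i1 := integrable_smul_poissonDx hz hg hB p.1
    have i2 := integrable_kernel_mul (integrable_poissonDz hz) hg hB p.1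
    rw [extDx, extDz, ← ContinuousLinearMap.integral_comp_comm _ i1, ← integral_const_mul,
      ← integral_add (ContinuousLinearMap.integrable_comp _ i1) (i2.const_mul _)]
    congr 1
    funext y
    simp only [hk, map_smul, smul_eq_mul]
    ring
  have hEq : ∫ p in slab N R Z ε, (fderiv ℝ (fun x => w (x, p.2)) p.1 (extDx g p)
      + deriv (fun z => w (p.1, z)) p.2 * extDz g p) = ∫ p in slab N R Z ε, ∫ y, k p y :=
    setIntegral_congr_fun hms fun p hp => (hkeq p hp).symm
  refine ⟨?_, ?_⟩
  · exact (hkint.integral_prod_left.congr ((ae_restrict_iff' hms).mpr (ae_of_all _ hkeq)))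
  rw [hEq, integral_integral_swap hkint]
  simp_rw [hk, integral_mul_const, hw.green_kernel hε hεZ]
  have hwi : Integrable (fun x => w (x, ε)) :=
    (hw.horiz ε hε.le).continuous.integrable_of_hasCompactSupport (hw.hasCompactSupport hε.le)
  have h2 : Integrable (Function.uncurry fun (y x : Space N) =>
      w (x, ε) * poissonDz ε (x - y) * g y) (volume.prod volume) :=
    ((integrable_mul_kernel hwi (integrable_poissonDz hε)).swap).mul_bdd (c := B)
      (hg.comp measurable_fst).aestronglyMeasurable (ae_of_all _ fun p => hB p.1)
  simp_rw [neg_mul, ← integral_mul_const]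
  rw [integral_neg, integral_integral_swap h2]
  simp_rw [mul_assoc, integral_const_mul]
  rfl

end IsTest

/-! ### The bilinear form of the half Laplacian -/

/-- The correlation of the increments of two functions. -/
def incrCorr (g w : Space N → ℝ) (h : Space N) : ℝ := ∫ x, (g (x + h) - g x) * (w (x + h) - w x)

/-- The bilinear form associated with the squared seminorm of `Ḣ^(1/2)`. -/
def energyForm (g w : Space N → ℝ) : ℝ :=
  poissonConst N / 2 * ∫ h, incrCorr g w h / ‖h‖ ^ (N + 1)

/-- The weight that makes second differences integrable. -/
def incrWeight (h : Space N) : ℝ := min 1 (‖h‖ ^ 2) / ‖h‖ ^ (N + 1)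

lemma integrable_incrWeight (hN : 0 < N) : Integrable (incrWeight : Space N → ℝ) := by
  have : Nonempty (Fin N) := ⟨⟨0, hN⟩⟩
  refine (integrable_fun_norm_addHaar volume
    (f := fun r : ℝ => min 1 (r ^ 2) / r ^ (N + 1))).mpr ?_
  rw [finrank_euclideanSpace, Fintype.card_fin]
  have hm : ∀ r ∈ Ioi (0 : ℝ), r ^ (N - 1) • (min 1 (r ^ 2) / r ^ (N + 1)) = min 1 (r ^ 2) / r ^ 2 := by
    intro r hr
    have hr : 0 < r := hr
    obtain ⟨n, rfl⟩ : ∃ n, N = n + 1 := ⟨N - 1, by omega⟩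
    simp only [Nat.add_sub_cancel, smul_eq_mul]
    field_simp
    ring
  rw [integrableOn_congr_fun hm measurableSet_Ioi, ← Ioc_union_Ioi_eq_Ioi zero_le_one,
    integrableOn_union]
  constructor
  · refine Integrable.of_bound (Measurable.aestronglyMeasurable (by fun_prop)) 1
      ((ae_restrict_iff' measurableSet_Ioc).mpr (ae_of_all _ fun r hr => ?_))
    rw [Real.norm_of_nonneg (by positivity)]
    exact div_le_one_of_le₀ (min_le_right _ _) (by positivity)
  · refine ((integrableOn_Ioi_rpow_of_lt (a := -2) (by norm_num) zero_lt_one)).mono'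
      (Measurable.aestronglyMeasurable (by fun_prop))
      ((ae_restrict_iff' measurableSet_Ioi).mpr (ae_of_all _ fun r hr => ?_))
    have hr0 : 0 < r := zero_lt_one.trans hr
    rw [Real.norm_of_nonneg (by positivity), Real.rpow_neg hr0.le, ← one_div,
      show (2 : ℝ) = ((2 : ℕ) : ℝ) by norm_num, Real.rpow_natCast]
    gcongr
    exact min_le_left _ _

section Symmetrize

variable {g w : Space N → ℝ} {B : ℝ}

lemma integrable_mul_of_bdd {u : Space N → ℝ} (hw : Integrable w) (hu : Measurable u)
    (hB : ∀ x, |u x| ≤ B) : Integrable (fun x => w x * u x) :=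
  hw.mul_bdd (c := B) hu.aestronglyMeasurable (ae_of_all _ hB)

/-- Summation by parts for second differences. -/
lemma integral_mul_secondDiff (hw : Integrable w) (hg : Measurable g) (hB : ∀ x, |g x| ≤ B)
    (h : Space N) : ∫ x, w x * (2 * g x - g (x + h) - g (x - h)) = incrCorr g w h := by
  have i1 : Integrable (fun x => w x * g x) := integrable_mul_of_bdd hw hg hB
  have i2 : Integrable (fun x => w x * g (x + h)) :=
    integrable_mul_of_bdd hw (hg.comp (measurable_add_const h)) fun x => hB _
  have i3 : Integrable (fun x => w x * g (x - h)) :=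
    integrable_mul_of_bdd hw (hg.comp (measurable_sub_const h)) fun x => hB _
  have i4 : Integrable (fun x => w (x + h) * g (x + h)) := i1.comp_add_right h
  have i5 : Integrable (fun x => w (x + h) * g x) := by simpa using i3.comp_add_right h
  have e1 : ∫ x, w x * g x = ∫ x, w (x + h) * g (x + h) :=
    (integral_add_right_eq_self (fun x => w x * g x) h).symm
  have e2 : ∫ x, w x * g (x - h) = ∫ x, w (x + h) * g x := by
    rw [← integral_add_right_eq_self (fun x => w x * g (x - h)) h]; simp
  have l : ∀ x, w x * (2 * g x - g (x + h) - g (x - h)) =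
      (w x * g x + w x * g x - w x * g (x + h)) - w x * g (x - h) := fun x => by ring
  have r : ∀ x, (g (x + h) - g x) * (w (x + h) - w x) =
      (w (x + h) * g (x + h) + w x * g x - w x * g (x + h)) - w (x + h) * g x := fun x => by ring
  unfold incrCorr
  simp_rw [l, r]
  have j1 : Integrable (fun x => w x * g x + w x * g x) := i1.add i1
  have j2 : Integrable (fun x => w x * g x + w x * g x - w x * g (x + h)) := j1.sub i2
  have j3 : Integrable (fun x => w (x + h) * g (x + h) + w x * g x) := i4.add i1
  have j4 : Integrable (fun x => w (x + h) * g (x + h) + w x * g x - w x * g (x + h)) :=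
    j3.sub i2
  rw [integral_sub j2 i3, integral_sub j1 i2, integral_add i1 i1,
    integral_sub j4 i5, integral_sub j3 i2, integral_add i4 i1, e2, e1]

lemma neg_extDz_eq (hg : Measurable g) (hB : ∀ x, |g x| ≤ B) {ε : ℝ} (hε : 0 < ε) (x : Space N) :
    -extDz g (x, ε) = 1 / 2 * ∫ h, poissonDz ε h * (2 * g x - g (x + h) - g (x - h)) := by
  have hP := integrable_poissonDz (N := N) hε
  have i2 : Integrable (fun h => poissonDz ε h * g (x + h)) :=
    integrable_mul_of_bdd hP (hg.comp (measurable_const_add x)) fun h => hB _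
  have i3 : Integrable (fun h => poissonDz ε h * g (x - h)) :=
    integrable_mul_of_bdd hP (hg.comp (measurable_const_sub x)) fun h => hB _
  have i1 : Integrable (fun h => poissonDz ε h * (2 * g x)) := hP.mul_const _
  have e3 : ∫ h, poissonDz ε h * g (x - h) = extDz g (x, ε) := by
    rw [extDz, ← integral_sub_left_eq_self (fun y => poissonDz ε (x - y) * g y) volume x]
    simp
  have e2 : ∫ h, poissonDz ε h * g (x + h) = extDz g (x, ε) := by
    rw [← e3, ← integral_neg_eq_self]
    simp [poissonDz_neg, ← sub_eq_add_neg]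
  simp_rw [mul_sub]
  have j : Integrable (fun h => poissonDz ε h * (2 * g x) - poissonDz ε h * g (x + h)) := i1.sub i2
  rw [integral_sub j i3, integral_sub i1 i2, e2, e3, integral_mul_const,
    integral_poissonDz hε]
  ring

lemma abs_secondDiff_le (hB : ∀ x, |g x| ≤ B) (x h : Space N) :
    |2 * g x - g (x + h) - g (x - h)| ≤ 4 * B := by
  have h1 := abs_le.mp (hB x)
  have h2 := abs_le.mp (hB (x + h))
  have h3 := abs_le.mp (hB (x - h))
  rw [abs_le]; constructor <;> linarith [h1.1, h1.2, h2.1, h2.2, h3.1, h3.2]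

lemma neg_integral_mul_extDz (hw : Integrable w) (hg : Measurable g) (hB : ∀ x, |g x| ≤ B) {ε : ℝ}
    (hε : 0 < ε) :
    -∫ x, w x * extDz g (x, ε) = 1 / 2 * ∫ h, poissonDz ε h * incrCorr g w h := by
  have hP := integrable_poissonDz (N := N) hε
  have hint : Integrable (Function.uncurry fun (x h : Space N) =>
      w x * (poissonDz ε h * (2 * g x - g (x + h) - g (x - h)))) (volume.prod volume) := by
    have h1 := (hw.mul_prod hP).mul_bdd (c := 4 * B)
      (g := fun p : Space N × Space N => 2 * g p.1 - g (p.1 + p.2) - g (p.1 - p.2))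
      (Measurable.aestronglyMeasurable (by fun_prop))
      (ae_of_all _ fun p => abs_secondDiff_le hB _ _)
    refine h1.congr (ae_of_all _ fun p => ?_)
    simp only [Function.uncurry]
    ring
  rw [← integral_neg]
  simp_rw [← mul_neg, neg_extDz_eq hg hB hε]
  simp_rw [← mul_assoc, mul_comm _ (1 / 2 : ℝ), mul_assoc, integral_const_mul, ← integral_const_mul (w _)]
  rw [integral_integral_swap hint]
  congr 2
  funext h
  rw [← integral_mul_secondDiff hw hg hB, ← integral_const_mul]
  congr 1
  funext x
  ring

/-- The bilinear form in terms of the half Laplacian. -/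
lemma energyForm_eq_integral_halfLaplacian (hN : 0 < N) (hw : Integrable w) (hg : Measurable g)
    (hB : ∀ x, |g x| ≤ B) {C : ℝ}
    (hC : ∀ x h, |2 * g x - g (x + h) - g (x - h)| ≤ C * min 1 (‖h‖ ^ 2)) :
    energyForm g w = ∫ x, w x * halfLaplacian g x := by
  have hint : Integrable (Function.uncurry fun (x h : Space N) =>
      w x * ((2 * g x - g (x + h) - g (x - h)) / ‖h‖ ^ (N + 1))) (volume.prod volume) := by
    have h1 := (hw.norm.mul_prod ((integrable_incrWeight hN).const_mul C))
    refine h1.mono' (hw.aestronglyMeasurable.comp_fst.mul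
      (Measurable.aestronglyMeasurable (by fun_prop))) (ae_of_all _ fun p => ?_)
    simp only [Function.uncurry, norm_mul, norm_div]
    refine mul_le_mul_of_nonneg_left ?_ (norm_nonneg _)
    unfold incrWeight
    rw [← mul_div_assoc, norm_pow, norm_norm]
    gcongr
    exact hC _ _
  unfold halfLaplacian energyForm
  simp_rw [← mul_assoc, mul_comm (w _) (poissonConst N / 2), mul_assoc, integral_const_mul,
    ← integral_const_mul (w _)]
  rw [integral_integral_swap hint]
  congr 2
  funext h
  rw [← integral_mul_secondDiff hw hg hB, ← integral_div]
  congr 1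
  funext x
  ring

end Symmetrize

section Lipschitz

variable {g w : Space N → ℝ} {B : ℝ} {K K' : NNReal} {R : ℝ}

lemma abs_incr_le (hg : LipschitzWith K g) (hB : ∀ x, |g x| ≤ B) (x h : Space N) :
    |g (x + h) - g x| ≤ (K + 2 * B) * min 1 ‖h‖ := by
  have hB0 : 0 ≤ B := (abs_nonneg _).trans (hB 0)
  have h1 : |g (x + h) - g x| ≤ K * ‖h‖ := by
    have := hg.dist_le_mul (x + h) x
    rwa [Real.dist_eq, dist_eq_norm, add_sub_cancel_left] at this
  have h2 : |g (x + h) - g x| ≤ 2 * B := by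
    have := abs_sub (g (x + h)) (g x)
    linarith [hB x, hB (x + h)]
  have hK : (0 : ℝ) ≤ K := K.2
  rcases le_total 1 ‖h‖ with hh | hh
  · rw [min_eq_left hh]; linarith
  · rw [min_eq_right hh]; nlinarith [norm_nonneg h]

lemma abs_incr_le_of_eq_zero (hw : LipschitzWith K w) (hB : ∀ x, |w x| ≤ B)
    (h0 : ∀ x, R ≤ ‖x‖ → w x = 0) (x h : Space N) :
    |w (x + h) - w x| ≤ (K + 2 * B) * min 1 ‖h‖ *
      ((Metric.closedBall 0 R).indicator (fun _ => 1) (x + h)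
        + (Metric.closedBall (0 : Space N) R).indicator (fun _ => 1) x) := by
  have hB0 : 0 ≤ B := (abs_nonneg _).trans (hB 0)
  have hK : (0 : ℝ) ≤ K := K.2
  have h1 := abs_incr_le hw hB x h
  have hpos : 0 ≤ (K + 2 * B) * min 1 ‖h‖ := by positivity
  by_cases hx : x ∈ Metric.closedBall (0 : Space N) R <;>
    by_cases hxh : x + h ∈ Metric.closedBall (0 : Space N) R
  · simp only [hx, hxh, indicator_of_mem]; linarith
  · simp only [hx, hxh, indicator_of_mem, not_false_eq_true, indicator_of_notMem]; linarith
  · simp only [hx, hxh, indicator_of_mem, not_false_eq_true, indicator_of_notMem]; linarith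
  · rw [mem_closedBall_zero_iff, not_le] at hx hxh
    rw [h0 _ hx.le, h0 _ hxh.le]
    simp [hx.not_ge, hxh.not_ge]

lemma integrable_indicator_closedBall :
    Integrable ((Metric.closedBall (0 : Space N) R).indicator (fun _ => (1 : ℝ))) :=
  (integrable_indicator_iff measurableSet_closedBall).mpr
    (integrableOn_const (measure_closedBall_lt_top.ne))

/-- A majorant of the integrand of `incrCorr`. -/
lemma abs_incr_mul_incr_le {Bg Bw : ℝ} (hg : LipschitzWith K' g) (hBg : ∀ x, |g x| ≤ Bg)
    (hw : LipschitzWith K w) (hBw : ∀ x, |w x| ≤ Bw)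
    (h0 : ∀ x, R ≤ ‖x‖ → w x = 0) (x h : Space N) :
    |(g (x + h) - g x) * (w (x + h) - w x)| ≤ (K' + 2 * Bg) * (K + 2 * Bw) * min 1 (‖h‖ ^ 2) *
      ((Metric.closedBall 0 R).indicator (fun _ => 1) (x + h)
        + (Metric.closedBall (0 : Space N) R).indicator (fun _ => 1) x) := by
  have h1 := abs_incr_le hg hBg x h
  have h2 := abs_incr_le_of_eq_zero hw hBw h0 x h
  have hm : min 1 ‖h‖ * min 1 ‖h‖ = min 1 (‖h‖ ^ 2) := by
    rcases le_total 1 ‖h‖ with hh | hh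
    · rw [min_eq_left hh, min_eq_left (one_le_pow₀ hh), one_mul]
    · rw [min_eq_right hh, min_eq_right (pow_le_one₀ (norm_nonneg h) hh), sq]
  have hBg0 : 0 ≤ Bg := (abs_nonneg _).trans (hBg 0)
  rw [abs_mul, ← hm]
  refine (mul_le_mul h1 h2 (abs_nonneg _) (by have : (0:ℝ) ≤ K' := K'.2; positivity)).trans_eq ?_
  ring

lemma abs_incrCorr_le {Bg Bw : ℝ} (hg : LipschitzWith K' g) (hBg : ∀ x, |g x| ≤ Bg)
    (hw : LipschitzWith K w) (hBw : ∀ x, |w x| ≤ Bw)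
    (h0 : ∀ x, R ≤ ‖x‖ → w x = 0) (h : Space N) :
    |incrCorr g w h| ≤ (K' + 2 * Bg) * (K + 2 * Bw) *
      (2 * ∫ x : Space N, (Metric.closedBall (0 : Space N) R).indicator (fun _ => (1 : ℝ)) x)
      * min 1 (‖h‖ ^ 2) := by
  have i := integrable_indicator_closedBall (N := N) (R := R)
  have j : Integrable (fun x => (Metric.closedBall 0 R).indicator (fun _ => (1 : ℝ)) (x + h)
      + (Metric.closedBall (0 : Space N) R).indicator (fun _ => 1) x) := (i.comp_add_right h).add i
  refine (norm_integral_le_of_norm_le (f := fun x => (g (x + h) - g x) * (w (x + h) - w x))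
    (j.const_mul _)
    (ae_of_all _ fun x => abs_incr_mul_incr_le hg hBg hw hBw h0 x h)).trans_eq ?_
  rw [integral_const_mul, integral_add (i.comp_add_right h) i,
    integral_add_right_eq_self (fun x => (Metric.closedBall (0 : Space N) R).indicator _ x)]
  ring

/-- The squared seminorm of `Ḣ^(1/2)` of a compactly supported Lipschitz function. -/
lemma hHalfSq_eq_energyForm (hN : 0 < N) (hw : LipschitzWith K w) (hB : ∀ x, |w x| ≤ B)
    (h0 : ∀ x, R ≤ ‖x‖ → w x = 0) : hHalfSq w = ENNReal.ofReal (energyForm w w) := by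
  have hc := poissonConst_pos N
  have hi : ∀ h, Integrable (fun x => (w (x + h) - w x) * (w (x + h) - w x)) := fun h => by
    have i := integrable_indicator_closedBall (N := N) (R := R)
    have j : Integrable (fun x => (Metric.closedBall 0 R).indicator (fun _ => (1 : ℝ)) (x + h)
      + (Metric.closedBall (0 : Space N) R).indicator (fun _ => 1) x) := (i.comp_add_right h).add i
    have := hw.continuous
    exact (j.const_mul _).mono' (Continuous.aestronglyMeasurable (by fun_prop))
      (ae_of_all _ fun x => abs_incr_mul_incr_le hw hB hw hB h0 x h)
  have hci : Integrable (fun h => incrCorr w w h / ‖h‖ ^ (N + 1)) := by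
    refine ((integrable_incrWeight hN).const_mul ((K + 2 * B) * (K + 2 * B) *
      (2 * ∫ x : Space N, (Metric.closedBall (0 : Space N) R).indicator (fun _ => (1 : ℝ)) x))).mono'
      ?_ (ae_of_all _ fun h => ?_)
    · have := hw.continuous.measurable
      refine (Measurable.aestronglyMeasurable ?_).mul
        (Measurable.aestronglyMeasurable (f := fun h : Space N => (‖h‖ ^ (N + 1))⁻¹) (by fun_prop))
      exact (StronglyMeasurable.integral_prod_right
        (f := fun h x => (w (x + h) - w x) * (w (x + h) - w x))
        (Measurable.stronglyMeasurable (by unfold Function.uncurry; fun_prop))).measurable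
    · rw [norm_div, norm_pow, norm_norm, incrWeight, ← mul_div_assoc]
      gcongr
      exact abs_incrCorr_le hw hB hw hB h0 h
  unfold hHalfSq energyForm
  rw [ENNReal.ofReal_mul (by positivity), ofReal_integral_eq_lintegral_ofReal hci
    (ae_of_all _ fun h => div_nonneg (integral_nonneg fun x => mul_self_nonneg _) (by positivity))]
  congr 1
  have e1 : ∀ x, ∫⁻ y, ENNReal.ofReal ((w x - w y) ^ 2 / ‖x - y‖ ^ (N + 1))
      = ∫⁻ h, ENNReal.ofReal ((w (x + h) - w x) * (w (x + h) - w x) / ‖h‖ ^ (N + 1)) := fun x => by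
    rw [← lintegral_add_left_eq_self _ x]
    congr 1
    funext h
    rw [sub_add_cancel_left, norm_neg]
    congr 2
    ring
  simp_rw [e1]
  have := hw.continuous.measurable
  rw [lintegral_lintegral_swap (Measurable.aemeasurable (by unfold Function.uncurry; fun_prop))]
  congr 1
  funext h
  rw [incrCorr, ← integral_div, ofReal_integral_eq_lintegral_ofReal ((hi h).div_const _)
    (ae_of_all _ fun x => div_nonneg (mul_self_nonneg _) (by positivity))]

end Lipschitz

lemma one_div_norm_pow_eq {h : Space N} (hh : h ≠ 0) :
    1 / ‖h‖ ^ (N + 1) = (‖h‖ ^ 2) ^ (-(((N : ℝ) + 1) / 2)) := by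
  have hpos : 0 < ‖h‖ := norm_pos_iff.mpr hh
  rw [← Real.rpow_natCast ‖h‖ 2, ← Real.rpow_mul hpos.le,
    show ((2 : ℕ) : ℝ) * -(((N : ℝ) + 1) / 2) = -((N + 1 : ℕ) : ℝ) by push_cast; ring,
    Real.rpow_neg hpos.le, Real.rpow_natCast, one_div]

lemma tendsto_poissonDz {h : Space N} (hh : h ≠ 0) :
    Tendsto (fun ε => poissonDz ε h) (𝓝[>] 0) (𝓝 (poissonConst N / ‖h‖ ^ (N + 1))) := by
  have hpos : 0 < ‖h‖ := norm_pos_iff.mpr hh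
  have hA : ContinuousAt (fun ε : ℝ => ε ^ 2 + ‖h‖ ^ 2) 0 := by fun_prop
  have h0 : (0 : ℝ) ^ 2 + ‖h‖ ^ 2 ≠ 0 := by positivity
  have hc : ContinuousAt (fun ε => poissonDz ε h) 0 := by
    unfold poissonDz decay
    exact continuousAt_const.mul ((hA.rpow_const (Or.inl h0)).sub
      ((by fun_prop : ContinuousAt (fun ε : ℝ => ((N : ℝ) + 1) * ε ^ 2) 0).mul
        (hA.rpow_const (Or.inl h0))))
  have e : poissonDz 0 h = poissonConst N / ‖h‖ ^ (N + 1) := by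
    unfold poissonDz decay
    rw [div_eq_mul_one_div (poissonConst N), one_div_norm_pow_eq hh]
    simp
  rw [← e]
  exact hc.tendsto.mono_left nhdsWithin_le_nhds

lemma decay_le_inv_norm_pow (ε : ℝ) (h : Space N) (hh : h ≠ 0) :
    decay ε h ≤ 1 / ‖h‖ ^ (N + 1) := by
  have hpos : 0 < ‖h‖ := norm_pos_iff.mpr hh
  rw [one_div_norm_pow_eq hh]
  unfold decay
  refine Real.rpow_le_rpow_of_nonpos (by positivity) (by nlinarith [sq_nonneg ε]) ?_
  have : (0 : ℝ) ≤ N := Nat.cast_nonneg N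
  linarith

namespace IsTest

variable {w : Space N × ℝ → ℝ} {R Z : ℝ} {K K' : NNReal} {g : Space N → ℝ} {B : ℝ}

lemma tendsto_incrCorr (hw : IsTest w R Z K) (hg : LipschitzWith K' g) (hB : ∀ x, |g x| ≤ B)
    (h : Space N) : Tendsto (fun ε => incrCorr g (fun x => w (x, ε)) h) (𝓝[>] 0)
      (𝓝 (incrCorr g (fun x => w (x, 0)) h)) := by
  obtain ⟨Bw, hBw0, hBw⟩ := hw.exists_bound
  have i := integrable_indicator_closedBall (N := N) (R := R)
  have j : Integrable (fun x => (Metric.closedBall 0 R).indicator (fun _ => (1 : ℝ)) (x + h)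
      + (Metric.closedBall (0 : Space N) R).indicator (fun _ => 1) x) := (i.comp_add_right h).add i
  have hgc := hg.continuous
  have hwc := hw.cont
  refine tendsto_integral_filter_of_dominated_convergence _
    (Eventually.of_forall fun ε => Continuous.aestronglyMeasurable (by fun_prop)) ?_
    (j.const_mul ((K' + 2 * B) * (K + 2 * Bw) * min 1 (‖h‖ ^ 2))) (ae_of_all _ fun x => ?_)
  · filter_upwards [self_mem_nhdsWithin] with ε hε
    have hε : 0 < ε := hε
    exact ae_of_all _ fun x => abs_incr_mul_incr_le hg hB (hw.horiz ε hε.le)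
      (fun x => hBw (x, ε) hε.le) (fun x hx => hw.eq_zero (x, ε) hε.le (Or.inl hx)) x h
  · have : Continuous fun ε => (g (x + h) - g x) * (w (x + h, ε) - w (x, ε)) := by fun_prop
    exact this.continuousAt.tendsto.mono_left nhdsWithin_le_nhds

/-- Green's formula in the half space, with the boundary term expressed by the bilinear form. -/
lemma tendsto_green (hN : 0 < N) (hw : IsTest w R Z K) (hZ : 0 < Z) (hg : LipschitzWith K' g)
    (hB : ∀ x, |g x| ≤ B) :
    Tendsto (fun ε => ∫ p in slab N R Z ε, (fderiv ℝ (fun x => w (x, p.2)) p.1 (extDx g p)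
      + deriv (fun z => w (p.1, z)) p.2 * extDz g p)) (𝓝[>] 0)
      (𝓝 (energyForm g fun x => w (x, 0))) := by
  obtain ⟨Bw, hBw0, hBw⟩ := hw.exists_bound
  have hc := poissonConst_pos N
  have hgc := hg.continuous
  have hwc := hw.cont
  have : Nonempty (Fin N) := ⟨⟨0, hN⟩⟩
  have key : ∀ᶠ ε in 𝓝[>] (0 : ℝ), ∫ h, poissonDz ε h * (1 / 2 * incrCorr g (fun x => w (x, ε)) h)
      = ∫ p in slab N R Z ε, (fderiv ℝ (fun x => w (x, p.2)) p.1 (extDx g p)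
      + deriv (fun z => w (p.1, z)) p.2 * extDz g p) := by
    filter_upwards [Ioo_mem_nhdsGT hZ] with ε hε
    rw [(hw.green hgc.measurable hB hε.1 hε.2.le).2, neg_integral_mul_extDz
      ((hw.horiz ε hε.1.le).continuous.integrable_of_hasCompactSupport
        (hw.hasCompactSupport hε.1.le)) hgc.measurable hB hε.1, ← integral_const_mul]
    congr 1
    funext h
    ring
  refine Tendsto.congr' key ?_
  have e : energyForm g (fun x => w (x, 0)) = ∫ h, poissonConst N / ‖h‖ ^ (N + 1) *
      (1 / 2 * incrCorr g (fun x => w (x, 0)) h) := by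
    unfold energyForm
    rw [← integral_const_mul]
    congr 1
    funext h
    ring
  rw [e]
  set C : ℝ := (K' + 2 * B) * (K + 2 * Bw) *
      (2 * ∫ x : Space N, (Metric.closedBall (0 : Space N) R).indicator (fun _ => (1 : ℝ)) x)
  have hne : ∀ᵐ h : Space N, h ≠ 0 := by simp [ae_iff, measure_singleton]
  refine tendsto_integral_filter_of_dominated_convergence
    (fun h => poissonConst N * (N + 1) * C * incrWeight h) ?_ ?_
    ((integrable_incrWeight hN).const_mul _) ?_
  · refine Eventually.of_forall fun ε => Measurable.aestronglyMeasurable ?_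
    refine (measurable_poissonDz_comp measurable_const measurable_id).mul (measurable_const.mul ?_)
    have := hgc.measurable
    have := hwc.measurable
    exact (StronglyMeasurable.integral_prod_right
        (f := fun h x => (g (x + h) - g x) * (w (x + h, ε) - w (x, ε)))
        (Measurable.stronglyMeasurable (by unfold Function.uncurry; fun_prop))).measurable
  · filter_upwards [self_mem_nhdsWithin] with ε hε
    have hε : 0 < ε := hε
    filter_upwards [hne] with h hh
    have h1 := abs_incrCorr_le hg hB (hw.horiz ε hε.le)
      (fun x => hBw (x, ε) hε.le) (fun x hx => hw.eq_zero (x, ε) hε.le (Or.inl hx)) h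
    have h2 := (abs_poissonDz_le hε h).trans (mul_le_mul_of_nonneg_left
      (decay_le_inv_norm_pow ε h hh) (by positivity))
    rw [norm_mul, Real.norm_eq_abs, Real.norm_eq_abs]
    have h3 : |1 / 2 * incrCorr g (fun x => w (x, ε)) h| ≤ C * min 1 (‖h‖ ^ 2) := by
      rw [abs_mul, abs_of_pos (by norm_num : (0 : ℝ) < 1 / 2)]
      have := abs_nonneg (incrCorr g (fun x => w (x, ε)) h)
      linarith
    refine (mul_le_mul h2 h3 (abs_nonneg _) (by positivity)).trans_eq ?_
    unfold incrWeight
    ring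
  · filter_upwards [hne] with h hh
    exact (tendsto_poissonDz hh).mul ((hw.tendsto_incrCorr hg hB h).const_mul _)

end IsTest

/-! ### Gradients of truncated products -/

section Pointwise

variable {F : Type*} [NormedAddCommGroup F] [NormedSpace ℝ F] {a b : F → ℝ} {x : F}

/-- The derivative of `a * b₊`; at the zeros of `b` either it vanishes or the function is not
differentiable. -/
lemma fderiv_mul_posPart (ha : DifferentiableAt ℝ a x) (hb : DifferentiableAt ℝ b x) :
    fderiv ℝ (fun y => a y * max (b y) 0) x =
      if 0 < b x then a x • fderiv ℝ b x + b x • fderiv ℝ a x else 0 := by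
  rcases lt_trichotomy (b x) 0 with h | h | h
  · rw [if_neg h.not_gt]
    have : (fun y => a y * max (b y) 0) =ᶠ[𝓝 x] fun _ => 0 := by
      filter_upwards [hb.continuousAt.eventually (gt_mem_nhds h)] with y hy
      rw [max_eq_right hy.le, mul_zero]
    rw [this.fderiv_eq]; simp
  · rw [if_neg h.not_gt]
    rcases lt_trichotomy (a x) 0 with h' | h' | h'
    · have : IsLocalMax (fun y => a y * max (b y) 0) x := by
        filter_upwards [ha.continuousAt.eventually (gt_mem_nhds h')] with y hy
        simp only [h, max_self, mul_zero]
        exact mul_nonpos_of_nonpos_of_nonneg hy.le (le_max_right _ _)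
      exact this.fderiv_eq_zero
    · have hab := ha.hasFDerivAt.mul hb.hasFDerivAt
      rw [h, h', zero_smul, zero_smul, add_zero] at hab
      refine HasFDerivAt.fderiv ?_
      rw [hasFDerivAt_iff_isLittleO_nhds_zero] at hab ⊢
      refine Asymptotics.IsBigO.trans_isLittleO ?_ hab
      refine Asymptotics.IsBigO.of_bound 1 (Eventually.of_forall fun y => ?_)
      simp only [Pi.mul_apply, h, h', max_self, mul_zero, _root_.zero_apply,
        sub_zero, norm_mul, one_mul]
      gcongr
      rw [Real.norm_eq_abs, Real.norm_eq_abs, abs_of_nonneg (le_max_right _ _)]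
      exact max_le (le_abs_self _) (abs_nonneg _)
    · have : IsLocalMin (fun y => a y * max (b y) 0) x := by
        filter_upwards [ha.continuousAt.eventually (lt_mem_nhds h')] with y hy
        simp only [h, max_self, mul_zero]
        exact mul_nonneg hy.le (le_max_right _ _)
      exact this.fderiv_eq_zero
  · rw [if_pos h]
    have : (fun y => a y * max (b y) 0) =ᶠ[𝓝 x] fun y => a y * b y := by
      filter_upwards [hb.continuousAt.eventually (lt_mem_nhds h)] with y hy
      rw [max_eq_left hy.le]
    rw [this.fderiv_eq, fderiv_fun_mul ha hb]

end Pointwise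

lemma deriv_mul_posPart {a b : ℝ → ℝ} {z : ℝ} (ha : DifferentiableAt ℝ a z)
    (hb : DifferentiableAt ℝ b z) : deriv (fun y => a y * max (b y) 0) z =
      if 0 < b z then a z * deriv b z + b z * deriv a z else 0 := by
  rw [← fderiv_apply_one_eq_deriv, fderiv_mul_posPart ha hb]
  split_ifs <;> simp

lemma fderiv_sq {F : Type*} [NormedAddCommGroup F] [NormedSpace ℝ F] {a : F → ℝ} {x : F}
    (ha : DifferentiableAt ℝ a x) : fderiv ℝ (fun y => a y ^ 2) x = (2 * a x) • fderiv ℝ a x := by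
  simpa using fderiv_fun_pow 2 ha

lemma norm_sq_innerSL_add (a b : ℝ) (v : Space N) (A : Space N →L[ℝ] ℝ) :
    ‖a • innerSL ℝ v + b • A‖ ^ 2 = a ^ 2 * ‖v‖ ^ 2 + 2 * (a * b) * A v + b ^ 2 * ‖A‖ ^ 2 := by
  obtain ⟨u, rfl⟩ : ∃ u, innerSL ℝ u = A := ⟨(InnerProductSpace.toDual ℝ (Space N)).symm A, by
    ext y; simp⟩
  have : a • innerSL ℝ v + b • innerSL ℝ u = innerSL ℝ (a • v + b • u) := by simp
  rw [this, innerSL_apply_norm, innerSL_apply_norm, @norm_add_sq_real]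
  simp only [norm_smul, inner_smul_left, inner_smul_right, innerSL_apply_apply, mul_pow,
    Real.norm_eq_abs, sq_abs, conj_trivial, real_inner_comm]
  ring

variable {η : Space N × ℝ → ℝ} {g : Space N → ℝ} {B : ℝ}

lemma differentiableAt_horiz (hη : ContDiff ℝ 1 η) (p : Space N × ℝ) :
    DifferentiableAt ℝ (fun x => η (x, p.2)) p.1 := by
  have := hη.differentiable one_ne_zero
  fun_prop

lemma differentiableAt_vert (hη : ContDiff ℝ 1 η) (p : Space N × ℝ) :
    DifferentiableAt ℝ (fun z => η (p.1, z)) p.2 := by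
  have := hη.differentiable one_ne_zero
  fun_prop

/-- The gradient of a truncated product, in squared norm. -/
lemma gradSq_mul_posPart (hη : ContDiff ℝ 1 η) (hg : Measurable g) (hB : ∀ x, |g x| ≤ B)
    {p : Space N × ℝ} (hz : 0 < p.2) :
    gradSq (fun q => η q * max (harmonicExt g q) 0) p =
      if 0 < harmonicExt g p then
        ‖η p • innerSL ℝ (extDx g p) + harmonicExt g p • fderiv ℝ (fun x => η (x, p.2)) p.1‖ ^ 2
          + (η p * extDz g p + harmonicExt g p * deriv (fun z => η (p.1, z)) p.2) ^ 2
      else 0 := by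
  have h1 := hasFDerivAt_harmonicExt hg hB hz
  have h2 := hasDerivAt_harmonicExt hg hB hz
  unfold gradSq
  rw [fderiv_mul_posPart (differentiableAt_horiz hη p) h1.differentiableAt,
    deriv_mul_posPart (differentiableAt_vert hη p) h2.differentiableAt, h1.fderiv, h2.deriv]
  split_ifs <;> simp

lemma green_integrand_posPart (hη : ContDiff ℝ 1 η) (hg : Measurable g) (hB : ∀ x, |g x| ≤ B)
    {p : Space N × ℝ} (hz : 0 < p.2) :
    fderiv ℝ (fun x => (fun q => η q ^ 2 * max (harmonicExt g q) 0) (x, p.2)) p.1 (extDx g p)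
      + deriv (fun z => (fun q => η q ^ 2 * max (harmonicExt g q) 0) (p.1, z)) p.2 * extDz g p
    = gradSq (fun q => η q * max (harmonicExt g q) 0) p
      - gradSq η p * max (harmonicExt g p) 0 ^ 2 := by
  have h1 := hasFDerivAt_harmonicExt hg hB hz
  have h2 := hasDerivAt_harmonicExt hg hB hz
  have d1 := differentiableAt_horiz hη p
  have d2 := differentiableAt_vert hη p
  rw [gradSq_mul_posPart hη hg hB hz]
  beta_reduce
  rw [fderiv_mul_posPart (d1.fun_pow 2) h1.differentiableAt,
    deriv_mul_posPart (d2.fun_pow 2) h2.differentiableAt, h1.fderiv, h2.deriv]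
  split_ifs with h
  · have e1 : fderiv ℝ (fun x => η (x, p.2) ^ 2) p.1 =
        (2 * η p) • fderiv ℝ (fun x => η (x, p.2)) p.1 := fderiv_sq d1
    have e2 : deriv (fun z => η (p.1, z) ^ 2) p.2 = 2 * η p * deriv (fun z => η (p.1, z)) p.2 := by
      simpa using deriv_fun_pow d2 2
    rw [e1, e2, norm_sq_innerSL_add, max_eq_left h.le]
    simp only [gradSq, _root_.add_apply, _root_.smul_apply,
      innerSL_apply_apply, smul_eq_mul, real_inner_self_eq_norm_sq]
    ring
  · rw [max_eq_right (not_lt.mp h)]; simp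

lemma green_integrand (hη : ContDiff ℝ 1 η) (hg : Measurable g) (hB : ∀ x, |g x| ≤ B)
    {p : Space N × ℝ} (hz : 0 < p.2) :
    fderiv ℝ (fun x => (fun q => η q ^ 2 * harmonicExt g q) (x, p.2)) p.1 (extDx g p)
      + deriv (fun z => (fun q => η q ^ 2 * harmonicExt g q) (p.1, z)) p.2 * extDz g p
    = gradSq (fun q => η q * harmonicExt g q) p - gradSq η p * harmonicExt g p ^ 2 := by
  have h1 := hasFDerivAt_harmonicExt hg hB hz
  have h2 := hasDerivAt_harmonicExt hg hB hz
  have d1 := differentiableAt_horiz hη p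
  have d2 := differentiableAt_vert hη p
  unfold gradSq
  beta_reduce
  have e1 : fderiv ℝ (fun x => η (x, p.2) ^ 2) p.1 =
      (2 * η p) • fderiv ℝ (fun x => η (x, p.2)) p.1 := fderiv_sq d1
  have e2 : deriv (fun z => η (p.1, z) ^ 2) p.2 = 2 * η p * deriv (fun z => η (p.1, z)) p.2 := by
    simpa using deriv_fun_pow d2 2
  rw [fderiv_fun_mul (d1.fun_pow 2) h1.differentiableAt, deriv_fun_mul (d2.fun_pow 2) h2.differentiableAt,
    fderiv_fun_mul d1 h1.differentiableAt, deriv_fun_mul d2 h2.differentiableAt, h1.fderiv, h2.deriv,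
    e1, e2, norm_sq_innerSL_add]
  simp only [_root_.add_apply, _root_.smul_apply,
      innerSL_apply_apply, smul_eq_mul, real_inner_self_eq_norm_sq]
  ring

/-- Young's inequality for the Green integrand. -/
lemma green_integrand_le (w : Space N × ℝ → ℝ) (hg : Measurable g) (hB : ∀ x, |g x| ≤ B)
    {p : Space N × ℝ} (hz : 0 < p.2) :
    fderiv ℝ (fun x => w (x, p.2)) p.1 (extDx g p) + deriv (fun z => w (p.1, z)) p.2 * extDz g p
      ≤ 1 / 2 * gradSq w p + 1 / 2 * gradSq (harmonicExt g) p := by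
  have h1 := hasFDerivAt_harmonicExt hg hB hz
  have h2 := hasDerivAt_harmonicExt hg hB hz
  unfold gradSq
  rw [h1.fderiv, h2.deriv, innerSL_apply_norm]
  have h3 := (le_abs_self _).trans
    ((fderiv ℝ (fun x => w (x, p.2)) p.1).le_opNorm (extDx g p))
  nlinarith [sq_nonneg (‖fderiv ℝ (fun x => w (x, p.2)) p.1‖ - ‖extDx g p‖),
    sq_nonneg (deriv (fun z => w (p.1, z)) p.2 - extDz g p)]

lemma measurable_gradSq {w : Space N × ℝ → ℝ} (hw : Continuous w) : Measurable (gradSq w) :=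
  ((measurable_fderiv_horiz hw).norm.pow_const 2).add ((measurable_deriv_vert hw).pow_const 2)

lemma gradSq_nonneg (w : Space N × ℝ → ℝ) (p : Space N × ℝ) : 0 ≤ gradSq w p := by
  unfold gradSq; positivity

/-! ### Construction of test functions -/

lemma isTest_of_contDiff {ψ : Space N × ℝ → ℝ} {R Z : ℝ} (hψ : ContDiff ℝ 1 ψ)
    (h0 : ∀ p : Space N × ℝ, 0 ≤ p.2 → (R ≤ ‖p.1‖ ∨ Z ≤ p.2) → ψ p = 0) :
    ∃ K, IsTest ψ R Z K := by
  have hd := hψ.differentiable one_ne_zero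
  obtain ⟨C, hC⟩ := ((isCompact_closedBall (0 : Space N) R).prod
    (isCompact_Icc (a := (0 : ℝ)) (b := Z))).exists_bound_of_continuousOn
    (hψ.continuous_fderiv one_ne_zero).continuousOn
  have hx : ∀ p : Space N × ℝ, HasFDerivAt (fun x => ψ (x, p.2))
      ((fderiv ℝ ψ p).comp (ContinuousLinearMap.inl ℝ (Space N) ℝ)) p.1 := fun p => by
    have h1 : HasFDerivAt (fun x : Space N => (x, p.2)) (ContinuousLinearMap.inl ℝ (Space N) ℝ) p.1 :=
      hasFDerivAt_prodMk_left p.1 p.2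
    exact (hd p).hasFDerivAt.comp p.1 h1
  have hz : ∀ p : Space N × ℝ, HasDerivAt (fun z => ψ (p.1, z)) (fderiv ℝ ψ p (0, 1)) p.2 :=
    fun p => by
      have h1 : HasDerivAt (fun z : ℝ => (p.1, z)) ((0 : Space N), (1 : ℝ)) p.2 :=
        (hasDerivAt_const _ _).prodMk (hasDerivAt_id _)
      exact (hd p).hasFDerivAt.comp_hasDerivAt p.2 h1
  refine ⟨C.toNNReal, hψ.continuous, fun z hz0 => ?_, fun ε hε => ⟨C.toNNReal, fun x => ?_⟩, h0⟩
  · refine lipschitzWith_of_nnnorm_fderiv_le (fun x => (hx (x, z)).differentiableAt) fun x => ?_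
    rw [← NNReal.coe_le_coe, coe_nnnorm]
    by_cases hxz : ‖x‖ ≤ R ∧ z ≤ Z
    · refine le_trans ?_ ((hC (x, z) ⟨by simpa using hxz.1, hz0, hxz.2⟩).trans
        (Real.le_coe_toNNReal C))
      rw [(hx (x, z)).fderiv]
      refine (ContinuousLinearMap.opNorm_comp_le _ _).trans ?_
      have := ContinuousLinearMap.norm_inl_le_one ℝ (Space N) ℝ
      nlinarith [norm_nonneg (fderiv ℝ ψ (x, z))]
    · have : (fun x => ψ (x, z)) =ᶠ[𝓝 x] fun _ => 0 := by
        rcases not_and_or.mp hxz with h | h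
        · filter_upwards [continuous_norm.continuousAt.eventually (lt_mem_nhds (not_le.mp h))]
            with y hy
          exact h0 (y, z) hz0 (Or.inl hy.le)
        · exact Eventually.of_forall fun y => h0 (y, z) hz0 (Or.inr (not_le.mp h).le)
      rw [this.fderiv_eq]; simp
  · by_cases hxR : ‖x‖ ≤ R
    · refine (convex_Icc ε Z).lipschitzOnWith_of_nnnorm_hasDerivWithin_le
        (fun z _ => (hz (x, z)).hasDerivWithinAt) fun z hz1 => ?_
      rw [← NNReal.coe_le_coe, coe_nnnorm]
      refine le_trans ?_ ((hC (x, z) ⟨by simpa using hxR, hε.le.trans hz1.1, hz1.2⟩).trans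
        (Real.le_coe_toNNReal C))
      refine (ContinuousLinearMap.le_opNorm _ _).trans ?_
      simp
    · intro z hz1 z' hz2
      simp only
      rw [h0 (x, z) (hε.le.trans hz1.1) (Or.inl (not_le.mp hxR).le),
        h0 (x, z') (hε.le.trans hz2.1) (Or.inl (not_le.mp hxR).le)]
      simp

lemma lipschitzOnWith_mul {α : Type*} [PseudoMetricSpace α] {s : Set α} {f g : α → ℝ}
    {Kf Kg Bf Bg : NNReal} (hf : LipschitzOnWith Kf f s) (hg : LipschitzOnWith Kg g s)
    (hBf : ∀ x ∈ s, |f x| ≤ Bf) (hBg : ∀ x ∈ s, |g x| ≤ Bg) :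
    LipschitzOnWith (Bf * Kg + Bg * Kf) (fun x => f x * g x) s := by
  refine LipschitzOnWith.of_dist_le_mul fun x hx y hy => ?_
  have h1 := hf.dist_le_mul x hx y hy
  have h2 := hg.dist_le_mul x hx y hy
  rw [Real.dist_eq] at h1 h2 ⊢
  have e : f x * g x - f y * g y = f x * (g x - g y) + g y * (f x - f y) := by ring
  rw [e]
  refine (abs_add_le _ _).trans ?_
  rw [abs_mul, abs_mul]
  push_cast
  have h3 := hBf x hx
  have h4 := hBg y hy
  calc |f x| * |g x - g y| + |g y| * |f x - f y|
      ≤ Bf * (Kg * dist x y) + Bg * (Kf * dist x y) := by gcongr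
    _ = _ := by ring

lemma IsTest.mul {w v : Space N × ℝ → ℝ} {R Z : ℝ} {K K' Bv : NNReal} (hw : IsTest w R Z K)
    (hv : Continuous v) (hB : ∀ p : Space N × ℝ, |v p| ≤ Bv)
    (hx : ∀ z, LipschitzWith K' (fun x => v (x, z)))
    (hz : ∀ ε, 0 < ε → ∃ K', ∀ x, LipschitzOnWith K' (fun z => v (x, z)) (Icc ε Z)) :
    ∃ K'', IsTest (fun p => w p * v p) R Z K'' := by
  obtain ⟨B, hB0, hBw⟩ := hw.exists_bound
  lift B to NNReal using hB0
  refine ⟨B * K' + Bv * K, hw.cont.mul hv, fun z hz0 => ?_, fun ε hε => ?_, fun p hp h => ?_⟩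
  · rw [← lipschitzOnWith_univ]
    exact lipschitzOnWith_mul (lipschitzOnWith_univ.mpr (hw.horiz z hz0))
      (lipschitzOnWith_univ.mpr (hx z)) (fun x _ => hBw (x, z) hz0) (fun x _ => hB (x, z))
  · obtain ⟨K₁, h1⟩ := hw.vert ε hε
    obtain ⟨K₂, h2⟩ := hz ε hε
    exact ⟨B * K₂ + Bv * K₁, fun x => lipschitzOnWith_mul (h1 x) (h2 x)
      (fun z hz => hBw (x, z) (hε.le.trans hz.1)) (fun z _ => hB (x, z))⟩
  · rw [hw.eq_zero p hp h, zero_mul]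

lemma IsTest.mul_harmonicExt {w : Space N × ℝ → ℝ} {R Z : ℝ} {K K' : NNReal} (hw : IsTest w R Z K)
    (hg : LipschitzWith K' g) (hB : ∀ x, |g x| ≤ B) :
    ∃ K'', IsTest (fun p => w p * harmonicExt g p) R Z K'' := by
  have hB0 : 0 ≤ B := (abs_nonneg _).trans (hB 0)
  exact hw.mul (Bv := ⟨B, hB0⟩) (continuous_harmonicExt hg.continuous hB)
    (fun p => abs_harmonicExt_le hB p) (fun z => lipschitz_harmonicExt_horiz hg hB z)
    (fun ε hε => ⟨_, fun x =>
      (lipschitzOn_harmonicExt_vert hg.continuous.measurable hB hε x).mono Icc_subset_Ici_self⟩)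

lemma lipschitzWith_posPart : LipschitzWith 1 (fun r : ℝ => max r 0) :=
  LipschitzWith.id.max_const 0

lemma abs_posPart_le (r : ℝ) : |max r 0| ≤ |r| := by
  rw [abs_of_nonneg (le_max_right _ _)]
  exact max_le (le_abs_self _) (abs_nonneg _)

lemma IsTest.mul_harmonicExt_posPart {w : Space N × ℝ → ℝ} {R Z : ℝ} {K K' : NNReal}
    (hw : IsTest w R Z K) (hg : LipschitzWith K' g) (hB : ∀ x, |g x| ≤ B) :
    ∃ K'', IsTest (fun p => w p * max (harmonicExt g p) 0) R Z K'' := by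
  have hB0 : 0 ≤ B := (abs_nonneg _).trans (hB 0)
  refine hw.mul (Bv := ⟨B, hB0⟩) (K' := 1 * K') (by
      have := continuous_harmonicExt hg.continuous hB
      fun_prop)
    (fun p => (abs_posPart_le _).trans (abs_harmonicExt_le hB p))
    (fun z => lipschitzWith_posPart.comp (lipschitz_harmonicExt_horiz hg hB z))
    (fun ε hε => ⟨1 * _, fun x => lipschitzWith_posPart.comp_lipschitzOnWith
      ((lipschitzOn_harmonicExt_vert hg.continuous.measurable hB hε x).mono Icc_subset_Ici_self)⟩)

/-! ### The dissipation of a truncated extension -/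

/-- A radius beyond which the cut-offs vanish. -/
def cutRadius (N : ℕ) : ℝ := 4 * N + 5

lemma norm_lt_of_mem_B4 {x : Space N} (hx : x ∈ B4 N) : ‖x‖ < cutRadius N := by
  have h1 : ‖x‖ ^ 2 ≤ 16 * N := by
    rw [EuclideanSpace.real_norm_sq_eq]
    calc ∑ i, x i ^ 2 ≤ ∑ _i : Fin N, (16 : ℝ) := Finset.sum_le_sum fun i _ => by
          have := hx i
          nlinarith [this.1, this.2]
      _ = 16 * N := by simp [mul_comm]
  unfold cutRadius
  have hN : (0 : ℝ) ≤ N := Nat.cast_nonneg N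
  by_contra h
  push Not at h
  nlinarith [norm_nonneg x]

lemma isClosed_B4 (N : ℕ) : IsClosed (B4 N) := by
  have : B4 N = ⋂ i, (fun x : Space N => x i) ⁻¹' Icc (-4) 4 := by
    ext x; simp [B4]
  rw [this]
  exact isClosed_iInter fun i => isClosed_Icc.preimage (by fun_prop)

lemma isClosed_B4star (N : ℕ) : IsClosed (B4star N) := (isClosed_B4 N).prod isClosed_Icc

lemma measurableSet_B4star (N : ℕ) : MeasurableSet (B4star N) := (isClosed_B4star N).measurableSet

lemma IsCutoff.contDiff_one {η : Space N × ℝ → ℝ} (hη : IsCutoff η) : ContDiff ℝ 1 η :=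
  hη.smooth.of_le (by exact_mod_cast le_top)

lemma IsCutoff.eq_zero {η : Space N × ℝ → ℝ} (hη : IsCutoff η) (p : Space N × ℝ) (hp : 0 ≤ p.2)
    (h : cutRadius N ≤ ‖p.1‖ ∨ 5 ≤ p.2) : η p = 0 := by
  refine hη.support p hp fun hm => ?_
  rcases h with h | h
  · exact absurd (norm_lt_of_mem_B4 hm.1) (not_lt.mpr h)
  · have := hm.2.2
    linarith

lemma IsCutoff.isTest {η : Space N × ℝ → ℝ} (hη : IsCutoff η) :
    ∃ K, IsTest η (cutRadius N) 5 K :=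
  isTest_of_contDiff hη.contDiff_one hη.eq_zero

lemma IsCutoff.isTest_sq {η : Space N × ℝ → ℝ} (hη : IsCutoff η) :
    ∃ K, IsTest (fun p => η p ^ 2) (cutRadius N) 5 K :=
  isTest_of_contDiff (hη.contDiff_one.pow 2) fun p hp h => by
    rw [hη.eq_zero p hp h]; simp

lemma IsTest.gradSq_le {w : Space N × ℝ → ℝ} {R Z : ℝ} (hw : ContDiff ℝ 1 w) :
    ∃ C, ∀ p ∈ slab N R Z 0, gradSq w p ≤ C := by
  have hd := hw.differentiable one_ne_zero
  obtain ⟨C, hC⟩ := ((isCompact_closedBall (0 : Space N) R).prod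
    (isCompact_Icc (a := (0 : ℝ)) (b := Z))).exists_bound_of_continuousOn
    (hw.continuous_fderiv one_ne_zero).continuousOn
  refine ⟨C ^ 2 + C ^ 2, fun p hp => ?_⟩
  have h1 := hC p ⟨hp.1, Ioo_subset_Icc_self hp.2⟩
  have hx : HasFDerivAt (fun x => w (x, p.2))
      ((fderiv ℝ w p).comp (ContinuousLinearMap.inl ℝ (Space N) ℝ)) p.1 :=
    (hd p).hasFDerivAt.comp p.1 (hasFDerivAt_prodMk_left p.1 p.2)
  have hz : HasDerivAt (fun z => w (p.1, z)) (fderiv ℝ w p (0, 1)) p.2 :=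
    (hd p).hasFDerivAt.comp_hasDerivAt p.2 ((hasDerivAt_const _ _).prodMk (hasDerivAt_id _))
  unfold gradSq
  rw [hx.fderiv, hz.deriv]
  have h2 : ‖(fderiv ℝ w p).comp (ContinuousLinearMap.inl ℝ (Space N) ℝ)‖ ≤ C := by
    refine (ContinuousLinearMap.opNorm_comp_le _ _).trans ?_
    have := ContinuousLinearMap.norm_inl_le_one ℝ (Space N) ℝ
    nlinarith [norm_nonneg (fderiv ℝ w p)]
  have h3 : |fderiv ℝ w p (0, 1)| ≤ C := by
    refine ((fderiv ℝ w p).le_opNorm _).trans ?_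
    simpa using h1
  have h4 := pow_le_pow_left₀ (norm_nonneg _) h2 2
  have h5 := pow_le_pow_left₀ (abs_nonneg _) h3 2
  rw [sq_abs] at h5
  linarith

lemma slab_mono {R Z ε ε' : ℝ} (h : ε ≤ ε') : slab N R Z ε' ⊆ slab N R Z ε :=
  prod_mono subset_rfl (Ioo_subset_Ioo_left h)

/-- Monotone convergence on slabs for an energy density. -/
lemma lintegral_slab_of_tendsto {F H : Space N × ℝ → ℝ} {R Z e : ℝ} (hZ : 0 < Z)
    (hF : ∀ p, 0 ≤ F p) (hH : IntegrableOn H (slab N R Z 0))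
    (hFH : ∀ ε ∈ Ioo 0 Z, IntegrableOn (fun p => F p - H p) (slab N R Z ε))
    (lim : Tendsto (fun ε => ∫ p in slab N R Z ε, (F p - H p)) (𝓝[>] 0) (𝓝 e)) :
    0 ≤ e + ∫ p in slab N R Z 0, H p ∧
    ∫⁻ p in slab N R Z 0, ENNReal.ofReal (F p) = ENNReal.ofReal (e + ∫ p in slab N R Z 0, H p) := by
  set a : ℕ → ℝ := fun n => Z / (n + 2) with ha
  have ha0 : ∀ n, a n ∈ Ioo 0 Z := fun n => by
    refine ⟨by positivity, ?_⟩
    rw [ha]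
    simp only
    rw [div_lt_iff₀ (by positivity)]
    have : (0 : ℝ) ≤ n := Nat.cast_nonneg n
    nlinarith
  have hanti : Antitone a := fun m n h => by
    simp only [ha]
    gcongr
  have hlim : Tendsto a atTop (𝓝[>] 0) := by
    refine tendsto_nhdsWithin_iff.mpr ⟨?_, Eventually.of_forall fun n => (ha0 n).1⟩
    have := tendsto_natCast_atTop_atTop (R := ℝ)
    exact Tendsto.div_atTop tendsto_const_nhds (tendsto_atTop_add_const_right _ 2 this)
  have hmono : Monotone fun n => slab N R Z (a n) := fun m n h => slab_mono (hanti h)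
  have hU : ⋃ n, slab N R Z (a n) = slab N R Z 0 := by
    ext p
    simp only [mem_iUnion]
    refine ⟨fun ⟨n, hn⟩ => slab_mono (ha0 n).1.le hn, fun hp => ?_⟩
    have := (hlim.mono_right nhdsWithin_le_nhds).eventually (gt_mem_nhds hp.2.1)
    obtain ⟨n, hn⟩ := this.exists
    exact ⟨n, hp.1, hn, hp.2.2⟩
  have hHlim : Tendsto (fun n => ∫ p in slab N R Z (a n), H p) atTop
      (𝓝 (∫ p in slab N R Z 0, H p)) := by
    have := tendsto_setIntegral_of_monotone (f := H) (μ := volume)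
      (fun n => measurableSet_slab (N := N) R Z (a n)) hmono (by rw [hU]; exact hH)
    rwa [hU] at this
  have hFi : ∀ n, IntegrableOn F (slab N R Z (a n)) := fun n => by
    have := (hFH (a n) (ha0 n)).add (hH.mono_set (slab_mono (ha0 n).1.le))
    refine this.congr (ae_of_all _ fun p => ?_)
    simp
  have hFlim : Tendsto (fun n => ∫ p in slab N R Z (a n), F p) atTop
      (𝓝 (e + ∫ p in slab N R Z 0, H p)) := by
    refine ((lim.comp hlim).add hHlim).congr fun n => ?_
    simp only [Function.comp]
    rw [← integral_add (hFH (a n) (ha0 n)) (hH.mono_set (slab_mono (ha0 n).1.le))]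
    simp
  refine ⟨ge_of_tendsto' hFlim fun n => setIntegral_nonneg (measurableSet_slab _ _ _)
    fun p _ => hF p, ?_⟩
  have hL : Tendsto (fun n => ∫⁻ p in slab N R Z (a n), ENNReal.ofReal (F p)) atTop
      (𝓝 (∫⁻ p in slab N R Z 0, ENNReal.ofReal (F p))) := by
    have := tendsto_measure_iUnion_atTop (μ := volume.withDensity fun p => ENNReal.ofReal (F p))
      hmono
    rw [hU] at this
    simpa only [Function.comp_def, withDensity_apply _ (measurableSet_slab _ _ _)] using this
  refine tendsto_nhds_unique hL ?_
  refine ((ENNReal.continuous_ofReal.tendsto _).comp hFlim).congr fun n => ?_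
  exact ofReal_integral_eq_lintegral_ofReal (hFi n) (ae_of_all _ hF)

section Dissipation

variable {η : Space N × ℝ → ℝ} {g : Space N → ℝ} {B : ℝ} {K : NNReal}

lemma volume_zero_height : (volume : Measure (Space N × ℝ)) (univ ×ˢ {0}) = 0 := by
  rw [Measure.volume_eq_prod, Measure.prod_prod]; simp

lemma ae_height_ne_zero : ∀ᵐ p : Space N × ℝ, p.2 ≠ 0 := by
  rw [ae_iff]
  convert volume_zero_height (N := N) using 2
  ext p; simp

/-- The dissipation of the extension of `g`, truncated from below and localized by `η`. -/
def dissipation (η : Space N × ℝ → ℝ) (g : Space N → ℝ) : ℝ≥0∞ :=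
  ∫⁻ p in B4star N, ENNReal.ofReal (gradSq (fun q => η q * max (harmonicExt g q) 0) p)

/-- The error term due to the localization. -/
def cutoffError (η : Space N × ℝ → ℝ) (g : Space N → ℝ) : ℝ :=
  ∫ p in B4star N, gradSq η p * max (harmonicExt g p) 0 ^ 2

lemma gradSq_eq_zero_of_notMem {w : Space N × ℝ → ℝ}
    (hw : ∀ p : Space N × ℝ, 0 ≤ p.2 → p ∉ B4star N → w p = 0) {p : Space N × ℝ} (hz : 0 < p.2)
    (hp : p ∉ B4star N) : gradSq w p = 0 := by
  have h1 : ∀ᶠ q : Space N × ℝ in 𝓝 p, w q = 0 := by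
    filter_upwards [(isClosed_B4star N).isOpen_compl.mem_nhds hp,
      continuous_snd.continuousAt.eventually (lt_mem_nhds hz)] with q hq hq2
    exact hw q hq2.le hq
  have h2 : (fun x => w (x, p.2)) =ᶠ[𝓝 p.1] fun _ => 0 :=
    (Continuous.tendsto (f := fun x : Space N => (x, p.2)) (by fun_prop) p.1).eventually h1
  have h3 : (fun z => w (p.1, z)) =ᶠ[𝓝 p.2] fun _ => 0 :=
    (Continuous.tendsto (f := fun z : ℝ => (p.1, z)) (by fun_prop) p.2).eventually h1
  unfold gradSq
  rw [h2.fderiv_eq, h3.deriv_eq]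
  simp

lemma mem_slab_of_mem_B4star {p : Space N × ℝ} (hp : p ∈ B4star N) (h : p.2 ≠ 0) :
    p ∈ slab N (cutRadius N) 5 0 := by
  refine ⟨by simpa using (norm_lt_of_mem_B4 hp.1).le, lt_of_le_of_ne hp.2.1 h.symm, ?_⟩
  have := hp.2.2
  linarith

lemma lintegral_B4star_eq_slab {F : Space N × ℝ → ℝ≥0∞}
    (hF : ∀ p : Space N × ℝ, 0 < p.2 → p ∉ B4star N → F p = 0) :
    ∫⁻ p in B4star N, F p = ∫⁻ p in slab N (cutRadius N) 5 0, F p := by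
  rw [← lintegral_indicator (measurableSet_B4star N), ← lintegral_indicator (measurableSet_slab _ _ _)]
  refine lintegral_congr_ae ?_
  filter_upwards [ae_height_ne_zero] with p hp
  by_cases h1 : p ∈ B4star N
  · rw [indicator_of_mem h1, indicator_of_mem (mem_slab_of_mem_B4star h1 hp)]
  · rw [indicator_of_notMem h1]
    by_cases h2 : p ∈ slab N (cutRadius N) 5 0
    · rw [indicator_of_mem h2, hF p h2.2.1 h1]
    · rw [indicator_of_notMem h2]

lemma integral_B4star_eq_slab {F : Space N × ℝ → ℝ}
    (hF : ∀ p : Space N × ℝ, 0 < p.2 → p ∉ B4star N → F p = 0) :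
    ∫ p in B4star N, F p = ∫ p in slab N (cutRadius N) 5 0, F p := by
  rw [← integral_indicator (measurableSet_B4star N), ← integral_indicator (measurableSet_slab _ _ _)]
  refine integral_congr_ae ?_
  filter_upwards [ae_height_ne_zero] with p hp
  by_cases h1 : p ∈ B4star N
  · rw [indicator_of_mem h1, indicator_of_mem (mem_slab_of_mem_B4star h1 hp)]
  · rw [indicator_of_notMem h1]
    by_cases h2 : p ∈ slab N (cutRadius N) 5 0
    · rw [indicator_of_mem h2, hF p h2.2.1 h1]
    · rw [indicator_of_notMem h2]

lemma harmonicExt_zero (g : Space N → ℝ) (x : Space N) : harmonicExt g (x, 0) = g x := by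
  simp [harmonicExt]

/-- The energy identity for the localized truncated extension. -/
lemma dissipation_eq (hN : 0 < N) (hη : IsCutoff η) (hg : LipschitzWith K g)
    (hB : ∀ x, |g x| ≤ B) :
    0 ≤ energyForm g (fun x => η (x, 0) ^ 2 * max (g x) 0) + cutoffError η g ∧
    dissipation η g =
      ENNReal.ofReal (energyForm g (fun x => η (x, 0) ^ 2 * max (g x) 0) + cutoffError η g) := by
  have hgm := hg.continuous.measurable
  have hv := continuous_harmonicExt hg.continuous hB
  have hηc := hη.smooth.continuous
  obtain ⟨K₁, hK₁⟩ := hη.isTest_sq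
  obtain ⟨K₂, hK₂⟩ := hK₁.mul_harmonicExt_posPart hg hB
  have hlim := hK₂.tendsto_green hN (by norm_num) hg hB
  simp only [harmonicExt_zero] at hlim
  have hHi : IntegrableOn (fun p => gradSq η p * max (harmonicExt g p) 0 ^ 2)
      (slab N (cutRadius N) 5 0) := by
    obtain ⟨C, hC⟩ := IsTest.gradSq_le (N := N) (R := cutRadius N) (Z := 5) hη.contDiff_one
    refine Integrable.of_bound (((measurable_gradSq hηc).mul
      ((hv.measurable.max measurable_const).pow_const 2)).aestronglyMeasurable) (C * B ^ 2)
      ((ae_restrict_iff' (measurableSet_slab _ _ _)).mpr (ae_of_all _ fun p hp => ?_))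
    rw [norm_mul, norm_pow, Real.norm_of_nonneg (gradSq_nonneg _ _)]
    have h1 := hC p hp
    have h2 := (abs_posPart_le (harmonicExt g p)).trans (abs_harmonicExt_le hB p)
    have h3 := (gradSq_nonneg η p).trans h1
    have h4 := pow_le_pow_left₀ (abs_nonneg _) h2 2
    exact mul_le_mul h1 h4 (by positivity) h3
  have key : ∀ ε, 0 < ε → EqOn (fun p : Space N × ℝ =>
      fderiv ℝ (fun x => (fun q => η q ^ 2 * max (harmonicExt g q) 0) (x, p.2)) p.1 (extDx g p)
      + deriv (fun z => (fun q => η q ^ 2 * max (harmonicExt g q) 0) (p.1, z)) p.2 * extDz g p)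
      (fun p => gradSq (fun q => η q * max (harmonicExt g q) 0) p
      - gradSq η p * max (harmonicExt g p) 0 ^ 2) (slab N (cutRadius N) 5 ε) := fun ε hε p hp =>
    green_integrand_posPart hη.contDiff_one hgm hB (hε.trans hp.2.1)
  have hlim2 : Tendsto (fun ε => ∫ p in slab N (cutRadius N) 5 ε,
      (gradSq (fun q => η q * max (harmonicExt g q) 0) p
      - gradSq η p * max (harmonicExt g p) 0 ^ 2)) (𝓝[>] 0)
      (𝓝 (energyForm g fun x => η (x, 0) ^ 2 * max (g x) 0)) := by
    refine hlim.congr' ?_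
    filter_upwards [self_mem_nhdsWithin] with ε hε
    exact setIntegral_congr_fun (measurableSet_slab _ _ _) (key ε hε)
  have hz1 : ∀ p : Space N × ℝ, 0 < p.2 → p ∉ B4star N →
      gradSq (fun q => η q * max (harmonicExt g q) 0) p = 0 := fun p hz hp =>
    gradSq_eq_zero_of_notMem (fun q hq hqn => by rw [hη.support q hq hqn, zero_mul]) hz hp
  have hz2 : ∀ p : Space N × ℝ, 0 < p.2 → p ∉ B4star N →
      gradSq η p * max (harmonicExt g p) 0 ^ 2 = 0 := fun p hz hp => by
    rw [gradSq_eq_zero_of_notMem hη.support hz hp, zero_mul]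
  have hfin := lintegral_slab_of_tendsto (by norm_num) (gradSq_nonneg _) hHi
    (fun ε hε => ((hK₂.green hgm hB hε.1 hε.2.le).1).congr_fun (key ε hε.1)
      (measurableSet_slab _ _ _)) hlim2
  unfold dissipation cutoffError
  rw [integral_B4star_eq_slab hz2, lintegral_B4star_eq_slab fun p hz hp => by
    rw [hz1 p hz hp, ENNReal.ofReal_zero]]
  exact hfin

end Dissipation

/-! ### The trace inequality -/

lemma poissonKernel_sub_comm (x y : Space N) (z : ℝ) :
    poissonKernel (x - y) z = poissonKernel (y - x) z := by
  rw [← poissonKernel_neg, neg_sub]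

/-- The Poisson integral is a contraction of `L¹`. -/
lemma integral_abs_harmonicExt_le {g : Space N → ℝ} (hg : Integrable g) {z : ℝ} (hz : 0 < z) :
    Integrable (fun x => harmonicExt g (x, z)) ∧ ∫ x, |harmonicExt g (x, z)| ≤ ∫ x, |g x| := by
  have h0 := (integrable_mul_kernel hg (integrable_poissonKernel hz)).swap
  have h1 : Integrable (Function.uncurry fun (x y : Space N) => poissonKernel (x - y) z * g y)
      (volume.prod volume) := by
    refine h0.congr (ae_of_all _ fun p => ?_)
    simp only [Function.comp, Prod.swap, Function.uncurry]
    rw [poissonKernel_sub_comm p.1 p.2, mul_comm]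
  have e : (fun x => harmonicExt g (x, z)) = fun x => ∫ y, poissonKernel (x - y) z * g y := by
    funext x; exact harmonicExt_of_pos g hz
  have hi : Integrable (fun x => harmonicExt g (x, z)) := by
    rw [e]; exact h1.integral_prod_left
  refine ⟨hi, ?_⟩
  calc ∫ x, |harmonicExt g (x, z)| ≤ ∫ x, ∫ y, |poissonKernel (x - y) z * g y| := by
        refine integral_mono hi.abs h1.abs.integral_prod_left fun x => ?_
        simp only
        rw [harmonicExt_of_pos g hz]
        exact abs_integral_le_integral_abs
    _ = ∫ y, ∫ x, |poissonKernel (x - y) z * g y| := integral_integral_swap h1.abs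
    _ = ∫ y, |g y| := by
        congr 1
        funext y
        simp_rw [abs_mul, abs_of_nonneg (poissonKernel_nonneg hz.le _)]
        rw [integral_mul_const, integral_sub_right_eq_self (fun x => poissonKernel x z),
          integral_poissonKernel hz, one_mul]

lemma integral_slab_abs_harmonicExt_le {g : Space N → ℝ} {B : ℝ} (hg : Integrable g)
    (hgc : Continuous g) (hB : ∀ x, |g x| ≤ B) {R Z : ℝ} (hZ : 0 < Z) :
    IntegrableOn (fun p => |harmonicExt g p|) (slab N R Z 0) ∧
    ∫ p in slab N R Z 0, |harmonicExt g p| ≤ Z * ∫ x, |g x| := by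
  have hi : IntegrableOn (fun p => |harmonicExt g p|) (slab N R Z 0) :=
    Integrable.of_bound (continuous_harmonicExt hgc hB).abs.aestronglyMeasurable B
      (ae_of_all _ fun p => by simpa using abs_harmonicExt_le hB p)
  refine ⟨hi, ?_⟩
  rw [IntegrableOn, volume_restrict_slab] at hi
  rw [volume_restrict_slab, integral_prod_symm _ hi]
  calc ∫ z in Ioo 0 Z, ∫ x in Metric.closedBall 0 R, |harmonicExt g (x, z)|
      ≤ ∫ _z in Ioo 0 Z, ∫ x, |g x| := by
        refine setIntegral_mono_on hi.integral_prod_right (integrableOn_const (by simp))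
          measurableSet_Ioo fun z hz => ?_
        obtain ⟨h1, h2⟩ := integral_abs_harmonicExt_le hg hz.1
        exact (setIntegral_le_integral h1.abs (ae_of_all _ fun x => abs_nonneg _)).trans h2
    _ = Z * ∫ x, |g x| := by simp [hZ.le]

/-- Smooth cut-offs at large scale. -/
lemma exists_large_cutoff (N : ℕ) : ∃ C : ℝ, ∀ ρ : ℝ, 0 < ρ → ∃ χ : Space N × ℝ → ℝ,
    ContDiff ℝ 1 χ ∧ (∀ p, ‖p‖ ≤ ρ → χ p = 1) ∧ (∀ p, 2 * ρ ≤ ‖p‖ → χ p = 0) ∧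
    ∀ p, gradSq χ p ≤ C / ρ ^ 2 := by
  obtain ⟨b, hb, hb1, hb0, hbs⟩ : ∃ b : Space N × ℝ → ℝ, ContDiff ℝ 1 b ∧ (∀ p, ‖p‖ ≤ 1 → b p = 1)
      ∧ (∀ p, 2 ≤ ‖p‖ → b p = 0) ∧ HasCompactSupport b := by
    let b : ContDiffBump (0 : Space N × ℝ) := ⟨1, 2, one_pos, one_lt_two⟩
    exact ⟨b, b.contDiff, fun p hp => b.one_of_mem_closedBall (by simpa using hp),
      fun p hp => b.zero_of_le_dist (by simpa using hp), b.hasCompactSupport⟩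
  have hd := hb.differentiable one_ne_zero
  obtain ⟨C, hC⟩ := (hb.continuous_fderiv one_ne_zero).bounded_above_of_compact_support
    (hbs.fderiv (𝕜 := ℝ))
  refine ⟨C ^ 2 + C ^ 2, fun ρ hρ => ⟨fun p => b (ρ⁻¹ • p), by fun_prop, fun p hp => ?_,
    fun p hp => ?_, fun p => ?_⟩⟩
  · refine hb1 _ ?_
    rw [norm_smul, norm_inv, Real.norm_of_nonneg hρ.le]
    exact (inv_mul_le_one₀ hρ).mpr hp
  · refine hb0 _ ?_
    rw [norm_smul, norm_inv, Real.norm_of_nonneg hρ.le]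
    rw [← div_eq_inv_mul, le_div_iff₀ hρ]
    exact hp
  · have hA := hC (ρ⁻¹ • p)
    have hq : HasFDerivAt (fun p : Space N × ℝ => b (ρ⁻¹ • p))
        ((fderiv ℝ b (ρ⁻¹ • p)).comp (ρ⁻¹ • ContinuousLinearMap.id ℝ _)) p :=
      (hd (ρ⁻¹ • p)).hasFDerivAt.comp p ((hasFDerivAt_id p).const_smul ρ⁻¹)
    set A := fderiv ℝ b (ρ⁻¹ • p)
    have hx : HasFDerivAt (fun x => b (ρ⁻¹ • (x, p.2)))
        ((A.comp (ρ⁻¹ • ContinuousLinearMap.id ℝ _)).comp (ContinuousLinearMap.inl ℝ (Space N) ℝ))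
        p.1 :=
      HasFDerivAt.comp (g := fun p : Space N × ℝ => b (ρ⁻¹ • p)) (f := fun x => (x, p.2)) p.1 hq
        (hasFDerivAt_prodMk_left p.1 p.2)
    have hz : HasDerivAt (fun z => b (ρ⁻¹ • (p.1, z)))
        ((A.comp (ρ⁻¹ • ContinuousLinearMap.id ℝ _)) (0, 1)) p.2 :=
      HasFDerivAt.comp_hasDerivAt (l := fun p : Space N × ℝ => b (ρ⁻¹ • p)) p.2 hq ((hasDerivAt_const _ _).prodMk (hasDerivAt_id _))
    have hAρ : ‖A.comp (ρ⁻¹ • ContinuousLinearMap.id ℝ (Space N × ℝ))‖ ≤ C / ρ := by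
      refine ContinuousLinearMap.opNorm_le_bound _ (div_nonneg ((norm_nonneg _).trans hA) hρ.le)
        fun v => ?_
      simp only [ContinuousLinearMap.comp_apply, _root_.smul_apply, ContinuousLinearMap.id_apply]
      refine (A.le_opNorm _).trans ?_
      rw [norm_smul, norm_inv, Real.norm_of_nonneg hρ.le, div_eq_mul_inv, mul_assoc]
      gcongr
    unfold gradSq
    rw [hx.fderiv, hz.deriv]
    have h2 : ‖(A.comp (ρ⁻¹ • ContinuousLinearMap.id ℝ _)).comp
        (ContinuousLinearMap.inl ℝ (Space N) ℝ)‖ ≤ C / ρ := by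
      refine (ContinuousLinearMap.opNorm_comp_le _ _).trans ?_
      have := ContinuousLinearMap.norm_inl_le_one ℝ (Space N) ℝ
      nlinarith [norm_nonneg (A.comp (ρ⁻¹ • ContinuousLinearMap.id ℝ (Space N × ℝ)))]
    have h3 : |(A.comp (ρ⁻¹ • ContinuousLinearMap.id ℝ _)) (0, 1)| ≤ C / ρ := by
      refine ((A.comp (ρ⁻¹ • ContinuousLinearMap.id ℝ _)).le_opNorm _).trans ?_
      simpa using hAρ
    have h4 := pow_le_pow_left₀ (norm_nonneg _) h2 2
    have h5 := pow_le_pow_left₀ (abs_nonneg _) h3 2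
    rw [sq_abs] at h5
    rw [add_div, ← div_pow]
    linarith

section Trace

variable {g : Space N → ℝ} {B : ℝ} {K : NNReal} {R₀ : ℝ}

/-- The Dirichlet energy of the harmonic extension is at most the energy of the trace. -/
lemma lintegral_gradSq_harmonicExt_le (hN : 0 < N) (hg : LipschitzWith K g) (hB : ∀ x, |g x| ≤ B)
    (h0 : ∀ x, R₀ ≤ ‖x‖ → g x = 0) (R Z : ℝ) :
    ∫⁻ p in slab N R Z 0, ENNReal.ofReal (gradSq (harmonicExt g) p)
      ≤ ENNReal.ofReal (energyForm g g) := by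
  obtain ⟨C, hC⟩ := exists_large_cutoff N
  have hgm := hg.continuous.measurable
  have hv := continuous_harmonicExt hg.continuous hB
  have hB0 : 0 ≤ B := (abs_nonneg _).trans (hB 0)
  have hgi : Integrable g := hg.continuous.integrable_of_hasCompactSupport
    (HasCompactSupport.of_support_subset_isCompact (isCompact_closedBall (0 : Space N) R₀)
      fun x hx => by
        by_contra hR
        rw [mem_closedBall_zero_iff, not_le] at hR
        exact hx (h0 x hR.le))
  have key : ∀ᶠ ρ : ℝ in atTop, ∫⁻ p in slab N R Z 0, ENNReal.ofReal (gradSq (harmonicExt g) p)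
      ≤ ENNReal.ofReal (energyForm g g + 2 * C * B * (∫ x, |g x|) / ρ) := by
    filter_upwards [eventually_gt_atTop 0, eventually_gt_atTop R, eventually_gt_atTop Z,
      eventually_gt_atTop R₀] with ρ hρ hρR hρZ hρR₀
    obtain ⟨χ, hχ, hχ1, hχ0, hχC⟩ := hC ρ hρ
    have h2ρ : 0 < 2 * ρ := by positivity
    have hχz : ∀ p : Space N × ℝ, 0 ≤ p.2 → (2 * ρ ≤ ‖p.1‖ ∨ 2 * ρ ≤ p.2) → χ p = 0 := by
      intro p _ h
      refine hχ0 p ?_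
      rcases h with h | h
      · exact h.trans (norm_fst_le p)
      · exact h.trans ((le_abs_self _).trans (norm_snd_le p))
    obtain ⟨K₁, hK₁⟩ := isTest_of_contDiff (R := 2 * ρ) (Z := 2 * ρ) (hχ.pow 2) fun p hp h => by
      rw [hχz p hp h]; simp
    obtain ⟨K₂, hK₂⟩ := hK₁.mul_harmonicExt hg hB
    have hlim := hK₂.tendsto_green hN h2ρ hg hB
    have eE : (fun x => χ (x, 0) ^ 2 * harmonicExt g (x, 0)) = g := by
      funext x
      rw [harmonicExt_zero]
      by_cases hx : R₀ ≤ ‖x‖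
      · rw [h0 x hx, mul_zero]
      · rw [hχ1 (x, 0) (by
          rw [Prod.norm_def]; simp only [norm_zero]
          exact max_le ((not_le.mp hx).le.trans hρR₀.le) hρ.le)]
        simp
    simp only [eE] at hlim
    have hdom : ∀ p, gradSq χ p * harmonicExt g p ^ 2 ≤ C / ρ ^ 2 * B * |harmonicExt g p| := by
      intro p
      have h1 := hχC p
      have h2 := abs_harmonicExt_le hB p
      rw [← sq_abs, sq, mul_assoc]
      exact mul_le_mul h1 (mul_le_mul_of_nonneg_right h2 (abs_nonneg _)) (by positivity)
        ((gradSq_nonneg _ _).trans h1)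
    obtain ⟨hi1, hi2⟩ := integral_slab_abs_harmonicExt_le hgi hg.continuous hB (R := 2 * ρ) h2ρ
    have hHi : IntegrableOn (fun p => gradSq χ p * harmonicExt g p ^ 2)
        (slab N (2 * ρ) (2 * ρ) 0) := by
      refine (hi1.const_mul (C / ρ ^ 2 * B)).mono'
        ((measurable_gradSq hχ.continuous).mul (hv.measurable.pow_const 2)).aestronglyMeasurable
        (ae_of_all _ fun p => ?_)
      rw [Real.norm_of_nonneg (mul_nonneg (gradSq_nonneg _ _) (sq_nonneg _))]
      exact hdom p
    have keyE : ∀ ε, 0 < ε → EqOn (fun p : Space N × ℝ =>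
        fderiv ℝ (fun x => (fun q => χ q ^ 2 * harmonicExt g q) (x, p.2)) p.1 (extDx g p)
        + deriv (fun z => (fun q => χ q ^ 2 * harmonicExt g q) (p.1, z)) p.2 * extDz g p)
        (fun p => gradSq (fun q => χ q * harmonicExt g q) p
        - gradSq χ p * harmonicExt g p ^ 2) (slab N (2 * ρ) (2 * ρ) ε) := fun ε hε p hp =>
      green_integrand hχ hgm hB (hε.trans hp.2.1)
    have hlim2 : Tendsto (fun ε => ∫ p in slab N (2 * ρ) (2 * ρ) ε,
        (gradSq (fun q => χ q * harmonicExt g q) p - gradSq χ p * harmonicExt g p ^ 2)) (𝓝[>] 0)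
        (𝓝 (energyForm g g)) := by
      refine hlim.congr' ?_
      filter_upwards [self_mem_nhdsWithin] with ε hε
      exact setIntegral_congr_fun (measurableSet_slab _ _ _) (keyE ε hε)
    have hfin := (lintegral_slab_of_tendsto h2ρ (gradSq_nonneg _) hHi
      (fun ε hε => ((hK₂.green hgm hB hε.1 hε.2.le).1).congr_fun (keyE ε hε.1)
        (measurableSet_slab _ _ _)) hlim2).2
    calc ∫⁻ p in slab N R Z 0, ENNReal.ofReal (gradSq (harmonicExt g) p)
        = ∫⁻ p in slab N R Z 0, ENNReal.ofReal (gradSq (fun q => χ q * harmonicExt g q) p) := by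
          refine setLIntegral_congr_fun (measurableSet_slab _ _ _) fun p hp => ?_
          have hpρ : ‖p‖ < ρ := by
            have h1 : ‖p.1‖ ≤ R := by simpa using hp.1
            rw [Prod.norm_def]
            refine max_lt (h1.trans_lt hρR) ?_
            rw [Real.norm_of_nonneg hp.2.1.le]
            exact hp.2.2.trans hρZ
          have hev : ∀ᶠ q : Space N × ℝ in 𝓝 p, harmonicExt g q = χ q * harmonicExt g q := by
            filter_upwards [continuous_norm.continuousAt.eventually (gt_mem_nhds hpρ)] with q hq
            rw [hχ1 q (le_of_lt hq), one_mul]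
          have h2 : (fun x => harmonicExt g (x, p.2)) =ᶠ[𝓝 p.1]
              fun x => χ (x, p.2) * harmonicExt g (x, p.2) :=
            (Continuous.tendsto (f := fun x : Space N => (x, p.2)) (by fun_prop) p.1).eventually hev
          have h3 : (fun z => harmonicExt g (p.1, z)) =ᶠ[𝓝 p.2]
              fun z => χ (p.1, z) * harmonicExt g (p.1, z) :=
            (Continuous.tendsto (f := fun z : ℝ => (p.1, z)) (by fun_prop) p.2).eventually hev
          simp only [gradSq]
          rw [h2.fderiv_eq, h3.deriv_eq]
      _ ≤ ∫⁻ p in slab N (2 * ρ) (2 * ρ) 0,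
            ENNReal.ofReal (gradSq (fun q => χ q * harmonicExt g q) p) := by
          refine lintegral_mono_set (prod_mono (Metric.closedBall_subset_closedBall (by linarith))
            (Ioo_subset_Ioo_right (by linarith)))
      _ ≤ _ := by
          rw [hfin]
          refine ENNReal.ofReal_le_ofReal (add_le_add le_rfl ?_)
          refine (integral_mono hHi (hi1.const_mul _) hdom).trans ?_
          rw [integral_const_mul]
          have hC0 : 0 ≤ C / ρ ^ 2 * B := by
            have := (gradSq_nonneg χ 0).trans (hχC 0)
            positivity
          refine (mul_le_mul_of_nonneg_left hi2 hC0).trans_eq ?_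
          field_simp
  have hT : Tendsto (fun ρ : ℝ => ENNReal.ofReal (energyForm g g + 2 * C * B * (∫ x, |g x|) / ρ))
      atTop (𝓝 (ENNReal.ofReal (energyForm g g))) := by
    refine (ENNReal.continuous_ofReal.tendsto _).comp ?_
    have := (tendsto_const_nhds (x := 2 * C * B * ∫ x, |g x|)).div_atTop (tendsto_id (α := ℝ))
    simpa using this.const_add (energyForm g g)
  exact ge_of_tendsto hT key

variable {η : Space N × ℝ → ℝ}

/-- The trace inequality for the localized truncated extension. -/
lemma hHalfSq_trace_le (hN : 0 < N) (hη : IsCutoff η) (hg : LipschitzWith K g)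
    (hB : ∀ x, |g x| ≤ B) :
    hHalfSq (fun x => η (x, 0) * max (g x) 0) ≤ dissipation η g := by
  have hgm := hg.continuous.measurable
  obtain ⟨K₁, hK₁⟩ := hη.isTest
  obtain ⟨K₂, hK₂⟩ := hK₁.mul_harmonicExt_posPart hg hB
  obtain ⟨B', hB'0, hB'⟩ := hK₂.exists_bound
  set w : Space N × ℝ → ℝ := fun p => η p * max (harmonicExt g p) 0 with hw
  set w₀ : Space N → ℝ := fun x => η (x, 0) * max (g x) 0 with hw₀
  have e0 : (fun x => w (x, 0)) = w₀ := by
    funext x; simp only [hw, hw₀, harmonicExt_zero]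
  have hl₀ : LipschitzWith K₂ w₀ := by rw [← e0]; exact hK₂.horiz 0 le_rfl
  have hb₀ : ∀ x, |w₀ x| ≤ B' := fun x => by rw [← e0]; exact hB' (x, 0) le_rfl
  have hz₀ : ∀ x, cutRadius N ≤ ‖x‖ → w₀ x = 0 := fun x hx => by
    rw [← e0]; exact hK₂.eq_zero (x, 0) le_rfl (Or.inl hx)
  have hm₀ := hl₀.continuous.measurable
  have hcont₀ := continuous_harmonicExt hl₀.continuous hb₀
  have hE0 : 0 ≤ energyForm w₀ w₀ := by
    have := poissonConst_pos N
    refine mul_nonneg (by positivity) (integral_nonneg fun h => div_nonneg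
      (integral_nonneg fun x => mul_self_nonneg _) (by positivity))
  have hD : dissipation η g ≠ ⊤ := by
    rw [(dissipation_eq hN hη hg hB).2]; exact ENNReal.ofReal_ne_top
  have hDslab : ∫⁻ p in slab N (cutRadius N) 5 0, ENNReal.ofReal (gradSq w p) = dissipation η g := by
    rw [dissipation, lintegral_B4star_eq_slab]
    intro p hz hp
    rw [gradSq_eq_zero_of_notMem (fun q hq hqn => by rw [hη.support q hq hqn, zero_mul]) hz hp,
      ENNReal.ofReal_zero]
  have hGle := lintegral_gradSq_harmonicExt_le hN hl₀ hb₀ hz₀ (cutRadius N) 5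
  have intOf : ∀ {F : Space N × ℝ → ℝ} {c : ℝ≥0∞}, Measurable F → (∀ p, 0 ≤ F p) → c ≠ ⊤ →
      ∫⁻ p in slab N (cutRadius N) 5 0, ENNReal.ofReal (F p) ≤ c →
      IntegrableOn F (slab N (cutRadius N) 5 0) ∧
      ∫ p in slab N (cutRadius N) 5 0, F p ≤ c.toReal := by
    intro F c hF hF0 hc h
    refine ⟨⟨hF.aestronglyMeasurable, ?_⟩, ?_⟩
    · rw [hasFiniteIntegral_iff_ofReal (ae_of_all _ hF0)]
      exact h.trans_lt hc.lt_top
    · rw [integral_eq_lintegral_of_nonneg_ae (ae_of_all _ hF0) hF.aestronglyMeasurable]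
      exact ENNReal.toReal_mono hc h
  obtain ⟨iw, hiw⟩ := intOf (measurable_gradSq hK₂.cont) (gradSq_nonneg _) hD hDslab.le
  obtain ⟨iv, hiv⟩ := intOf (measurable_gradSq hcont₀) (gradSq_nonneg _)
    ENNReal.ofReal_ne_top hGle
  rw [ENNReal.toReal_ofReal hE0] at hiv
  have hlim := hK₂.tendsto_green hN (by norm_num) hl₀ hb₀
  rw [show (fun x => (fun p => η p * max (harmonicExt g p) 0) (x, (0 : ℝ))) = w₀ from e0] at hlim
  have hle : energyForm w₀ w₀ ≤ 1 / 2 * (dissipation η g).toReal + 1 / 2 * energyForm w₀ w₀ := by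
    refine le_of_tendsto hlim ?_
    filter_upwards [Ioo_mem_nhdsGT (show (0 : ℝ) < 5 by norm_num)] with ε hε
    have hsub := slab_mono (N := N) (R := cutRadius N) (Z := 5) hε.1.le
    calc _ ≤ ∫ p in slab N (cutRadius N) 5 ε,
          (1 / 2 * gradSq w p + 1 / 2 * gradSq (harmonicExt w₀) p) :=
          setIntegral_mono_on (hK₂.green hm₀ hb₀ hε.1 hε.2.le).1
            (((iw.mono_set hsub).const_mul _).add ((iv.mono_set hsub).const_mul _))
            (measurableSet_slab _ _ _) fun p hp =>
              green_integrand_le w hm₀ hb₀ (hε.1.trans hp.2.1)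
      _ = 1 / 2 * (∫ p in slab N (cutRadius N) 5 ε, gradSq w p)
          + 1 / 2 * ∫ p in slab N (cutRadius N) 5 ε, gradSq (harmonicExt w₀) p := by
          rw [integral_add ((iw.mono_set hsub).const_mul _) ((iv.mono_set hsub).const_mul _),
            integral_const_mul, integral_const_mul]
      _ ≤ _ := by
          have h1 := (setIntegral_mono_set iw (ae_of_all _ (gradSq_nonneg _))
            hsub.eventuallyLE).trans hiw
          have h2 := (setIntegral_mono_set iv (ae_of_all _ (gradSq_nonneg _))
            hsub.eventuallyLE).trans hiv
          linarith
  rw [hHalfSq_eq_energyForm hN hl₀ hb₀ hz₀]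
  exact ENNReal.ofReal_le_of_le_toReal (by linarith)

end Trace

/-! ### Convolution with a smooth kernel -/

/-- The convolution of a bounded function with a kernel. -/
def smear (m f : Space N → ℝ) (x : Space N) : ℝ := ∫ y, m (x - y) * f y

section Smear

variable {m f : Space N → ℝ} {B : ℝ}

lemma abs_smear_le (hm : Integrable m) (hB : ∀ x, |f x| ≤ B) (x : Space N) :
    |smear m f x| ≤ (∫ y, |m y|) * B := by
  refine (norm_integral_le_of_norm_le (f := fun y => m (x - y) * f y)
    ((hm.comp_sub_left x).abs.mul_const B) (ae_of_all _ fun y => ?_)).trans_eq ?_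
  · rw [norm_mul]
    exact mul_le_mul_of_nonneg_left (hB y) (abs_nonneg _)
  · rw [integral_mul_const, integral_sub_left_eq_self (fun y => |m y|)]

lemma measurable_smear {α : Type*} [MeasurableSpace α] (hm : Measurable m) {F : α → Space N → ℝ}
    (hF : Measurable (Function.uncurry F)) :
    Measurable (fun p : α × Space N => smear m (F p.1) p.2) := by
  refine (StronglyMeasurable.integral_prod_right
    (f := fun (p : α × Space N) y => m (p.2 - y) * F p.1 y) ?_).measurable
  refine Measurable.stronglyMeasurable (Measurable.mul ?_ ?_)
  · exact hm.comp ((measurable_snd.comp measurable_fst).sub measurable_snd)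
  · exact hF.comp ((measurable_fst.comp measurable_fst).prodMk measurable_snd)

lemma integrable_of_smooth (hm : ContDiff ℝ (⊤ : ℕ∞) m) (hc : HasCompactSupport m) :
    Integrable m := hm.continuous.integrable_of_hasCompactSupport hc

lemma integrable_fderiv_of_smooth (hm : ContDiff ℝ (⊤ : ℕ∞) m) (hc : HasCompactSupport m) :
    Integrable (fderiv ℝ m) :=
  (hm.continuous_fderiv (by simp)).integrable_of_hasCompactSupport (hc.fderiv (𝕜 := ℝ))

lemma exists_bound_fderiv (hm : ContDiff ℝ (⊤ : ℕ∞) m) (hc : HasCompactSupport m) :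
    ∃ C, ∀ x, ‖fderiv ℝ m x‖ ≤ C :=
  (hc.fderiv (𝕜 := ℝ)).exists_bound_of_continuous (hm.continuous_fderiv (by simp))

lemma exists_lipschitz_fderiv (hm : ContDiff ℝ (⊤ : ℕ∞) m) (hc : HasCompactSupport m) :
    ∃ L, LipschitzWith L (fderiv ℝ m) :=
  ContDiff.lipschitzWith_of_hasCompactSupport (hc.fderiv (𝕜 := ℝ))
    (hm.fderiv_right (m := (⊤ : ℕ∞)) le_rfl) (by simp)

lemma exists_support_radius {F : Type*} [Zero F] {m : Space N → F} (hc : HasCompactSupport m) :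
    ∃ r, 0 ≤ r ∧ ∀ x, r < ‖x‖ → m x = 0 := by
  obtain ⟨r, hr⟩ := hc.isCompact.isBounded.subset_closedBall (0 : Space N)
  refine ⟨max r 0, le_max_right _ _, fun x hx => ?_⟩
  by_contra h
  have := hr (subset_tsupport m h)
  rw [mem_closedBall_zero_iff] at this
  exact absurd (this.trans (le_max_left _ _)) (not_le.mpr hx)

lemma integrable_smul_fderiv (hm : ContDiff ℝ (⊤ : ℕ∞) m) (hc : HasCompactSupport m)
    (hf : Measurable f) (hB : ∀ x, |f x| ≤ B) (x : Space N) :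
    Integrable (fun y => f y • fderiv ℝ m (x - y)) :=
  ((integrable_fderiv_of_smooth hm hc).comp_sub_left x).bdd_smul B hf.aestronglyMeasurable
    (ae_of_all _ hB)

lemma hasFDerivAt_smear (hm : ContDiff ℝ (⊤ : ℕ∞) m) (hc : HasCompactSupport m)
    (hf : Measurable f) (hB : ∀ x, |f x| ≤ B) (x : Space N) :
    HasFDerivAt (smear m f) (∫ y, f y • fderiv ℝ m (x - y)) x := by
  obtain ⟨C, hC⟩ := exists_bound_fderiv hm hc
  obtain ⟨r, hr0, hr⟩ := exists_support_radius (hc.fderiv (𝕜 := ℝ))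
  have hB0 : 0 ≤ B := (abs_nonneg _).trans (hB 0)
  have hC0 : 0 ≤ C := (norm_nonneg _).trans (hC 0)
  have hd := hm.differentiable (by simp)
  refine hasFDerivAt_integral_of_dominated_of_fderiv_le
    (F := fun x y => m (x - y) * f y) (F' := fun x y => f y • fderiv ℝ m (x - y))
    (bound := (Metric.closedBall x (r + 1)).indicator fun _ => B * C)
    (Metric.ball_mem_nhds x one_pos) ?_ ?_ ?_ ?_ ?_ ?_
  · have := hm.continuous.measurable
    exact Eventually.of_forall fun x => Measurable.aestronglyMeasurable (by fun_prop)
  · exact integrable_kernel_mul (integrable_of_smooth hm hc) hf hB x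
  · exact (integrable_smul_fderiv hm hc hf hB x).aestronglyMeasurable
  · refine ae_of_all _ fun y x' hx' => ?_
    by_cases hy : y ∈ Metric.closedBall x (r + 1)
    · rw [indicator_of_mem hy, norm_smul]
      exact mul_le_mul (hB y) (hC _) (norm_nonneg _) hB0
    · rw [indicator_of_notMem hy, hr (x' - y), smul_zero, norm_zero]
      rw [mem_closedBall_iff_norm, not_le] at hy
      rw [mem_ball_iff_norm] at hx'
      have e : y - x = (x' - x) - (x' - y) := by abel
      have := norm_sub_le (x' - x) (x' - y)
      rw [← e] at this
      linarith
  · exact (integrable_indicator_iff measurableSet_closedBall).mpr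
      (integrableOn_const measure_closedBall_lt_top.ne)
  · refine ae_of_all _ fun y x' _ => ?_
    have h := (hd (x' - y)).hasFDerivAt.comp x' ((hasFDerivAt_id x').sub_const y)
    refine (h.mul_const (f y)).congr_fderiv ?_
    ext v; simp

lemma fderiv_smear_apply (hm : ContDiff ℝ (⊤ : ℕ∞) m) (hc : HasCompactSupport m)
    (hf : Measurable f) (hB : ∀ x, |f x| ≤ B) (x v : Space N) :
    fderiv ℝ (smear m f) x v = ∫ y, f y * fderiv ℝ m (x - y) v := by
  rw [(hasFDerivAt_smear hm hc hf hB x).fderiv,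
    ContinuousLinearMap.integral_apply (integrable_smul_fderiv hm hc hf hB x)]
  simp

lemma exists_lipschitz_smear (hm : ContDiff ℝ (⊤ : ℕ∞) m) (hc : HasCompactSupport m)
    (hf : Measurable f) (hB : ∀ x, |f x| ≤ B) : ∃ K, LipschitzWith K (smear m f) := by
  have hB0 : 0 ≤ B := (abs_nonneg _).trans (hB 0)
  have hI : 0 ≤ ∫ y, ‖fderiv ℝ m y‖ := integral_nonneg fun _ => norm_nonneg _
  refine ⟨(B * ∫ y, ‖fderiv ℝ m y‖).toNNReal, lipschitzWith_of_nnnorm_fderiv_le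
    (fun x => (hasFDerivAt_smear hm hc hf hB x).differentiableAt) fun x => ?_⟩
  rw [(hasFDerivAt_smear hm hc hf hB x).fderiv, ← NNReal.coe_le_coe, coe_nnnorm,
    Real.coe_toNNReal _ (by positivity)]
  refine (norm_integral_le_of_norm_le
    (((integrable_fderiv_of_smooth hm hc).comp_sub_left x).norm.const_mul B)
    (ae_of_all _ fun y => ?_)).trans_eq ?_
  · rw [norm_smul]
    exact mul_le_mul_of_nonneg_right (hB y) (norm_nonneg _)
  · rw [integral_const_mul, integral_sub_left_eq_self (fun y => ‖fderiv ℝ m y‖)]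

lemma integrable_secondDiff (hm : Integrable m) (h : Space N) :
    Integrable (fun y => 2 * m y - m (y + h) - m (y - h)) :=
  ((hm.const_mul 2).sub (hm.comp_add_right h)).sub (hm.comp_sub_right h)

lemma exists_integral_secondDiff_le (hm : ContDiff ℝ (⊤ : ℕ∞) m) (hc : HasCompactSupport m) :
    ∃ C, 0 ≤ C ∧ ∀ h, ∫ y, |2 * m y - m (y + h) - m (y - h)| ≤ C * min 1 (‖h‖ ^ 2) := by
  obtain ⟨L, hL⟩ := exists_lipschitz_fderiv hm hc
  obtain ⟨r, hr0, hr⟩ := exists_support_radius hc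
  have hd := hm.differentiable (by simp)
  have hmi := integrable_of_smooth hm hc
  set V : ℝ := ∫ y : Space N, (Metric.closedBall (0 : Space N) (r + 1)).indicator (fun _ => (1 : ℝ)) y
  have hV : 0 ≤ V := integral_nonneg fun y => indicator_nonneg (fun _ _ => zero_le_one) y
  have hI : 0 ≤ ∫ y, |m y| := integral_nonneg fun _ => abs_nonneg _
  refine ⟨4 * (∫ y, |m y|) + L * V, by positivity, fun h => ?_⟩
  rcases le_total 1 ‖h‖ with hh | hh
  · rw [min_eq_left (one_le_pow₀ hh), mul_one]
    have i0 : Integrable (fun y => |m y|) := hmi.abs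
    have i1 : Integrable (fun y => |m (y + h)|) := i0.comp_add_right h
    have i2 : Integrable (fun y => |m (y - h)|) := i0.comp_sub_right h
    have i3 : Integrable (fun y => 2 * |m y| + |m (y + h)|) := (i0.const_mul 2).add i1
    calc ∫ y, |2 * m y - m (y + h) - m (y - h)|
        ≤ ∫ y, (2 * |m y| + |m (y + h)| + |m (y - h)|) := by
          refine integral_mono (integrable_secondDiff hmi h).abs (i3.add i2) fun y => ?_
          refine (abs_sub _ _).trans (add_le_add ((abs_sub _ _).trans ?_) le_rfl)
          rw [abs_mul, abs_two]
      _ = 4 * ∫ y, |m y| := by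
          rw [integral_add i3 i2, integral_add (i0.const_mul 2) i1, integral_const_mul,
            integral_add_right_eq_self (fun y => |m y|), integral_sub_right_eq_self (fun y => |m y|)]
          ring
      _ ≤ _ := by
          have : 0 ≤ (L : ℝ) * V := mul_nonneg L.2 hV
          linarith
  · rw [min_eq_right (pow_le_one₀ (norm_nonneg h) hh)]
    have hpt : ∀ y, |2 * m y - m (y + h) - m (y - h)| ≤ L * ‖h‖ ^ 2 := by
      intro y
      have hF : LipschitzWith (L * ‖h‖₊) (fun y => m (y + h) - m y) := by
        have hfd : ∀ y, HasFDerivAt (fun y => m (y + h) - m y)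
            (fderiv ℝ m (y + h) - fderiv ℝ m y) y := fun y => by
          have h1 := (hd (y + h)).hasFDerivAt.comp y ((hasFDerivAt_id y).add_const h)
          rw [ContinuousLinearMap.comp_id] at h1
          exact h1.sub (hd y).hasFDerivAt
        refine lipschitzWith_of_nnnorm_fderiv_le (fun y => (hfd y).differentiableAt) fun y => ?_
        rw [(hfd y).fderiv, ← NNReal.coe_le_coe, coe_nnnorm]
        have := hL.dist_le_mul (y + h) y
        rwa [dist_eq_norm, dist_eq_norm, add_sub_cancel_left] at this
      have h1 := hF.dist_le_mul (y - h) y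
      simp only [dist_eq_norm, sub_add_cancel, sub_sub_cancel_left, norm_neg] at h1
      have e : 2 * m y - m (y + h) - m (y - h) = m y - m (y - h) - (m (y + h) - m y) := by ring
      rw [e]
      refine h1.trans_eq ?_
      push_cast
      ring
    have hpt2 : ∀ y, |2 * m y - m (y + h) - m (y - h)| ≤
        L * ‖h‖ ^ 2 * (Metric.closedBall (0 : Space N) (r + 1)).indicator (fun _ => (1 : ℝ)) y := by
      intro y
      by_cases hy : y ∈ Metric.closedBall (0 : Space N) (r + 1)
      · rw [indicator_of_mem hy, mul_one]; exact hpt y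
      · rw [mem_closedBall_zero_iff, not_le] at hy
        have h1 := norm_sub_norm_le y h
        have h2 := norm_sub_norm_le y (-h)
        rw [sub_neg_eq_add, norm_neg] at h2
        rw [hr y (by linarith), hr (y + h) (by linarith), hr (y - h) (by linarith)]
        simp [hy.not_ge]
    calc ∫ y, |2 * m y - m (y + h) - m (y - h)|
        ≤ ∫ y, L * ‖h‖ ^ 2 *
            (Metric.closedBall (0 : Space N) (r + 1)).indicator (fun _ => (1 : ℝ)) y :=
          integral_mono (integrable_secondDiff hmi h).abs
            (integrable_indicator_closedBall.const_mul _) hpt2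
      _ = L * V * ‖h‖ ^ 2 := by rw [integral_const_mul]; ring
      _ ≤ _ := by
          have : 0 ≤ 4 * (∫ y, |m y|) * ‖h‖ ^ 2 := by positivity
          linarith

lemma smear_secondDiff (hm : Integrable m) (hf : Measurable f) (hB : ∀ x, |f x| ≤ B)
    (x h : Space N) : 2 * smear m f x - smear m f (x + h) - smear m f (x - h)
      = ∫ y, (2 * m (x - y) - m (x - y + h) - m (x - y - h)) * f y := by
  have i0 := integrable_kernel_mul hm hf hB
  have e1 : smear m f (x + h) = ∫ y, m (x - y + h) * f y := by
    unfold smear; simp_rw [add_sub_right_comm]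
  have e2 : smear m f (x - h) = ∫ y, m (x - y - h) * f y := by
    unfold smear; simp_rw [sub_right_comm]
  have i1 : Integrable (fun y => m (x - y + h) * f y) := by
    simpa only [add_sub_right_comm] using i0 (x + h)
  have i2 : Integrable (fun y => m (x - y - h) * f y) := by
    simpa only [sub_right_comm] using i0 (x - h)
  have i3 : Integrable (fun y => 2 * (m (x - y) * f y)) := (i0 x).const_mul 2
  have i4 : Integrable (fun y => 2 * (m (x - y) * f y) - m (x - y + h) * f y) := i3.sub i1
  rw [e1, e2, smear, ← integral_const_mul, ← integral_sub i3 i1, ← integral_sub i4 i2]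
  congr 1
  funext y
  ring

lemma exists_smear_secondDiff_le (hm : ContDiff ℝ (⊤ : ℕ∞) m) (hc : HasCompactSupport m)
    (B : ℝ) : ∃ C, ∀ f : Space N → ℝ, Measurable f → (∀ x, |f x| ≤ B) → ∀ x h,
      |2 * smear m f x - smear m f (x + h) - smear m f (x - h)| ≤ C * min 1 (‖h‖ ^ 2) := by
  obtain ⟨C, hC0, hC⟩ := exists_integral_secondDiff_le hm hc
  have hmi := integrable_of_smooth hm hc
  refine ⟨B * C, fun f hf hB x h => ?_⟩
  have hB0 : 0 ≤ B := (abs_nonneg _).trans (hB 0)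
  have hi := (integrable_secondDiff hmi h).comp_sub_left x
  rw [smear_secondDiff hmi hf hB]
  refine (norm_integral_le_of_norm_le
    (f := fun y => (2 * m (x - y) - m (x - y + h) - m (x - y - h)) * f y)
    (hi.abs.mul_const B) (ae_of_all _ fun y => ?_)).trans ?_
  · rw [norm_mul]
    exact mul_le_mul_of_nonneg_left (hB y) (abs_nonneg _)
  · rw [integral_mul_const,
      integral_sub_left_eq_self (fun y => |2 * m y - m (y + h) - m (y - h)|), mul_comm, mul_assoc]
    exact mul_le_mul_of_nonneg_left (hC h) hB0

lemma integrable_secondDiff_prod (hN : 0 < N) (hm : ContDiff ℝ (⊤ : ℕ∞) m)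
    (hc : HasCompactSupport m) (hf : Measurable f) (hB : ∀ x, |f x| ≤ B) (x : Space N) :
    Integrable (Function.uncurry fun (y h : Space N) =>
      f y * ((2 * m (x - y) - m (x - y + h) - m (x - y - h)) / ‖h‖ ^ (N + 1)))
      (volume.prod volume) := by
  obtain ⟨C, hC0, hC⟩ := exists_integral_secondDiff_le hm hc
  have hmi := integrable_of_smooth hm hc
  have hmm := hm.continuous.measurable
  have hB0 : 0 ≤ B := (abs_nonneg _).trans (hB 0)
  have hmeas : StronglyMeasurable (Function.uncurry fun (y h : Space N) =>
      f y * ((2 * m (x - y) - m (x - y + h) - m (x - y - h)) / ‖h‖ ^ (N + 1))) :=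
    Measurable.stronglyMeasurable (by unfold Function.uncurry; fun_prop)
  have hi : ∀ h, Integrable (fun y => 2 * m (x - y) - m (x - y + h) - m (x - y - h)) :=
    fun h => (integrable_secondDiff hmi h).comp_sub_left x
  rw [integrable_prod_iff' hmeas.aestronglyMeasurable]
  refine ⟨ae_of_all _ fun h => ((hi h).div_const (‖h‖ ^ (N + 1))).bdd_mul
    hf.aestronglyMeasurable (ae_of_all _ hB), ?_⟩
  refine ((integrable_incrWeight hN).const_mul (B * C)).mono'
    hmeas.norm.integral_prod_left'.aestronglyMeasurable (ae_of_all _ fun h => ?_)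
  rw [Real.norm_of_nonneg (integral_nonneg fun _ => norm_nonneg _)]
  calc ∫ y, ‖f y * ((2 * m (x - y) - m (x - y + h) - m (x - y - h)) / ‖h‖ ^ (N + 1))‖
      ≤ ∫ y, B / ‖h‖ ^ (N + 1) * |2 * m (x - y) - m (x - y + h) - m (x - y - h)| := by
        refine integral_mono_of_nonneg (ae_of_all _ fun _ => norm_nonneg _)
          ((hi h).abs.const_mul _) (ae_of_all _ fun y => ?_)
        simp only [Real.norm_eq_abs, abs_mul, abs_div, abs_pow, abs_norm]
        rw [div_mul_eq_mul_div, ← mul_div_assoc]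
        gcongr
        exact hB y
    _ = B / ‖h‖ ^ (N + 1) * ∫ y, |2 * m y - m (y + h) - m (y - h)| := by
        rw [integral_const_mul,
          integral_sub_left_eq_self (fun y => |2 * m y - m (y + h) - m (y - h)|)]
    _ ≤ B / ‖h‖ ^ (N + 1) * (C * min 1 (‖h‖ ^ 2)) := by
        gcongr
        exact hC h
    _ = B * C * incrWeight h := by
        unfold incrWeight
        ring

/-- The half Laplacian commutes with convolution. -/
lemma integral_mul_halfLaplacian_comp (hN : 0 < N) (hm : ContDiff ℝ (⊤ : ℕ∞) m)
    (hc : HasCompactSupport m) (hf : Measurable f) (hB : ∀ x, |f x| ≤ B) (x : Space N) :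
    ∫ y, f y * halfLaplacian (fun y => m (x - y)) y = halfLaplacian (smear m f) x := by
  have hp := integrable_secondDiff_prod hN hm hc hf hB x
  have hmi := integrable_of_smooth hm hc
  have e1 : ∀ y, f y * halfLaplacian (fun y => m (x - y)) y = poissonConst N / 2 *
      ∫ h, f y * ((2 * m (x - y) - m (x - y + h) - m (x - y - h)) / ‖h‖ ^ (N + 1)) := by
    intro y
    rw [integral_const_mul, halfLaplacian]
    have : ∀ h, (2 * m (x - y) - m (x - (y + h)) - m (x - (y - h))) / ‖h‖ ^ (N + 1)
        = (2 * m (x - y) - m (x - y + h) - m (x - y - h)) / ‖h‖ ^ (N + 1) := fun h => by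
      rw [← sub_sub, sub_sub_eq_add_sub, add_sub_right_comm]
      ring
    simp_rw [this]
    ring
  simp_rw [e1]
  rw [integral_const_mul, integral_integral_swap hp, halfLaplacian]
  congr 2
  funext h
  rw [smear_secondDiff hmi hf hB, ← integral_div]
  congr 1
  funext y
  ring

lemma integrable_mul_halfLaplacian_comp (hN : 0 < N) (hm : ContDiff ℝ (⊤ : ℕ∞) m)
    (hc : HasCompactSupport m) (hf : Measurable f) (hB : ∀ x, |f x| ≤ B) (x : Space N) :
    Integrable fun y => f y * halfLaplacian (fun y => m (x - y)) y := by
  refine ((integrable_secondDiff_prod hN hm hc hf hB x).integral_prod_left.const_mul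
    (poissonConst N / 2)).congr (ae_of_all _ fun y => ?_)
  simp only [Function.uncurry]
  rw [integral_const_mul, halfLaplacian]
  have : ∀ h, (2 * m (x - y) - m (x - (y + h)) - m (x - (y - h))) / ‖h‖ ^ (N + 1)
      = (2 * m (x - y) - m (x - y + h) - m (x - y - h)) / ‖h‖ ^ (N + 1) := fun h => by
    rw [← sub_sub, sub_sub_eq_add_sub, add_sub_right_comm]
    ring
  simp_rw [this]
  ring

lemma measurable_halfLaplacian {α : Type*} [MeasurableSpace α] {G : α → Space N → ℝ}
    (hG : Measurable (Function.uncurry G)) :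
    Measurable (fun p : α × Space N => halfLaplacian (G p.1) p.2) := by
  refine Measurable.const_mul (StronglyMeasurable.integral_prod_right
    (f := fun (p : α × Space N) h =>
      (2 * G p.1 p.2 - G p.1 (p.2 + h) - G p.1 (p.2 - h)) / ‖h‖ ^ (N + 1)) ?_).measurable _
  have h0 : Measurable fun q : (α × Space N) × Space N => G q.1.1 q.1.2 := by fun_prop
  have h1 : Measurable fun q : (α × Space N) × Space N => G q.1.1 (q.1.2 + q.2) :=
    hG.comp ((measurable_fst.comp measurable_fst).prodMk
      ((measurable_snd.comp measurable_fst).add measurable_snd))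
  have h2 : Measurable fun q : (α × Space N) × Space N => G q.1.1 (q.1.2 - q.2) :=
    hG.comp ((measurable_fst.comp measurable_fst).prodMk
      ((measurable_snd.comp measurable_fst).sub measurable_snd))
  exact Measurable.stronglyMeasurable ((((h0.const_mul 2).sub h1).sub h2).div (by fun_prop))

lemma abs_halfLaplacian_le (hN : 0 < N) {g : Space N → ℝ} {C : ℝ}
    (hC : ∀ x h, |2 * g x - g (x + h) - g (x - h)| ≤ C * min 1 (‖h‖ ^ 2)) (x : Space N) :
    |halfLaplacian g x| ≤ poissonConst N / 2 * (C * ∫ h : Space N, incrWeight h) := by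
  have hp := (poissonConst_pos N).le
  rw [halfLaplacian, abs_mul, abs_of_nonneg (by positivity)]
  refine mul_le_mul_of_nonneg_left ?_ (by positivity)
  rw [← integral_const_mul]
  refine norm_integral_le_of_norm_le
    (f := fun h => (2 * g x - g (x + h) - g (x - h)) / ‖h‖ ^ (N + 1))
    ((integrable_incrWeight hN).const_mul C) (ae_of_all _ fun h => ?_)
  rw [norm_div, Real.norm_eq_abs, norm_pow, norm_norm, incrWeight, ← mul_div_assoc]
  gcongr
  exact hC x h

end Smear

/-! ### Mollifiers -/

/-- A smooth probability density supported in the ball of radius `δ`, with the natural bounds. -/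
structure IsMollifier (C δ : ℝ) (m : Space N → ℝ) : Prop where
  smooth : ContDiff ℝ (⊤ : ℕ∞) m
  compact : HasCompactSupport m
  nonneg : ∀ x, 0 ≤ m x
  integral_eq_one : ∫ x, m x = 1
  eq_zero : ∀ x, δ < ‖x‖ → m x = 0
  fderiv_eq_zero : ∀ x, δ < ‖x‖ → fderiv ℝ m x = 0
  le : ∀ x, m x ≤ C / δ ^ N
  fderiv_le : ∀ x, ‖fderiv ℝ m x‖ ≤ C / δ ^ (N + 1)

lemma exists_isMollifier (N : ℕ) : ∃ C : ℝ, 0 ≤ C ∧ ∀ δ : ℝ, 0 < δ →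
    ∃ m : Space N → ℝ, IsMollifier C δ m := by
  let b : ContDiffBump (0 : Space N) := ⟨1 / 2, 1, by norm_num, by norm_num⟩
  set φ : Space N → ℝ := b.normed volume with hφ
  have hs : ContDiff ℝ (⊤ : ℕ∞) φ := b.contDiff_normed
  have hc : HasCompactSupport φ := b.hasCompactSupport_normed
  obtain ⟨C₁, h₁⟩ := hc.exists_bound_of_continuous hs.continuous
  obtain ⟨C₂, h₂⟩ := exists_bound_fderiv hs hc
  have hz : ∀ x : Space N, 1 < ‖x‖ → φ x = 0 := fun x hx => by
    by_contra h
    have : x ∈ Function.support φ := h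
    rw [hφ, b.support_normed_eq, mem_ball_zero_iff] at this
    exact absurd this (not_lt.mpr hx.le)
  refine ⟨max C₁ C₂, ((norm_nonneg _).trans (h₁ 0)).trans (le_max_left _ _), fun δ hδ => ?_⟩
  have hδ' : δ⁻¹ ≠ 0 := inv_ne_zero hδ.ne'
  have hd : ∀ x, HasFDerivAt (fun x => (δ ^ N)⁻¹ * φ (δ⁻¹ • x))
      ((δ ^ N)⁻¹ • δ⁻¹ • fderiv ℝ φ (δ⁻¹ • x)) x := fun x => by
    have h := (hs.differentiable (by simp) (δ⁻¹ • x)).hasFDerivAt.comp x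
      ((hasFDerivAt_id x).const_smul δ⁻¹)
    refine (h.const_mul ((δ ^ N)⁻¹)).congr_fderiv ?_
    ext v; simp
  have hn : ∀ x : Space N, δ < ‖x‖ → 1 < ‖δ⁻¹ • x‖ := fun x hx => by
    rw [norm_smul, norm_inv, Real.norm_of_nonneg hδ.le, ← div_eq_inv_mul, one_lt_div hδ]
    exact hx
  have hz' : ∀ x : Space N, δ < ‖x‖ → (δ ^ N)⁻¹ * φ (δ⁻¹ • x) = 0 := fun x hx => by
    rw [hz _ (hn x hx), mul_zero]
  refine ⟨fun x => (δ ^ N)⁻¹ * φ (δ⁻¹ • x), ?_, ?_, ?_, ?_, hz', ?_, ?_, ?_⟩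
  · exact contDiff_const.mul (hs.comp (contDiff_const_smul _))
  · exact (hc.comp_smul hδ').mul_left
  · exact fun x => mul_nonneg (by positivity) (b.nonneg_normed _)
  · rw [integral_const_mul, Measure.integral_comp_inv_smul_of_nonneg _ _ hδ.le,
      b.integral_normed]
    simp [hδ.ne']
  · intro x hx
    have : (fun x => (δ ^ N)⁻¹ * φ (δ⁻¹ • x)) =ᶠ[𝓝 x] fun _ => 0 := by
      filter_upwards [continuous_norm.continuousAt.eventually (lt_mem_nhds hx)] with y hy
      exact hz' y hy
    rw [this.fderiv_eq]; simp
  · intro x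
    rw [div_eq_inv_mul]
    gcongr
    exact ((le_abs_self _).trans (h₁ _)).trans (le_max_left _ _)
  · intro x
    rw [(hd x).fderiv, norm_smul, norm_smul, Real.norm_of_nonneg (by positivity),
      Real.norm_of_nonneg (by positivity), ← mul_assoc, ← mul_inv, ← pow_succ, div_eq_inv_mul]
    gcongr
    exact (h₂ _).trans (le_max_right _ _)

/-- The mean deviation of `f` from `f x` in the ball of radius `δ` about `x`, up to a constant. -/
def meanDev (f : Space N → ℝ) (δ : ℝ) (x : Space N) : ℝ :=
  (δ ^ N)⁻¹ * ∫ h in Metric.closedBall (0 : Space N) δ, |f (x + h) - f x|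

section MeanDev

variable {f : Space N → ℝ} {B δ : ℝ}

lemma measurable_meanDev (hf : Measurable f) : Measurable (meanDev f δ) := by
  refine Measurable.const_mul (StronglyMeasurable.integral_prod_right
    (f := fun (x h : Space N) => |f (x + h) - f x|) ?_).measurable _
  exact Measurable.stronglyMeasurable (by unfold Function.uncurry; fun_prop)

lemma meanDev_nonneg (hδ : 0 < δ) (x : Space N) : 0 ≤ meanDev f δ x :=
  mul_nonneg (by positivity) (integral_nonneg fun _ => abs_nonneg _)

lemma integrableOn_abs_incr (hf : Measurable f) (hB : ∀ x, |f x| ≤ B) (x : Space N) :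
    IntegrableOn (fun h => |f (x + h) - f x|) (Metric.closedBall (0 : Space N) δ) := by
  refine Measure.integrableOn_of_bounded (M := B + B) measure_closedBall_lt_top.ne
    (Measurable.aestronglyMeasurable (by fun_prop)) (ae_of_all _ fun h => ?_)
  rw [norm_abs_eq_norm]
  exact (norm_sub_le _ _).trans (add_le_add (hB _) (hB _))

lemma meanDev_le (hδ : 0 < δ) (hf : Measurable f) (hB : ∀ x, |f x| ≤ B) (x : Space N) :
    meanDev f δ x ≤ 2 * B * volume.real (Metric.closedBall (0 : Space N) 1) := by
  have h1 : ∫ h in Metric.closedBall (0 : Space N) δ, |f (x + h) - f x| ≤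
      ∫ _h in Metric.closedBall (0 : Space N) δ, 2 * B := by
    refine setIntegral_mono_on (integrableOn_abs_incr hf hB x)
      (integrableOn_const measure_closedBall_lt_top.ne) measurableSet_closedBall fun h _ => ?_
    rw [two_mul]
    exact (abs_sub _ _).trans (add_le_add (hB _) (hB _))
  rw [setIntegral_const, smul_eq_mul, Measure.addHaar_real_closedBall' _ _ hδ.le,
    finrank_euclideanSpace_fin] at h1
  rw [meanDev, inv_mul_le_iff₀ (by positivity)]
  linarith

lemma tendsto_meanDev (hf : Measurable f) (hB : ∀ x, |f x| ≤ B) {δ : ℕ → ℝ}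
    (hδ : ∀ n, 0 < δ n) (hlim : Tendsto δ atTop (𝓝 0)) :
    ∀ᵐ x, Tendsto (fun n => meanDev f (δ n) x) atTop (𝓝 0) := by
  have hloc : LocallyIntegrable f := (locallyIntegrable_const B).mono hf.aestronglyMeasurable
    (ae_of_all _ fun x => (hB x).trans (le_abs_self B))
  have hlim' : Tendsto δ atTop (𝓝[>] 0) :=
    tendsto_nhdsWithin_iff.mpr ⟨hlim, Eventually.of_forall hδ⟩
  filter_upwards [IsUnifLocDoublingMeasure.ae_tendsto_average_norm_sub volume hloc 1] with x hx
  have h := (hx (fun _ => x) δ hlim' (Eventually.of_forall fun n => by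
    simp [(hδ n).le])).mul_const (volume.real (Metric.closedBall (0 : Space N) 1))
  rw [zero_mul] at h
  refine h.congr fun n => ?_
  have e : ∫ y in Metric.closedBall x (δ n), ‖f y - f x‖ =
      ∫ h in Metric.closedBall (0 : Space N) (δ n), |f (x + h) - f x| := by
    rw [← integral_indicator measurableSet_closedBall, ← integral_add_left_eq_self _ x,
      ← integral_indicator measurableSet_closedBall]
    congr 1
    funext h
    simp only [indicator, Metric.mem_closedBall, dist_self_add_left, dist_zero_right,
      Real.norm_eq_abs]
  have hV : 0 < volume.real (Metric.closedBall (0 : Space N) 1) :=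
    ENNReal.toReal_pos (Metric.measure_closedBall_pos _ _ one_pos).ne'
      measure_closedBall_lt_top.ne
  have hn := hδ n
  rw [setAverage_eq, smul_eq_mul, meanDev, e, Measure.addHaar_real_closedBall' _ _ (hδ n).le,
    finrank_euclideanSpace_fin]
  field_simp

/-- Integrals against a kernel of mean zero at scale `δ` are controlled by the mean deviation. -/
lemma norm_integral_smul_sub_le {F : Type*} [NormedAddCommGroup F] [NormedSpace ℝ F]
    {k : Space N → F} {C : ℝ} (hf : Measurable f) (hB : ∀ x, |f x| ≤ B)
    (h0 : ∀ x, δ < ‖x‖ → k x = 0) (hk : ∀ x, ‖k x‖ ≤ C) (x : Space N) :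
    ‖∫ y, (f y - f x) • k (x - y)‖ ≤
      C * ∫ h in Metric.closedBall (0 : Space N) δ, |f (x + h) - f x| := by
  rw [← integral_add_left_eq_self _ x, ← integral_const_mul,
    ← integral_indicator measurableSet_closedBall]
  refine norm_integral_le_of_norm_le ((integrable_indicator_iff measurableSet_closedBall).mpr
    ((integrableOn_abs_incr hf hB x).const_mul C)) (ae_of_all _ fun h => ?_)
  by_cases hh : h ∈ Metric.closedBall (0 : Space N) δ
  · rw [indicator_of_mem hh, norm_smul, mul_comm]
    exact mul_le_mul_of_nonneg_right (hk _) (norm_nonneg _)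
  · rw [indicator_of_notMem hh, h0, smul_zero, norm_zero]
    rw [mem_closedBall_zero_iff, not_le] at hh
    rwa [sub_add_cancel_left, norm_neg]

end MeanDev

/-! ### The commutator of the nonlinearity with a mollifier -/

/-- The inner integral of the Gagliardo seminorm. -/
def incrEnergy (f : Space N → ℝ) (x : Space N) : ℝ≥0∞ :=
  ∫⁻ y, ENNReal.ofReal ((f x - f y) ^ 2 / ‖x - y‖ ^ (N + 1))

lemma measurable_incrEnergy {f : Space N → ℝ} (hf : Measurable f) : Measurable (incrEnergy f) := by
  refine Measurable.lintegral_prod_right' (f := fun p : Space N × Space N =>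
    ENNReal.ofReal ((f p.1 - f p.2) ^ 2 / ‖p.1 - p.2‖ ^ (N + 1))) ?_
  fun_prop

section Mollify

variable {m f : Space N → ℝ} {B C δ : ℝ}

lemma IsMollifier.integrable (hm : IsMollifier C δ m) : Integrable m :=
  integrable_of_smooth hm.smooth hm.compact

lemma IsMollifier.const_nonneg (hδ : 0 < δ) (hm : IsMollifier C δ m) : 0 ≤ C := by
  have h := (hm.nonneg 0).trans (hm.le 0)
  by_contra hC
  exact absurd h (not_le.mpr (div_neg_of_neg_of_pos (not_le.mp hC) (by positivity)))

lemma IsMollifier.integral_sub_left (hm : IsMollifier C δ m) (x : Space N) :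
    ∫ y, m (x - y) = 1 := by
  rw [integral_sub_left_eq_self m, hm.integral_eq_one]

lemma IsMollifier.abs_smear_le (hm : IsMollifier C δ m) (hB : ∀ x, |f x| ≤ B) (x : Space N) :
    |smear m f x| ≤ B := by
  refine (CriticalBurgers.abs_smear_le hm.integrable hB x).trans_eq ?_
  simp_rw [abs_of_nonneg (hm.nonneg _)]
  rw [hm.integral_eq_one, one_mul]

lemma IsMollifier.integral_smul_fderiv (hm : IsMollifier C δ m) (x : Space N) :
    ∫ y, fderiv ℝ m (x - y) = 0 := by
  have h := hasFDerivAt_smear (f := fun _ => (1 : ℝ)) (B := 1) hm.smooth hm.compact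
    measurable_const (by simp) x
  have e : smear m (fun _ => (1 : ℝ)) = fun _ => 1 := by
    funext x
    simp [smear, hm.integral_sub_left]
  rw [e] at h
  simpa using h.unique (hasFDerivAt_const (1 : ℝ) x)

lemma IsMollifier.abs_smear_sub_le (hm : IsMollifier C δ m) (hf : Measurable f)
    (hB : ∀ x, |f x| ≤ B) (x : Space N) : |smear m f x - f x| ≤ C * meanDev f δ x := by
  have e : smear m f x - f x = ∫ y, (f y - f x) • m (x - y) := by
    have h1 := (hm.integrable.comp_sub_left x).mul_const (f x)
    have h2 : ∫ y, m (x - y) * f x = f x := by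
      rw [integral_mul_const, hm.integral_sub_left, one_mul]
    conv_lhs => rw [← h2, smear]
    rw [← integral_sub (integrable_kernel_mul hm.integrable hf hB x) h1]
    congr 1
    funext y
    rw [smul_eq_mul]
    ring
  rw [e]
  refine (norm_integral_smul_sub_le hf hB hm.eq_zero (C := C / δ ^ N) (fun x => ?_) x).trans_eq ?_
  · rw [Real.norm_of_nonneg (hm.nonneg x)]
    exact hm.le x
  · rw [meanDev]; ring

lemma IsMollifier.norm_fderiv_smear_le (hδ : 0 < δ) (hm : IsMollifier C δ m) (hf : Measurable f)
    (hB : ∀ x, |f x| ≤ B) (x : Space N) :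
    ‖fderiv ℝ (smear m f) x‖ ≤ C / δ * meanDev f δ x := by
  have e : fderiv ℝ (smear m f) x = ∫ y, (f y - f x) • fderiv ℝ m (x - y) := by
    have h1 : Integrable fun y => f x • fderiv ℝ m (x - y) :=
      ((integrable_fderiv_of_smooth hm.smooth hm.compact).comp_sub_left x).smul (f x)
    simp_rw [sub_smul]
    rw [integral_sub (integrable_smul_fderiv hm.smooth hm.compact hf hB x) h1, integral_smul,
      hm.integral_smul_fderiv, smul_zero, sub_zero,
      (hasFDerivAt_smear hm.smooth hm.compact hf hB x).fderiv]
  rw [e]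
  refine (norm_integral_smul_sub_le hf hB hm.fderiv_eq_zero hm.fderiv_le x).trans_eq ?_
  rw [meanDev, pow_succ]
  field_simp

lemma abs_sq_le (hB : ∀ x, |f x| ≤ B) (x : Space N) : |f x ^ 2| ≤ B ^ 2 := by
  rw [abs_pow]
  exact pow_le_pow_left₀ (abs_nonneg _) (hB x) 2

lemma IsMollifier.integral_mul_sub_sq (hm : IsMollifier C δ m) (hf : Measurable f)
    (hB : ∀ x, |f x| ≤ B) (x : Space N) (c : ℝ) :
    ∫ y, m (x - y) * (f y - c) ^ 2 =
      smear m (fun y => f y ^ 2) x - 2 * c * smear m f x + c ^ 2 := by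
  have h1 := integrable_kernel_mul hm.integrable (hf.pow_const 2) (abs_sq_le hB) x
  have h2 := (integrable_kernel_mul hm.integrable hf hB x).const_mul (2 * c)
  have h3 := (hm.integrable.comp_sub_left x).const_mul (c ^ 2)
  have h4 : Integrable fun y => m (x - y) * f y ^ 2 - 2 * c * (m (x - y) * f y) := h1.sub h2
  have h5 : ∫ y, c ^ 2 * m (x - y) = c ^ 2 := by
    rw [integral_const_mul, hm.integral_sub_left, mul_one]
  rw [smear, smear, ← integral_const_mul, ← integral_sub h1 h2]
  conv_rhs => rw [← h5]
  rw [← integral_add h4 h3]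
  congr 1
  funext y
  ring

/-- The defect of multiplicativity of the mollification. -/
def variance (m f : Space N → ℝ) (x : Space N) : ℝ :=
  smear m (fun y => f y ^ 2) x - smear m f x ^ 2

lemma IsMollifier.variance_nonneg (hm : IsMollifier C δ m) (hf : Measurable f)
    (hB : ∀ x, |f x| ≤ B) (x : Space N) : 0 ≤ variance m f x := by
  have h := hm.integral_mul_sub_sq hf hB x (smear m f x)
  have : 0 ≤ ∫ y, m (x - y) * (f y - smear m f x) ^ 2 :=
    integral_nonneg fun y => mul_nonneg (hm.nonneg _) (sq_nonneg _)
  unfold variance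
  linarith

lemma IsMollifier.variance_le (hδ : 0 < δ) (hm : IsMollifier C δ m) (hf : Measurable f)
    (hB : ∀ x, |f x| ≤ B) (x : Space N) :
    ENNReal.ofReal (variance m f x) ≤ ENNReal.ofReal (C * δ) * incrEnergy f x := by
  have hC := hm.const_nonneg hδ
  have h := hm.integral_mul_sub_sq hf hB x (f x)
  have h1 : variance m f x ≤ ∫ y, m (x - y) * (f y - f x) ^ 2 := by
    unfold variance
    nlinarith [sq_nonneg (f x - smear m f x)]
  have hi : Integrable fun y => m (x - y) * (f y - f x) ^ 2 := by
    refine integrable_kernel_mul (B := (2 * B) ^ 2) hm.integrable (by fun_prop) (fun y => ?_) x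
    rw [abs_pow]
    refine pow_le_pow_left₀ (abs_nonneg _) ?_ 2
    rw [two_mul]
    exact (abs_sub _ _).trans (add_le_add (hB _) (hB _))
  refine (ENNReal.ofReal_le_ofReal h1).trans ?_
  rw [ofReal_integral_eq_lintegral_ofReal hi
    (ae_of_all _ fun y => mul_nonneg (hm.nonneg _) (sq_nonneg _)), incrEnergy,
    ← lintegral_const_mul' _ _ ENNReal.ofReal_ne_top]
  refine lintegral_mono fun y => ?_
  rw [← ENNReal.ofReal_mul (by positivity)]
  refine ENNReal.ofReal_le_ofReal ?_
  rcases eq_or_ne x y with rfl | hxy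
  · simp
  have hp : 0 < ‖x - y‖ := norm_pos_iff.mpr (sub_ne_zero.mpr hxy)
  by_cases hn : δ < ‖x - y‖
  · rw [hm.eq_zero _ hn, zero_mul]
    positivity
  · push Not at hn
    have h2 : C / δ ^ N ≤ C * δ / ‖x - y‖ ^ (N + 1) := by
      rw [div_le_div_iff₀ (by positivity) (by positivity)]
      calc C * ‖x - y‖ ^ (N + 1) ≤ C * δ ^ (N + 1) := by gcongr
        _ = C * δ * δ ^ N := by ring
    calc m (x - y) * (f y - f x) ^ 2 ≤ C * δ / ‖x - y‖ ^ (N + 1) * (f y - f x) ^ 2 :=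
          mul_le_mul_of_nonneg_right ((hm.le _).trans h2) (sq_nonneg _)
      _ = _ := by ring

end Mollify

/-- Integration by parts of Lipschitz functions, one of which has compact support. -/
lemma integral_fderiv_mul_eq_neg {w h : Space N → ℝ} {K D : NNReal} (hw : LipschitzWith K w)
    (hc : HasCompactSupport w) (hh : LipschitzWith D h) (v : Space N) :
    ∫ x, fderiv ℝ w x v * h x = - ∫ x, w x * fderiv ℝ h x v := by
  have e := LipschitzWith.integral_lineDeriv_mul_eq (μ := volume) hh hw hc v
  have e1 : ∫ x, lineDeriv ℝ h x v * w x = ∫ x, w x * fderiv ℝ h x v := by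
    refine integral_congr_ae ?_
    filter_upwards [hh.ae_differentiableAt] with x hx
    rw [hx.lineDeriv_eq_fderiv, mul_comm]
  have e2 : ∫ x, lineDeriv ℝ w x (-v) * h x = - ∫ x, fderiv ℝ w x v * h x := by
    rw [← integral_neg]
    refine integral_congr_ae ?_
    filter_upwards [hw.ae_differentiableAt] with x hx
    rw [hx.lineDeriv_eq_fderiv, map_neg, neg_mul]
  rw [e1, e2] at e
  rw [e, neg_neg]

lemma measurable_fderiv_apply_const' {w : Space N → ℝ} (v : Space N) :
    Measurable fun x => fderiv ℝ w x v := measurable_fderiv_apply_const ℝ w v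

lemma integrable_fderiv_apply {w : Space N → ℝ} {K : NNReal} (hw : LipschitzWith K w)
    (hc : HasCompactSupport w) (v : Space N) : Integrable fun x => fderiv ℝ w x v := by
  have h : IntegrableOn (fun x => fderiv ℝ w x v) (tsupport w) :=
    Measure.integrableOn_of_bounded (M := K * ‖v‖) hc.isCompact.measure_lt_top.ne
      (measurable_fderiv_apply_const' v).aestronglyMeasurable (ae_of_all _ fun x =>
        (ContinuousLinearMap.le_opNorm _ _).trans (mul_le_mul_of_nonneg_right
          (norm_fderiv_le_of_lipschitz ℝ hw) (norm_nonneg _)))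
  rwa [integrableOn_iff_integrable_of_support_subset] at h
  intro x hx
  by_contra hx'
  refine hx ?_
  have : x ∉ tsupport (fderiv ℝ w) := fun h => hx' (tsupport_fderiv_subset ℝ h)
  simp [image_eq_zero_of_notMem_tsupport this]

/-! ### The transport term -/

/-- The density of the transport term of the energy balance, in the direction `v`. -/
def transport (ζ : Space N → ℝ) (β L : ℝ) (v : Space N) (g : Space N → ℝ) (x : Space N) : ℝ :=
  ζ x * fderiv ℝ ζ x v * max (β * (g x - L)) 0 ^ 2 * ((2 * g x + L) / 3)

section Transport

variable {m f g ζ : Space N → ℝ} {B C δ β L : ℝ} {K : NNReal}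

lemma exists_bound_of_contDiff_one (hζ : ContDiff ℝ 1 ζ) (hc : HasCompactSupport ζ) :
    ∃ C, 0 ≤ C ∧ (∀ x, |ζ x| ≤ C) ∧ ∀ x, ‖fderiv ℝ ζ x‖ ≤ C := by
  obtain ⟨C₁, h₁⟩ := hc.exists_bound_of_continuous hζ.continuous
  obtain ⟨C₂, h₂⟩ := (hc.fderiv (𝕜 := ℝ)).exists_bound_of_continuous
    (hζ.continuous_fderiv (by simp))
  exact ⟨max C₁ C₂, ((norm_nonneg _).trans (h₁ 0)).trans (le_max_left _ _),
    fun x => (h₁ x).trans (le_max_left _ _), fun x => (h₂ x).trans (le_max_right _ _)⟩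

lemma lipschitz_mul_sub (hg : LipschitzWith K g) :
    LipschitzWith (‖β‖₊ * K) (fun x => β * (g x - L)) := by
  refine LipschitzWith.of_dist_le_mul fun x y => ?_
  have h := hg.dist_le_mul x y
  rw [Real.dist_eq] at h ⊢
  have e : β * (g x - L) - β * (g y - L) = β * (g x - g y) := by ring
  rw [e, abs_mul]
  push_cast
  rw [mul_assoc]
  exact mul_le_mul_of_nonneg_left h (abs_nonneg _)

lemma abs_mul_sub_le (hβ : 0 ≤ β) (hB : ∀ x, |g x| ≤ B) (x : Space N) :
    |β * (g x - L)| ≤ β * (B + |L|) := by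
  rw [abs_mul, abs_of_nonneg hβ]
  exact mul_le_mul_of_nonneg_left ((abs_sub _ _).trans (add_le_add (hB x) le_rfl)) hβ

lemma exists_lipschitz_sq_mul_posPart (hζ : ContDiff ℝ 1 ζ) (hc : HasCompactSupport ζ)
    (hg : LipschitzWith K g) (hB : ∀ x, |g x| ≤ B) :
    ∃ K', LipschitzWith K' (fun x => ζ x ^ 2 * max (g x) 0) := by
  have hs : ContDiff ℝ 1 fun x => ζ x ^ 2 := hζ.pow 2
  have hcs : HasCompactSupport fun x => ζ x ^ 2 := by
    simp_rw [pow_two]; exact hc.mul_left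
  obtain ⟨C, hC0, hC, -⟩ := exists_bound_of_contDiff_one hs hcs
  obtain ⟨K₁, h₁⟩ := ContDiff.lipschitzWith_of_hasCompactSupport hcs hs (by simp)
  have hB0 : 0 ≤ B := (abs_nonneg _).trans (hB 0)
  lift C to NNReal using hC0
  lift B to NNReal using hB0
  refine ⟨C * (1 * K) + B * K₁, ?_⟩
  rw [← lipschitzOnWith_univ]
  exact lipschitzOnWith_mul (lipschitzOnWith_univ.mpr h₁)
    (lipschitzOnWith_univ.mpr (lipschitzWith_posPart.comp hg)) (fun x _ => hC x)
    (fun x _ => (abs_posPart_le _).trans (hB x))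

lemma hasCompactSupport_sq_mul_posPart (hc : HasCompactSupport ζ) :
    HasCompactSupport fun x => ζ x ^ 2 * max (g x) 0 := by
  have : (fun x => ζ x ^ 2 * max (g x) 0) = fun x => ζ x * (ζ x * max (g x) 0) := by
    funext x
    ring
  rw [this]
  exact hc.mul_right

lemma fderiv_sq_mul_posPart (hζ : ContDiff ℝ 1 ζ) {x : Space N} (hg : DifferentiableAt ℝ g x) :
    fderiv ℝ (fun x => ζ x ^ 2 * max (β * (g x - L)) 0) x =
      if 0 < β * (g x - L) then (ζ x ^ 2 * β) • fderiv ℝ g x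
        + (β * (g x - L) * (2 * ζ x)) • fderiv ℝ ζ x else 0 := by
  have hd := hζ.differentiable (by simp) x
  have hb : HasFDerivAt (fun x => β * (g x - L)) (β • fderiv ℝ g x) x :=
    (hg.hasFDerivAt.sub_const L).const_mul β
  rw [fderiv_mul_posPart (a := fun x => ζ x ^ 2) (b := fun x => β * (g x - L)) (hd.pow 2)
    hb.differentiableAt, hb.fderiv, fderiv_sq hd]
  simp only [smul_smul]

lemma integrable_transport (hζ : ContDiff ℝ 1 ζ) (hc : HasCompactSupport ζ) (hβ : 0 ≤ β)
    (hg : Measurable g) (hB : ∀ x, |g x| ≤ B) (v : Space N) :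
    Integrable (transport ζ β L v g) := by
  have h1 : Integrable fun x => ζ x * fderiv ℝ ζ x v :=
    (hζ.continuous.mul ((hζ.continuous_fderiv (by simp)).clm_apply continuous_const)
      ).integrable_of_hasCompactSupport hc.mul_right
  have h2 : Integrable fun x => ζ x * fderiv ℝ ζ x v * max (β * (g x - L)) 0 ^ 2 := by
    refine integrable_mul_of_bdd (B := (β * (B + |L|)) ^ 2) h1 (by fun_prop) fun x => ?_
    rw [abs_pow]
    exact pow_le_pow_left₀ (abs_nonneg _) ((abs_posPart_le _).trans (abs_mul_sub_le hβ hB x)) 2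
  refine integrable_mul_of_bdd (B := (2 * B + |L|) / 3) h2 (by fun_prop) fun x => ?_
  rw [abs_div, abs_of_pos (by norm_num : (0:ℝ) < 3)]
  gcongr
  refine (abs_add_le _ _).trans (add_le_add ?_ le_rfl)
  rw [abs_mul, abs_two]
  linarith [hB x]

/-- Up to the variance of the mollification, the nonlinearity contributes the transport term. -/
lemma integral_mul_fderiv_smear_sq (hζ : ContDiff ℝ 1 ζ) (hc : HasCompactSupport ζ)
    (hβ : 0 ≤ β) (hm : IsMollifier C δ m) (hf : Measurable f) (hB : ∀ x, |f x| ≤ B)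
    (v : Space N) :
    -(β / 2) * ∫ x, ζ x ^ 2 * max (β * (smear m f x - L)) 0 *
        fderiv ℝ (smear m fun y => f y ^ 2) x v
      = (∫ x, transport ζ β L v (smear m f) x)
        + β / 2 * ∫ x, fderiv ℝ (fun x => ζ x ^ 2 * max (β * (smear m f x - L)) 0) x v *
          variance m f x := by
  set g := smear m f with hg
  set w : Space N → ℝ := fun x => ζ x ^ 2 * max (β * (g x - L)) 0 with hw
  have hgB : ∀ x, |g x| ≤ B := hm.abs_smear_le hB
  have hB0 : 0 ≤ B := (abs_nonneg _).trans (hB 0)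
  have hgd : ∀ x, DifferentiableAt ℝ g x := fun x =>
    (hasFDerivAt_smear hm.smooth hm.compact hf hB x).differentiableAt
  obtain ⟨Kg, hgl⟩ := exists_lipschitz_smear hm.smooth hm.compact hf hB
  rw [← hg] at hgl
  have hgm : Measurable g := hgl.continuous.measurable
  obtain ⟨Kq, hql⟩ := exists_lipschitz_smear hm.smooth hm.compact (hf.pow_const 2) (abs_sq_le hB)
  obtain ⟨Kw, hwl⟩ := exists_lipschitz_sq_mul_posPart hζ hc (lipschitz_mul_sub (L := L) hgl)
    (abs_mul_sub_le hβ hgB)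
  have hwc : HasCompactSupport w := hasCompactSupport_sq_mul_posPart hc
  set k : Space N → ℝ := fun x => (g x ^ 2 + g x * L + L ^ 2) / 3 with hk
  have hkd : ∀ x, HasFDerivAt k (((2 * g x + L) / 3) • fderiv ℝ g x) x := fun x => by
    have h1 := (((hgd x).hasFDerivAt.pow 2).add ((hgd x).hasFDerivAt.mul_const L)).add_const
      (L ^ 2)
    refine (h1.mul_const (1 / 3)).congr_fderiv ?_ |>.congr_of_eventuallyEq ?_
    · ext v; simp; ring
    · exact Eventually.of_forall fun x => by simp [hk]; ring
  have hkl : LipschitzWith (((2 * B + |L|) / 3).toNNReal * Kg) k := by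
    refine lipschitzWith_of_nnnorm_fderiv_le (fun x => (hkd x).differentiableAt) fun x => ?_
    rw [(hkd x).fderiv, ← NNReal.coe_le_coe, coe_nnnorm, norm_smul, NNReal.coe_mul,
      Real.coe_toNNReal _ (by positivity)]
    refine mul_le_mul ?_ (norm_fderiv_le_of_lipschitz ℝ hgl) (norm_nonneg _) (by positivity)
    rw [Real.norm_eq_abs, abs_div, abs_of_pos (by norm_num : (0:ℝ) < 3)]
    gcongr
    refine (abs_add_le _ _).trans (add_le_add ?_ le_rfl)
    rw [abs_mul, abs_two]
    linarith [hgB x]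
  have hwi := integrable_fderiv_apply hwl hwc v
  have hww : Integrable w := hwl.continuous.integrable_of_hasCompactSupport hwc
  have hqB : ∀ x, |smear m (fun y => f y ^ 2) x| ≤ B ^ 2 := hm.abs_smear_le (abs_sq_le hB)
  have i1 : Integrable fun x => fderiv ℝ w x v * g x ^ 2 :=
    integrable_mul_of_bdd hwi (hgm.pow_const 2) (abs_sq_le hgB)
  have i2 : Integrable fun x => fderiv ℝ w x v * smear m (fun y => f y ^ 2) x :=
    integrable_mul_of_bdd hwi hql.continuous.measurable hqB
  have i3 : Integrable fun x => fderiv ℝ w x v * k x := by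
    refine integrable_mul_of_bdd (B := (B ^ 2 + B * |L| + L ^ 2) / 3) hwi
      hkl.continuous.measurable fun x => ?_
    simp only [hk]
    rw [abs_div, abs_of_pos (by norm_num : (0:ℝ) < 3)]
    gcongr
    refine (abs_add_le _ _).trans (add_le_add ((abs_add_le _ _).trans (add_le_add ?_ ?_)) ?_)
    · exact abs_sq_le hgB x
    · rw [abs_mul]
      exact mul_le_mul_of_nonneg_right (hgB x) (abs_nonneg _)
    · rw [abs_of_nonneg (sq_nonneg L)]
  have i4 : Integrable fun x => w x * fderiv ℝ k x v := by
    refine integrable_mul_of_bdd (B := _ * ‖v‖) hww (measurable_fderiv_apply_const' v) fun x =>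
      (ContinuousLinearMap.le_opNorm _ _).trans (mul_le_mul_of_nonneg_right
        (norm_fderiv_le_of_lipschitz ℝ hkl) (norm_nonneg _))
  have i5 := integrable_transport (L := L) hζ hc hβ hgm hgB v
  have b1 := integral_fderiv_mul_eq_neg hwl hwc hql v
  have b2 := integral_fderiv_mul_eq_neg hwl hwc hkl v
  have b3 : ∫ x, fderiv ℝ w x v * variance m f x =
      (∫ x, fderiv ℝ w x v * smear m (fun y => f y ^ 2) x) - ∫ x, fderiv ℝ w x v * g x ^ 2 := by
    rw [← integral_sub i2 i1]
    congr 1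
    funext x
    rw [variance]
    ring
  have b4 : ∫ x, transport ζ β L v g x = β / 2 * ((∫ x, fderiv ℝ w x v * g x ^ 2)
      - (∫ x, fderiv ℝ w x v * k x) - ∫ x, w x * fderiv ℝ k x v) := by
    have i6 : Integrable fun x => fderiv ℝ w x v * g x ^ 2 - fderiv ℝ w x v * k x := i1.sub i3
    rw [← integral_sub i1 i3, ← integral_sub i6 i4, ← integral_const_mul]
    congr 1
    funext x
    rw [(hkd x).fderiv, hw, fderiv_sq_mul_posPart hζ (hgd x), transport]
    split_ifs with h
    · simp only [max_eq_left h.le, add_apply, smul_apply,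
        smul_eq_mul, hk]
      ring
    · simp [max_eq_right (not_lt.mp h)]
  rw [b4, b3, b1]
  rw [b2]
  ring

end Transport

/-! ### The remainder of the transport term -/

section Remainder

variable {m f g ζ : Space N → ℝ} {B C δ β L : ℝ}

/-- A majorant of the part of the transport term that is lost by mollification. -/
def remainderBound (K δ : ℝ) (f : Space N → ℝ) : ℝ≥0∞ :=
  ∫⁻ x, ENNReal.ofReal (K * (meanDev f δ x + δ)) * incrEnergy f x

lemma exists_remainder_le (hζ : ContDiff ℝ 1 ζ) (hc : HasCompactSupport ζ) (hβ : 0 ≤ β)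
    (C B L : ℝ) (v : Space N) : ∃ K, 0 ≤ K ∧ ∀ (f m : Space N → ℝ) (δ : ℝ), 0 < δ →
      IsMollifier C δ m → Measurable f → (∀ x, |f x| ≤ B) →
      ENNReal.ofReal |β / 2 * ∫ x, fderiv ℝ
        (fun x => ζ x ^ 2 * max (β * (smear m f x - L)) 0) x v * variance m f x|
        ≤ remainderBound K δ f := by
  obtain ⟨D, hD0, hD, hD'⟩ := exists_bound_of_contDiff_one hζ hc
  obtain ⟨K₀, hK₀⟩ : ∃ K₀, K₀ = β / 2 * (‖v‖ * (D ^ 2 * β + β * (|B| + |L|) * (2 * D) * D)) :=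
    ⟨_, rfl⟩
  have hK₀0 : 0 ≤ K₀ := by rw [hK₀]; positivity
  refine ⟨K₀ * (C ^ 2 + |C|), by positivity, fun f m δ hδ hm hf hB => ?_⟩
  have hC := hm.const_nonneg hδ
  have hB0 : 0 ≤ B := (abs_nonneg _).trans (hB 0)
  rw [abs_of_nonneg hB0] at hK₀
  have hV := hm.variance_nonneg hf hB
  have hw : ∀ x, |fderiv ℝ (fun x => ζ x ^ 2 * max (β * (smear m f x - L)) 0) x v| ≤
      ‖v‖ * (D ^ 2 * β + β * (B + |L|) * (2 * D) * D) * (‖fderiv ℝ (smear m f) x‖ + 1) := by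
    intro x
    refine (ContinuousLinearMap.le_opNorm (fderiv ℝ
      (fun x => ζ x ^ 2 * max (β * (smear m f x - L)) 0) x) v).trans ?_
    rw [fderiv_sq_mul_posPart hζ (hasFDerivAt_smear hm.smooth hm.compact hf hB x).differentiableAt,
      mul_comm, mul_assoc ‖v‖]
    refine mul_le_mul_of_nonneg_left ?_ (norm_nonneg v)
    split_ifs with h
    · refine (norm_add_le _ _).trans ?_
      rw [norm_smul, norm_smul, Real.norm_eq_abs, Real.norm_eq_abs, abs_mul, abs_mul _ (2 * ζ x),
        abs_pow, abs_mul 2, abs_two, abs_of_nonneg hβ]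
      have h1 : |ζ x| ^ 2 ≤ D ^ 2 := pow_le_pow_left₀ (abs_nonneg _) (hD x) 2
      have h2 : |β * (smear m f x - L)| * (2 * |ζ x|) * ‖fderiv ℝ ζ x‖ ≤
          β * (B + |L|) * (2 * D) * D := by
        gcongr
        · exact abs_mul_sub_le hβ (hm.abs_smear_le hB) x
        · exact hD x
        · exact hD' x
      have h3 : |ζ x| ^ 2 * β * ‖fderiv ℝ (smear m f) x‖ ≤
        D ^ 2 * β * ‖fderiv ℝ (smear m f) x‖ := by gcongr
      have h4 : 0 ≤ D ^ 2 * β := by positivity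
      have h5 : 0 ≤ β * (B + |L|) * (2 * D) * D * ‖fderiv ℝ (smear m f) x‖ := by positivity
      linarith
    · rw [norm_zero]
      positivity
  rw [← Real.enorm_eq_ofReal_abs, ← integral_const_mul]
  refine (enorm_integral_le_lintegral_enorm _).trans (lintegral_mono fun x => ?_)
  rw [Real.enorm_eq_ofReal_abs, abs_mul, abs_mul, abs_of_nonneg (hV x),
    abs_of_nonneg (by positivity : 0 ≤ β / 2), ← mul_assoc, ENNReal.ofReal_mul (by positivity)]
  have hA : 0 ≤ meanDev f δ x := meanDev_nonneg hδ x
  calc ENNReal.ofReal (β / 2 *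
        |fderiv ℝ (fun x => ζ x ^ 2 * max (β * (smear m f x - L)) 0) x v|) *
        ENNReal.ofReal (variance m f x)
      ≤ ENNReal.ofReal (K₀ * (C / δ * meanDev f δ x + 1)) *
          (ENNReal.ofReal (C * δ) * incrEnergy f x) := by
        refine mul_le_mul' (ENNReal.ofReal_le_ofReal ?_) (hm.variance_le hδ hf hB x)
        rw [hK₀, mul_assoc (β / 2)]
        refine mul_le_mul_of_nonneg_left ((hw x).trans ?_) (by positivity)
        gcongr
        exact hm.norm_fderiv_smear_le hδ hf hB x
    _ = ENNReal.ofReal (K₀ * (C ^ 2 * meanDev f δ x + C * δ)) * incrEnergy f x := by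
        rw [← mul_assoc, ← ENNReal.ofReal_mul (by positivity)]
        congr 2
        field_simp
    _ ≤ _ := by
        refine mul_le_mul_left (ENNReal.ofReal_le_ofReal ?_) _
        rw [mul_assoc, abs_of_nonneg hC]
        refine mul_le_mul_of_nonneg_left ?_ hK₀0
        have h1 : 0 ≤ C * meanDev f δ x := by positivity
        have h2 : 0 ≤ C ^ 2 * δ := by positivity
        linarith

lemma remainderBound_le {K : ℝ} (hK : 0 ≤ K) (hδ : 0 < δ) (hδ1 : δ ≤ 1) (hf : Measurable f)
    (hB : ∀ x, |f x| ≤ B) : remainderBound K δ f ≤ ENNReal.ofReal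
      (K * (2 * B * volume.real (Metric.closedBall (0 : Space N) 1) + 1)) *
      ∫⁻ x, incrEnergy f x := by
  rw [← lintegral_const_mul' _ _ ENNReal.ofReal_ne_top]
  refine lintegral_mono fun x => ?_
  gcongr
  exact meanDev_le hδ hf hB x

lemma tendsto_remainderBound {K : ℝ} (hK : 0 ≤ K) {δ : ℕ → ℝ} (hδ : ∀ n, 0 < δ n)
    (hδ1 : ∀ n, δ n ≤ 1) (hlim : Tendsto δ atTop (𝓝 0)) (hf : Measurable f)
    (hB : ∀ x, |f x| ≤ B) (hfin : ∫⁻ x, incrEnergy f x ≠ ⊤) :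
    Tendsto (fun n => remainderBound K (δ n) f) atTop (𝓝 0) := by
  have hmi := measurable_incrEnergy hf
  have h := tendsto_lintegral_of_dominated_convergence' (μ := (volume : Measure (Space N)))
    (F := fun n x => ENNReal.ofReal (K * (meanDev f (δ n) x + δ n)) * incrEnergy f x)
    (f := fun _ => 0) (fun x => ENNReal.ofReal
      (K * (2 * B * volume.real (Metric.closedBall (0 : Space N) 1) + 1)) * incrEnergy f x)
    (fun n => by
      have := measurable_meanDev (δ := δ n) hf
      exact Measurable.aemeasurable (by fun_prop))
    (fun n => ae_of_all _ fun x => by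
      have := meanDev_le (hδ n) hf hB x
      have := hδ1 n
      simp only
      gcongr) ?_ ?_
  · rw [lintegral_zero] at h
    exact h
  · rw [lintegral_const_mul' _ _ ENNReal.ofReal_ne_top]
    exact ENNReal.mul_ne_top ENNReal.ofReal_ne_top hfin
  · filter_upwards [tendsto_meanDev hf hB hδ hlim, ae_lt_top hmi hfin] with x hx hx'
    have h1 : Tendsto (fun n => K * (meanDev f (δ n) x + δ n)) atTop (𝓝 0) := by
      simpa using (hx.add hlim).const_mul K
    have h2 := ENNReal.Tendsto.mul_const (ENNReal.tendsto_ofReal h1) (b := incrEnergy f x)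
      (Or.inr hx'.ne)
    simpa using h2

lemma hHalfSq_eq_lintegral_incrEnergy :
    hHalfSq f = ENNReal.ofReal (poissonConst N / 2) * ∫⁻ x, incrEnergy f x := rfl

end Remainder

/-! ### The transport term and the Sobolev inequality -/

/-- The direction of transport. -/
def diag (N : ℕ) : Space N := ∑ j, EuclideanSpace.single j 1

lemma norm_diag (N : ℕ) : ‖diag N‖ = √N := by
  rw [EuclideanSpace.norm_eq]
  simp [diag]

lemma volume_B4 (N : ℕ) : volume (B4 N) = 8 ^ N := by
  have h := (EuclideanSpace.volume_preserving_symm_measurableEquiv_toLp (Fin N))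
  have e : B4 N = (MeasurableEquiv.toLp 2 (Fin N → ℝ)).symm ⁻¹' Icc (fun _ => -4) (fun _ => 4) := by
    ext x
    simp [B4, Pi.le_def, forall_and]
  rw [e, h.measure_preimage measurableSet_Icc.nullMeasurableSet, Real.volume_Icc_pi]
  norm_num

section Sobolev

variable {h : Space N → ℝ}

lemma eq_zero_of_hHalfSq_eq_zero (hN : 0 < N) (hh : Measurable h) (h0 : ∀ x ∉ B4 N, h x = 0)
    (hz : hHalfSq h = 0) : h =ᵐ[volume] 0 := by
  have hp : ENNReal.ofReal (poissonConst N / 2) ≠ 0 := by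
    have := poissonConst_pos N
    simpa using this
  rw [hHalfSq_eq_lintegral_incrEnergy, mul_eq_zero, or_iff_right hp,
    lintegral_eq_zero_iff (measurable_incrEnergy hh)] at hz
  have hB : volume (B4 N)ᶜ ≠ 0 := by
    have : Nonempty (Fin N) := ⟨⟨0, hN⟩⟩
    rw [measure_compl (isClosed_B4 N).measurableSet (by rw [volume_B4]; finiteness), volume_B4,
      measure_univ_of_isAddLeftInvariant, ENNReal.top_sub (by finiteness)]
    exact ENNReal.top_ne_zero
  filter_upwards [hz] with x hx
  rw [Pi.zero_apply, incrEnergy, lintegral_eq_zero_iff (by fun_prop)] at hx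
  obtain ⟨y, hy, hy'⟩ : ∃ y, y ∈ (B4 N)ᶜ ∧
      ENNReal.ofReal ((h x - h y) ^ 2 / ‖x - y‖ ^ (N + 1)) = 0 := by
    by_contra hcon
    push Not at hcon
    exact hB (measure_mono_null (fun y hy => hcon y hy) (ae_iff.mp hx))
  rw [h0 y hy, sub_zero, ENNReal.ofReal_eq_zero] at hy'
  by_contra hx0
  have hx1 : h x ≠ 0 := hx0
  have hxy : x ≠ y := fun e => hx1 (by rw [e, h0 y hy])
  have h1 : 0 < ‖x - y‖ := norm_pos_iff.mpr (sub_ne_zero.mpr hxy)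
  have h2 : 0 < h x ^ 2 / ‖x - y‖ ^ (N + 1) := by positivity
  exact absurd hy' (not_le.mpr h2)

lemma eLpNorm_sq_le (hN : 2 ≤ N) (hh : Measurable h) (hm : MemLp h 2) (h0 : ∀ x ∉ B4 N, h x = 0)
    (hfin : hHalfSq h ≠ ⊤) :
    eLpNorm h (ENNReal.ofReal (2 * (N : ℝ) / ((N : ℝ) - 1))) volume ^ 2 ≤
      sobolevConst N * hHalfSq h := by
  rcases eq_or_ne (hHalfSq h) 0 with hz | hz
  · rw [eLpNorm_congr_ae (eq_zero_of_hHalfSq_eq_zero (by omega) hh h0 hz)]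
    simp
  · rw [← ENNReal.div_le_iff hz hfin]
    refine le_sInf fun C hC => ?_
    rw [ENNReal.div_le_iff hz hfin]
    exact hC h hm

/-- The Sobolev and Hölder inequalities on the cube. -/
lemma lintegral_sq_le (hN : 2 ≤ N) (hh : Measurable h) (hm : MemLp h 2)
    (h0 : ∀ x ∉ B4 N, h x = 0) (hfin : hHalfSq h ≠ ⊤) :
    ∫⁻ x in B4 N, ENNReal.ofReal (h x ^ 2) ≤ 8 * sobolevConst N * hHalfSq h := by
  set p : ℝ := 2 * (N : ℝ) / ((N : ℝ) - 1) with hp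
  have hN2 : (2 : ℝ) ≤ N := by exact_mod_cast hN
  have hp2 : 2 ≤ p := by
    rw [hp, le_div_iff₀ (by linarith)]
    linarith
  have e1 : ∫⁻ x in B4 N, ENNReal.ofReal (h x ^ 2) = eLpNorm h 2 (volume.restrict (B4 N)) ^ 2 := by
    rw [eLpNorm_eq_lintegral_rpow_enorm_toReal (by norm_num) (by norm_num), ← ENNReal.rpow_natCast,
      ← ENNReal.rpow_mul]
    norm_num
    congr 1
    funext x
    rw [← ofReal_norm, ← ENNReal.ofReal_pow (norm_nonneg _), Real.norm_eq_abs, sq_abs]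
  have e2 := eLpNorm_le_eLpNorm_mul_rpow_measure_univ (μ := volume.restrict (B4 N)) (f := h)
    (p := 2) (q := ENNReal.ofReal p) (by
      rw [← ENNReal.ofReal_ofNat]
      exact ENNReal.ofReal_le_ofReal hp2) hh.aestronglyMeasurable
  rw [Measure.restrict_apply_univ, volume_B4, ENNReal.toReal_ofReal (by linarith)] at e2
  have e3 : ((8 : ℝ≥0∞) ^ N) ^ (1 / (2 : ℝ≥0∞).toReal - 1 / p) = 8 ^ (1 / 2 : ℝ) := by
    rw [← ENNReal.rpow_natCast, ← ENNReal.rpow_mul]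
    congr 1
    have : (N : ℝ) - 1 ≠ 0 := by linarith
    rw [hp, ENNReal.toReal_ofNat]
    field_simp
    ring
  rw [e3] at e2
  rw [e1]
  calc eLpNorm h 2 (volume.restrict (B4 N)) ^ 2
      ≤ (eLpNorm h (ENNReal.ofReal p) volume * 8 ^ (1 / 2 : ℝ)) ^ 2 := by
        refine pow_le_pow_left' (e2.trans ?_) 2
        gcongr
        exact Measure.restrict_le_self
    _ = 8 * eLpNorm h (ENNReal.ofReal p) volume ^ 2 := by
        rw [mul_pow, ← ENNReal.rpow_natCast (8 ^ (1 / 2 : ℝ)), ← ENNReal.rpow_mul]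
        norm_num
        rw [mul_comm]
    _ ≤ 8 * (sobolevConst N * hHalfSq h) := by
        gcongr
        exact eLpNorm_sq_le hN hh hm h0 hfin
    _ = _ := by ring

end Sobolev

/-- The transport term is absorbed by the dissipation. -/
lemma abs_integral_transport_le (hN : 2 ≤ N) {ζ g : Space N → ℝ} {β B L : ℝ}
    (hζ : ContDiff ℝ 1 ζ) (h0 : ∀ x ∉ B4 N, ζ x = 0) (hβ : 0 ≤ β) (hg : Measurable g)
    (hB : ∀ x, |g x| ≤ B) :
    ENNReal.ofReal |∫ x, transport ζ β L (diag N) g x| ≤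
      1 / 2 * hHalfSq (fun x => ζ x * max (β * (g x - L)) 0) +
      2 * N * sobolevConst N * (ENNReal.ofReal |L| + ENNReal.ofReal B) ^ 2 *
        ∫⁻ x in B4 N, ENNReal.ofReal (‖fderiv ℝ ζ x‖ ^ 2 * max (β * (g x - L)) 0 ^ 2) := by
  set h : Space N → ℝ := fun x => ζ x * max (β * (g x - L)) 0 with hh
  set Y := ∫⁻ x in B4 N, ENNReal.ofReal (‖fderiv ℝ ζ x‖ ^ 2 * max (β * (g x - L)) 0 ^ 2) with hY
  have hB0 : 0 ≤ B := (abs_nonneg _).trans (hB 0)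
  rcases eq_or_ne (hHalfSq h) ⊤ with hfin | hfin
  · rw [hfin, ENNReal.mul_top (by norm_num)]
    simp
  have hζm := hζ.continuous.measurable
  have hdζ : Measurable fun x => ‖fderiv ℝ ζ x‖ := (measurable_fderiv ℝ ζ).norm
  have hhm : Measurable h := by fun_prop
  have hc : HasCompactSupport ζ :=
    HasCompactSupport.of_support_subset_isCompact
      (isCompact_closedBall (0 : Space N) (cutRadius N)) fun x hx => by
        by_contra hx'
        refine hx (h0 x fun hm => hx' ?_)
        simpa using (norm_lt_of_mem_B4 hm).le
  have hmem : MemLp h 2 := by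
    obtain ⟨D, hD0, hD, -⟩ := exists_bound_of_contDiff_one hζ hc
    have : MemLp ζ 2 := hζ.continuous.memLp_of_hasCompactSupport hc
    refine (this.const_mul (β * (B + |L|))).mono hhm.aestronglyMeasurable (ae_of_all _ fun x => ?_)
    rw [norm_mul, norm_mul, mul_comm, Real.norm_of_nonneg (by positivity : 0 ≤ β * (B + |L|))]
    exact mul_le_mul_of_nonneg_right ((abs_posPart_le _).trans (abs_mul_sub_le hβ hB x))
      (norm_nonneg _)
  set M' : ℝ := (2 * B + |L|) / 3 with hM'
  set c : ℝ := √N * M' with hcdef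
  have hM'0 : 0 ≤ M' := by positivity
  have hpt : ∀ x, ENNReal.ofReal |transport ζ β L (diag N) g x| ≤ (B4 N).indicator
      (fun x => ENNReal.ofReal c * (ENNReal.ofReal |h x| *
        ENNReal.ofReal (‖fderiv ℝ ζ x‖ * max (β * (g x - L)) 0))) x := by
    intro x
    by_cases hx : x ∈ B4 N
    · rw [indicator_of_mem hx, ← ENNReal.ofReal_mul (abs_nonneg _),
        ← ENNReal.ofReal_mul (by positivity)]
      refine ENNReal.ofReal_le_ofReal ?_
      have hm0 : 0 ≤ max (β * (g x - L)) 0 := le_max_right _ _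
      rw [transport, hh, abs_mul, abs_mul, abs_mul, abs_mul, abs_pow, abs_of_nonneg hm0]
      have h1 : |fderiv ℝ ζ x (diag N)| ≤ ‖fderiv ℝ ζ x‖ * √N := by
        rw [← norm_diag]
        exact ContinuousLinearMap.le_opNorm (fderiv ℝ ζ x) (diag N)
      have h2 : |(2 * g x + L) / 3| ≤ M' := by
        rw [hM', abs_div, abs_of_pos (by norm_num : (0:ℝ) < 3)]
        gcongr
        refine (abs_add_le _ _).trans (add_le_add ?_ le_rfl)
        rw [abs_mul, abs_two]
        linarith [hB x]
      calc |ζ x| * |fderiv ℝ ζ x (diag N)| * max (β * (g x - L)) 0 ^ 2 * |(2 * g x + L) / 3|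
          ≤ |ζ x| * (‖fderiv ℝ ζ x‖ * √N) * max (β * (g x - L)) 0 ^ 2 * M' := by gcongr
        _ = _ := by ring
    · rw [indicator_of_notMem hx, transport, h0 x hx]
      simp
  have hsq : ∀ r : ℝ, 0 ≤ r → ENNReal.ofReal r ^ (2 : ℝ) = ENNReal.ofReal (r ^ 2) := fun r hr => by
    rw [ENNReal.rpow_ofNat, ENNReal.ofReal_pow hr]
  have hCS := ENNReal.lintegral_mul_le_Lp_mul_Lq (volume.restrict (B4 N)) Real.HolderConjugate.two_two
    (f := fun x => ENNReal.ofReal |h x|)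
    (g := fun x => ENNReal.ofReal (‖fderiv ℝ ζ x‖ * max (β * (g x - L)) 0))
    (by fun_prop) (by fun_prop)
  have hA : ∫⁻ x in B4 N, ENNReal.ofReal |h x| ^ (2 : ℝ) ≤ 8 * sobolevConst N * hHalfSq h := by
    refine le_trans (le_of_eq ?_) (lintegral_sq_le hN hhm hmem (fun x hx => by simp [hh, h0 x hx]) hfin)
    congr 1
    funext x
    rw [hsq _ (abs_nonneg _), sq_abs]
  have hYe : ∫⁻ x in B4 N, ENNReal.ofReal (‖fderiv ℝ ζ x‖ * max (β * (g x - L)) 0) ^ (2 : ℝ)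
      = Y := by
    rw [hY]
    congr 1
    funext x
    rw [hsq _ (mul_nonneg (norm_nonneg _) (le_max_right _ _)), mul_pow]
  rw [hYe] at hCS
  rw [← Real.enorm_eq_ofReal_abs]
  calc ‖∫ x, transport ζ β L (diag N) g x‖ₑ
      ≤ ∫⁻ x, ENNReal.ofReal |transport ζ β L (diag N) g x| := by
        simp_rw [← Real.enorm_eq_ofReal_abs]
        exact enorm_integral_le_lintegral_enorm _
    _ ≤ ∫⁻ x in B4 N, ENNReal.ofReal c * (ENNReal.ofReal |h x| *
        ENNReal.ofReal (‖fderiv ℝ ζ x‖ * max (β * (g x - L)) 0)) := by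
        rw [← lintegral_indicator (isClosed_B4 N).measurableSet]
        exact lintegral_mono hpt
    _ ≤ ENNReal.ofReal c * ((8 * sobolevConst N * hHalfSq h) ^ (1 / 2 : ℝ) * Y ^ (1 / 2 : ℝ)) := by
        rw [lintegral_const_mul' _ _ ENNReal.ofReal_ne_top]
        gcongr
        refine hCS.trans ?_
        gcongr
    _ = hHalfSq h ^ (1 / 2 : ℝ) * (8 * sobolevConst N * ENNReal.ofReal (c ^ 2) * Y) ^ (1 / 2 : ℝ) := by
        have : ENNReal.ofReal c = ENNReal.ofReal (c ^ 2) ^ (1 / 2 : ℝ) := by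
          rw [← hsq c (by positivity), ← ENNReal.rpow_mul]
          norm_num
        rw [this, ← ENNReal.mul_rpow_of_nonneg _ _ (by norm_num),
          ← ENNReal.mul_rpow_of_nonneg _ _ (by norm_num),
          ← ENNReal.mul_rpow_of_nonneg _ _ (by norm_num)]
        congr 1
        ring
    _ ≤ (hHalfSq h ^ (1 / 2 : ℝ)) ^ (2 : ℝ) / ENNReal.ofReal 2
        + ((8 * sobolevConst N * ENNReal.ofReal (c ^ 2) * Y) ^ (1 / 2 : ℝ)) ^ (2 : ℝ)
          / ENNReal.ofReal 2 := ENNReal.young_inequality _ _ Real.HolderConjugate.two_two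
    _ = 1 / 2 * hHalfSq h + 4 * ENNReal.ofReal (c ^ 2) * sobolevConst N * Y := by
        rw [← ENNReal.rpow_mul, ← ENNReal.rpow_mul]
        norm_num
        rw [ENNReal.div_eq_inv_mul, ENNReal.div_eq_inv_mul]
        congr 1
        have : (8 : ℝ≥0∞) = 2 * 4 := by norm_num
        rw [this]
        simp only [← mul_assoc]
        rw [ENNReal.inv_mul_cancel (by norm_num) (by norm_num), one_mul]
        ring
    _ ≤ _ := by
        gcongr 1 / 2 * hHalfSq h + ?_ * Y
        have h1 : 4 * ENNReal.ofReal (c ^ 2) ≤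
            2 * N * (ENNReal.ofReal |L| + ENNReal.ofReal B) ^ 2 := by
          rw [← ENNReal.ofReal_add (abs_nonneg _) hB0, ← ENNReal.ofReal_pow (by positivity),
            ← ENNReal.ofReal_natCast, ← ENNReal.ofReal_ofNat, ← ENNReal.ofReal_ofNat,
            ← ENNReal.ofReal_mul (by norm_num), ← ENNReal.ofReal_mul (by norm_num),
            ← ENNReal.ofReal_mul (by positivity)]
          refine ENNReal.ofReal_le_ofReal ?_
          rw [hcdef, mul_pow, Real.sq_sqrt (Nat.cast_nonneg N)]
          have h2 : M' ^ 2 ≤ (2 / 3 * (|L| + B)) ^ 2 := by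
            refine pow_le_pow_left₀ hM'0 ?_ 2
            have := abs_nonneg L
            rw [hM']
            linarith
          have h3 : (N : ℝ) * M' ^ 2 ≤ N * (2 / 3 * (|L| + B)) ^ 2 := by gcongr
          have h4 : 0 ≤ (N : ℝ) * (|L| + B) ^ 2 := by positivity
          nlinarith
        calc 4 * ENNReal.ofReal (c ^ 2) * sobolevConst N
            ≤ 2 * N * (ENNReal.ofReal |L| + ENNReal.ofReal B) ^ 2 * sobolevConst N := by gcongr
          _ = _ := by ring

/-! ### The energy balance of the mollified equation -/

lemma hasDerivAt_posPart_sq (y : ℝ) : HasDerivAt (fun y => max y 0 ^ 2) (2 * max y 0) y := by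
  rcases lt_trichotomy y 0 with h | rfl | h
  · have : (fun y : ℝ => max y 0 ^ 2) =ᶠ[𝓝 y] fun _ => 0 := by
      filter_upwards [gt_mem_nhds h] with x hx
      rw [max_eq_right hx.le]; norm_num
    rw [max_eq_right h.le, mul_zero]
    exact (hasDerivAt_const y (0 : ℝ)).congr_of_eventuallyEq this
  · rw [hasDerivAt_iff_isLittleO_nhds_zero]
    have h1 : (fun h : ℝ => h ^ 2) =o[𝓝 0] fun h => h := by
      simpa using Asymptotics.isLittleO_pow_id (𝕜 := ℝ) (n := 2) (by norm_num)
    refine (Asymptotics.IsBigO.of_bound 1 (Eventually.of_forall fun h => ?_)).trans_isLittleO h1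
    have h2 := pow_le_pow_left₀ (abs_nonneg _) (abs_posPart_le h) 2
    rw [← abs_pow, ← abs_pow] at h2
    simpa using h2
  · have : (fun y : ℝ => max y 0 ^ 2) =ᶠ[𝓝 y] fun y => y ^ 2 := by
      filter_upwards [lt_mem_nhds h] with x hx
      rw [max_eq_left hx.le]
    rw [max_eq_left h.le]
    exact (by simpa using hasDerivAt_pow 2 y : HasDerivAt (fun y : ℝ => y ^ 2) (2 * y) y
      ).congr_of_eventuallyEq this

/-- The chain rule for the square of the positive part along a primitive. -/
lemma half_posPart_sq_sub {r : ℝ → ℝ} {R : ℝ} (hr : Measurable r) (hR : ∀ s, |r s| ≤ R)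
    (c β L σ t : ℝ) :
    1 / 2 * max (β * (c + (∫ s in σ..t, r s) - L)) 0 ^ 2 - 1 / 2 * max (β * (c - L)) 0 ^ 2
      = ∫ s in σ..t, max (β * (c + (∫ s' in σ..s, r s') - L)) 0 * (β * r s) := by
  have hloc : LocallyIntegrable r := (locallyIntegrable_const R).mono hr.aestronglyMeasurable
    (ae_of_all _ fun x => (hR x).trans (le_abs_self R))
  have hR0 : 0 ≤ R := (abs_nonneg _).trans (hR 0)
  have hint : ∀ a b, IntervalIntegrable r volume a b := fun a b =>
    intervalIntegrable_iff.mpr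
      ((hloc.integrableOn_isCompact isCompact_uIcc).mono_set uIoc_subset_uIcc)
  have hl : LipschitzWith R.toNNReal (fun s => c + ∫ s' in σ..s, r s') := by
    refine LipschitzWith.of_dist_le_mul fun s s' => ?_
    rw [dist_add_left, Real.dist_eq, intervalIntegral.integral_interval_sub_left (hint _ _)
      (hint _ _), Real.coe_toNNReal R hR0, Real.dist_eq]
    exact intervalIntegral.norm_integral_le_of_norm_le_const (f := r) fun x _ => hR x
  have hl2 : LipschitzWith (1 * (‖β‖₊ * R.toNNReal))
      (fun s => max (β * (c + (∫ s' in σ..s, r s') - L)) 0) := by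
    refine lipschitzWith_posPart.comp (LipschitzWith.of_dist_le_mul fun s s' => ?_)
    have h := hl.dist_le_mul s s'
    rw [Real.dist_eq] at h ⊢
    rw [← mul_sub, sub_sub_sub_cancel_right, abs_mul, NNReal.coe_mul, mul_assoc]
    exact mul_le_mul_of_nonneg_left h (abs_nonneg _)
  have hac := (hl2.lipschitzOnWith (s := uIcc σ t)).absolutelyContinuousOnInterval
  have h2 := ((hac.mul hac).const_mul (1 / 2)).integral_deriv_eq_sub
  simp only [intervalIntegral.integral_same, add_zero, Pi.mul_apply] at h2
  rw [pow_two, pow_two, ← h2]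
  refine intervalIntegral.integral_congr_ae ?_
  filter_upwards [LocallyIntegrable.ae_hasDerivAt_integral hloc] with s hs _
  have h3 := (((hs σ).const_add c).sub_const L).const_mul β
  have h4 := ((hasDerivAt_posPart_sq _).comp s h3).const_mul (1 / 2)
  have e : (fun x => 1 / 2 * (max (β * (c + (∫ s' in σ..x, r s') - L)) 0 *
      max (β * (c + (∫ s' in σ..x, r s') - L)) 0)) = fun y => 1 / 2 *
      ((fun y => max y 0 ^ 2) ∘ fun x => β * (c + (∫ t in σ..x, r t) - L)) y := by
    funext x
    simp only [Function.comp]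
    ring
  rw [e, h4.deriv]
  ring

/-- The time derivative of the mollification of a solution. -/
def smearedFlux (m f : Space N → ℝ) (x : Space N) : ℝ :=
  -(1 / 2) * fderiv ℝ (smear m fun y => f y ^ 2) x (diag N) - halfLaplacian (smear m f) x

section Balance

variable {m ζ : Space N → ℝ} {B C δ β L σ t : ℝ} {θ : ℝ → Space N → ℝ}

lemma fderiv_smear_eq_smear {f : Space N → ℝ} (hm : ContDiff ℝ (⊤ : ℕ∞) m)
    (hc : HasCompactSupport m) (hf : Measurable f) (hB : ∀ x, |f x| ≤ B) (x v : Space N) :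
    fderiv ℝ (smear m f) x v = smear (fun x => fderiv ℝ m x v) f x := by
  rw [fderiv_smear_apply hm hc hf hB, smear]
  simp_rw [mul_comm]

lemma IsMollifier.measurable_smearedFlux (hm : IsMollifier C δ m)
    (hθ : Measurable (Function.uncurry θ)) (hB : ∀ s x, |θ s x| ≤ B) :
    Measurable (Function.uncurry fun s x => smearedFlux m (θ s) x) := by
  have hθs : ∀ s, Measurable (θ s) := fun s => hθ.of_uncurry_left
  have e : (Function.uncurry fun s x => smearedFlux m (θ s) x) = fun p : ℝ × Space N =>
      -(1 / 2) * smear (fun x => fderiv ℝ m x (diag N)) (fun y => θ p.1 y ^ 2) p.2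
        - halfLaplacian (smear m (θ p.1)) p.2 := by
    funext p
    rw [Function.uncurry, smearedFlux,
      fderiv_smear_eq_smear hm.smooth hm.compact ((hθs _).pow_const 2) (abs_sq_le (hB _))]
  rw [e]
  refine ((measurable_smear (F := fun s y => θ s y ^ 2) ?_ (hθ.pow_const 2)).const_mul _).sub
    (measurable_halfLaplacian (G := fun s => smear m (θ s)) ?_)
  · exact measurable_fderiv_apply_const' _
  · exact measurable_smear hm.smooth.continuous.measurable hθ

lemma IsMollifier.exists_abs_smearedFlux_le (hN : 0 < N) (hm : IsMollifier C δ m) (B : ℝ) :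
    ∃ R, ∀ f : Space N → ℝ, Measurable f → (∀ x, |f x| ≤ B) → ∀ x, |smearedFlux m f x| ≤ R := by
  obtain ⟨C₁, h₁⟩ := exists_smear_secondDiff_le hm.smooth hm.compact B
  refine ⟨1 / 2 * ((∫ y, |fderiv ℝ m y (diag N)|) * B ^ 2) +
    poissonConst N / 2 * (C₁ * ∫ h : Space N, incrWeight h), fun f hf hB x => ?_⟩
  have hi : Integrable fun x => fderiv ℝ m x (diag N) :=
    (integrable_fderiv_of_smooth hm.smooth hm.compact).apply_continuousLinearMap _
  rw [smearedFlux]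
  refine (abs_sub _ _).trans (add_le_add ?_ (abs_halfLaplacian_le hN (h₁ f hf hB) x))
  rw [abs_mul, abs_neg, abs_of_pos (by norm_num : (0 : ℝ) < 1 / 2)]
  refine mul_le_mul_of_nonneg_left ?_ (by norm_num)
  rw [fderiv_smear_eq_smear hm.smooth hm.compact (hf.pow_const 2) (abs_sq_le hB)]
  exact CriticalBurgers.abs_smear_le hi (abs_sq_le hB) x

/-- The rate of change of the local energy of the mollified solution. -/
def energyRate (ζ : Space N → ℝ) (β L : ℝ) (m f : Space N → ℝ) : ℝ :=
  ∫ x, ζ x ^ 2 * (max (β * (smear m f x - L)) 0 * (β * smearedFlux m f x))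

lemma integrable_sq_of_contDiff (hζ : ContDiff ℝ 1 ζ) (hc : HasCompactSupport ζ) :
    Integrable fun x => ζ x ^ 2 :=
  (hζ.continuous.pow 2).integrable_of_hasCompactSupport (by
    simp_rw [pow_two]; exact hc.mul_left)

lemma IsMollifier.integrable_energyRate_prod (hN : 0 < N) (hm : IsMollifier C δ m)
    (hζ : ContDiff ℝ 1 ζ) (hc : HasCompactSupport ζ) (hβ : 0 ≤ β)
    (hθ : Measurable (Function.uncurry θ)) (hB : ∀ s x, |θ s x| ≤ B) (L σ t : ℝ) :
    Integrable (Function.uncurry fun (s : ℝ) x =>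
      ζ x ^ 2 * (max (β * (smear m (θ s) x - L)) 0 * (β * smearedFlux m (θ s) x)))
      ((volume.restrict (Ioc σ t)).prod volume) := by
  obtain ⟨R, hR⟩ := hm.exists_abs_smearedFlux_le hN B
  have hF := hm.measurable_smearedFlux hθ hB
  have hS := measurable_smear hm.smooth.continuous.measurable hθ
  have h1 : Integrable (fun p : ℝ × Space N => (1 : ℝ) * ζ p.2 ^ 2)
      ((volume.restrict (Ioc σ t)).prod volume) :=
    (integrable_const (1 : ℝ)).mul_prod (integrable_sq_of_contDiff hζ hc)
  simp_rw [one_mul] at h1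
  refine h1.mul_bdd (c := β * (B + |L|) * (β * R)) (Measurable.aestronglyMeasurable ?_)
    (ae_of_all _ fun p => ?_)
  · exact (((hS.sub_const L).const_mul β).max measurable_const).mul (hF.const_mul β)
  · rw [norm_mul, norm_mul, Real.norm_of_nonneg hβ]
    have h2 := abs_mul_sub_le (L := L) hβ (hm.abs_smear_le (hB p.1)) p.2
    exact mul_le_mul ((abs_posPart_le _).trans h2) (mul_le_mul_of_nonneg_left
      (hR _ hθ.of_uncurry_left (hB _) _) hβ) (by positivity) ((abs_nonneg _).trans h2)

lemma IsMollifier.integrable_energyRate (hN : 0 < N) (hm : IsMollifier C δ m)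
    (hζ : ContDiff ℝ 1 ζ) (hc : HasCompactSupport ζ) (hβ : 0 ≤ β)
    (hθ : Measurable (Function.uncurry θ)) (hB : ∀ s x, |θ s x| ≤ B) (L σ t : ℝ) :
    Integrable (fun s => energyRate ζ β L m (θ s)) (volume.restrict (Ioc σ t)) :=
  (hm.integrable_energyRate_prod hN hζ hc hβ hθ hB L σ t).integral_prod_left

/-- `b` is the value at time `t` of a solution with the value `a` at time `σ`, in the sense that
the mollified equation holds in its integrated form. -/
def Evolves (m : Space N → ℝ) (θ : ℝ → Space N → ℝ) (σ t : ℝ) (a b : Space N → ℝ) : Prop :=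
  ∀ᵐ x, (∀ᵐ s ∂volume.restrict (Ioc σ t),
      smear m (θ s) x = smear m a x + ∫ r in σ..s, smearedFlux m (θ r) x) ∧
    smear m b x = smear m a x + ∫ r in σ..t, smearedFlux m (θ r) x

/-- The local energy balance of the mollified solution. -/
lemma IsMollifier.energy_balance (hN : 0 < N) (hm : IsMollifier C δ m)
    (hζ : ContDiff ℝ 1 ζ) (hc : HasCompactSupport ζ) (hβ : 0 ≤ β)
    (hθ : Measurable (Function.uncurry θ)) (hB : ∀ s x, |θ s x| ≤ B) (hσt : σ ≤ t)
    {a b : Space N → ℝ} (ha : Measurable a) (hb : Measurable b) (haB : ∀ x, |a x| ≤ B)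
    (hbB : ∀ x, |b x| ≤ B) (hev : Evolves m θ σ t a b) :
    1 / 2 * (∫ x, ζ x ^ 2 * max (β * (smear m b x - L)) 0 ^ 2)
      - 1 / 2 * (∫ x, ζ x ^ 2 * max (β * (smear m a x - L)) 0 ^ 2)
      = ∫ s in Ioc σ t, energyRate ζ β L m (θ s) := by
  obtain ⟨R, hR⟩ := hm.exists_abs_smearedFlux_le hN B
  have hF := hm.measurable_smearedFlux hθ hB
  have hi : ∀ g : Space N → ℝ, Measurable g → (∀ x, |g x| ≤ B) →
      Integrable fun x => ζ x ^ 2 * max (β * (smear m g x - L)) 0 ^ 2 := fun g hg hgB => by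
    obtain ⟨K, hK⟩ := exists_lipschitz_smear hm.smooth hm.compact hg hgB
    have := hK.continuous.measurable
    refine integrable_mul_of_bdd (B := (β * (B + |L|)) ^ 2) (integrable_sq_of_contDiff hζ hc)
      (by fun_prop) fun x => ?_
    rw [abs_pow]
    exact pow_le_pow_left₀ (abs_nonneg _)
      ((abs_posPart_le _).trans (abs_mul_sub_le hβ (hm.abs_smear_le hgB) x)) 2
  have hprod := hm.integrable_energyRate_prod hN hζ hc hβ hθ hB L σ t
  simp only [energyRate]
  rw [integral_integral_swap hprod, ← integral_const_mul, ← integral_const_mul,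
    ← integral_sub ((hi b hb hbB).const_mul _) ((hi a ha haB).const_mul _)]
  refine integral_congr_ae ?_
  filter_upwards [hev] with x hx
  have h := half_posPart_sq_sub (r := fun s => smearedFlux m (θ s) x)
    (hF.of_uncurry_right (y := x)) (fun s => hR _ hθ.of_uncurry_left (hB s) x)
    (smear m a x) β L σ t
  rw [← hx.2, intervalIntegral.integral_of_le hσt] at h
  have h2 : ∫ s in Ioc σ t, max (β * (smear m (θ s) x - L)) 0 * (β * smearedFlux m (θ s) x) =
      ∫ s in Ioc σ t, max (β * (smear m a x + (∫ s' in σ..s, smearedFlux m (θ s') x) - L)) 0 *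
        (β * smearedFlux m (θ s) x) := by
    refine integral_congr_ae ?_
    filter_upwards [hx.1] with s hs
    rw [hs]
  rw [integral_const_mul, h2, ← h]
  ring

/-- The transport part of the energy rate. -/
def transportRate (ζ : Space N → ℝ) (β L : ℝ) (m f : Space N → ℝ) : ℝ :=
  -(β / 2) * ∫ x, ζ x ^ 2 * max (β * (smear m f x - L)) 0 *
    fderiv ℝ (smear m fun y => f y ^ 2) x (diag N)

lemma measurable_halfLaplacian_of_measurable {g : Space N → ℝ} (hg : Measurable g) :
    Measurable fun x => halfLaplacian g x := by
  refine Measurable.const_mul (StronglyMeasurable.integral_prod_right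
    (f := fun (x h : Space N) => (2 * g x - g (x + h) - g (x - h)) / ‖h‖ ^ (N + 1))
    ?_).measurable _
  exact Measurable.stronglyMeasurable (by unfold Function.uncurry; fun_prop)

/-- The energy rate is the sum of a transport part and a dissipative part. -/
lemma IsMollifier.energyRate_eq (hN : 0 < N) (hm : IsMollifier C δ m) (hζ : ContDiff ℝ 1 ζ)
    (hc : HasCompactSupport ζ) (hβ : 0 ≤ β) {f : Space N → ℝ} (hf : Measurable f)
    (hB : ∀ x, |f x| ≤ B) (L : ℝ) :
    energyRate ζ β L m f = transportRate ζ β L m f -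
      energyForm (fun x => β * (smear m f x - L))
        (fun x => ζ x ^ 2 * max (β * (smear m f x - L)) 0) := by
  obtain ⟨K, hK⟩ := exists_lipschitz_smear hm.smooth hm.compact hf hB
  obtain ⟨C₁, h₁⟩ := exists_smear_secondDiff_le hm.smooth hm.compact B
  have hgB := abs_mul_sub_le (L := L) hβ (hm.abs_smear_le hB)
  have hgl := lipschitz_mul_sub (β := β) (L := L) hK
  obtain ⟨K', hK'⟩ := exists_lipschitz_sq_mul_posPart hζ hc hgl hgB
  set w : Space N → ℝ := fun x => ζ x ^ 2 * max (β * (smear m f x - L)) 0 with hw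
  have hwi : Integrable w := hK'.continuous.integrable_of_hasCompactSupport
    (hasCompactSupport_sq_mul_posPart hc)
  have hd : ∀ x h, 2 * (β * (smear m f x - L)) - β * (smear m f (x + h) - L)
      - β * (smear m f (x - h) - L) =
      β * (2 * smear m f x - smear m f (x + h) - smear m f (x - h)) := fun x h => by ring
  have hC : ∀ x h, |2 * (β * (smear m f x - L)) - β * (smear m f (x + h) - L)
      - β * (smear m f (x - h) - L)| ≤ β * C₁ * min 1 (‖h‖ ^ 2) := fun x h => by
    rw [hd, abs_mul, abs_of_nonneg hβ, mul_assoc]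
    exact mul_le_mul_of_nonneg_left (h₁ f hf hB x h) hβ
  have hh : ∀ x, halfLaplacian (fun x => β * (smear m f x - L)) x =
      β * halfLaplacian (smear m f) x := fun x => by
    simp only [halfLaplacian, hd, mul_div_assoc]
    rw [integral_const_mul]
    ring
  have hΛm : Measurable fun x => halfLaplacian (smear m f) x :=
    measurable_halfLaplacian_of_measurable hK.continuous.measurable
  have i1 : Integrable fun x => w x * halfLaplacian (smear m f) x :=
    integrable_mul_of_bdd hwi hΛm (abs_halfLaplacian_le hN (h₁ f hf hB))
  have i2 : Integrable fun x => w x * fderiv ℝ (smear m fun y => f y ^ 2) x (diag N) := by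
    obtain ⟨Kq, hq⟩ := exists_lipschitz_smear hm.smooth hm.compact (hf.pow_const 2) (abs_sq_le hB)
    exact integrable_mul_of_bdd (B := Kq * ‖diag N‖) hwi (measurable_fderiv_apply_const' _)
      fun x => (ContinuousLinearMap.le_opNorm _ _).trans (mul_le_mul_of_nonneg_right
        (norm_fderiv_le_of_lipschitz ℝ hq) (norm_nonneg _))
  rw [energyForm_eq_integral_halfLaplacian hN hwi hgl.continuous.measurable hgB hC, energyRate,
    transportRate]
  simp_rw [hh]
  have e : (fun x => w x * (β * halfLaplacian (smear m f) x)) =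
      fun x => β * (w x * halfLaplacian (smear m f) x) := by funext x; ring
  rw [e, integral_const_mul, ← integral_const_mul, ← integral_const_mul,
    ← integral_sub (i2.const_mul _) (i1.const_mul _)]
  congr 1
  funext x
  rw [smearedFlux, hw]
  ring

end Balance

/-! ### Limits at a fixed time -/

section Limits

variable {G : ℕ → Space N → ℝ} {g ζ : Space N → ℝ} {B β L : ℝ} {η : Space N × ℝ → ℝ}

lemma tendsto_smear {C : ℝ} {δ : ℕ → ℝ} {m : ℕ → Space N → ℝ} (hδ : ∀ n, 0 < δ n)
    (hlim : Tendsto δ atTop (𝓝 0)) (hm : ∀ n, IsMollifier C (δ n) (m n)) (hg : Measurable g)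
    (hB : ∀ x, |g x| ≤ B) : ∀ᵐ x, Tendsto (fun n => smear (m n) g x) atTop (𝓝 (g x)) := by
  filter_upwards [tendsto_meanDev hg hB hδ hlim] with x hx
  rw [tendsto_iff_norm_sub_tendsto_zero]
  refine squeeze_zero (fun n => norm_nonneg _) (fun n => (hm n).abs_smear_sub_le hg hB x) ?_
  simpa using hx.const_mul C

lemma tendsto_integral_sq_mul_posPart_sq (hζ : ContDiff ℝ 1 ζ) (hc : HasCompactSupport ζ)
    (hβ : 0 ≤ β) (hG : ∀ n, Measurable (G n)) (hB : ∀ n x, |G n x| ≤ B)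
    (hlim : ∀ᵐ x, Tendsto (fun n => G n x) atTop (𝓝 (g x))) :
    Tendsto (fun n => ∫ x, ζ x ^ 2 * max (β * (G n x - L)) 0 ^ 2) atTop
      (𝓝 (∫ x, ζ x ^ 2 * max (β * (g x - L)) 0 ^ 2)) := by
  have hζm := hζ.continuous.measurable
  refine tendsto_integral_of_dominated_convergence (fun x => ζ x ^ 2 * (β * (B + |L|)) ^ 2)
    (fun n => ?_) ((integrable_sq_of_contDiff hζ hc).mul_const _)
    (fun n => ae_of_all _ fun x => ?_) ?_
  · have := hG n
    exact Measurable.aestronglyMeasurable (by fun_prop)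
  · rw [norm_mul, norm_pow, Real.norm_eq_abs, sq_abs, norm_pow]
    refine mul_le_mul_of_nonneg_left ?_ (sq_nonneg _)
    exact pow_le_pow_left₀ (abs_nonneg _)
      ((abs_posPart_le _).trans (abs_mul_sub_le hβ (hB n) x)) 2
  · filter_upwards [hlim] with x hx
    have h : Continuous fun y : ℝ => ζ x ^ 2 * max (β * (y - L)) 0 ^ 2 := by fun_prop
    exact (h.tendsto _).comp hx

/-- A bound for the density of the transport term. -/
lemma abs_transport_le (hβ : 0 ≤ β) (hB : ∀ x, |g x| ≤ B) (v x : Space N) :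
    |transport ζ β L v g x| ≤
      |ζ x * fderiv ℝ ζ x v| * ((β * (B + |L|)) ^ 2 * ((2 * B + |L|) / 3)) := by
  rw [transport, abs_mul, abs_mul, mul_assoc, abs_pow]
  refine mul_le_mul_of_nonneg_left (mul_le_mul (pow_le_pow_left₀ (abs_nonneg _)
    ((abs_posPart_le _).trans (abs_mul_sub_le hβ hB x)) 2) ?_ (abs_nonneg _)
    (sq_nonneg _)) (abs_nonneg _)
  rw [abs_div, abs_of_pos (by norm_num : (0:ℝ) < 3)]
  gcongr
  refine (abs_add_le _ _).trans (add_le_add ?_ le_rfl)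
  rw [abs_mul, abs_two]
  linarith [hB x]

lemma integrable_mul_fderiv (hζ : ContDiff ℝ 1 ζ) (hc : HasCompactSupport ζ) (v : Space N) :
    Integrable fun x => ζ x * fderiv ℝ ζ x v :=
  (hζ.continuous.mul ((hζ.continuous_fderiv (by simp)).clm_apply continuous_const)
    ).integrable_of_hasCompactSupport hc.mul_right

lemma exists_abs_integral_transport_le (hζ : ContDiff ℝ 1 ζ) (hc : HasCompactSupport ζ)
    (hβ : 0 ≤ β) (B L : ℝ) (v : Space N) : ∃ K, ∀ g : Space N → ℝ, (∀ x, |g x| ≤ B) →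
      |∫ x, transport ζ β L v g x| ≤ K :=
  ⟨_, fun g hB => norm_integral_le_of_norm_le (f := transport ζ β L v g) ((integrable_mul_fderiv hζ hc v).abs.mul_const _)
    (ae_of_all _ fun x => abs_transport_le hβ hB v x)⟩

lemma tendsto_integral_transport (hζ : ContDiff ℝ 1 ζ) (hc : HasCompactSupport ζ)
    (hβ : 0 ≤ β) (hG : ∀ n, Measurable (G n)) (hB : ∀ n x, |G n x| ≤ B)
    (hlim : ∀ᵐ x, Tendsto (fun n => G n x) atTop (𝓝 (g x))) (v : Space N) :
    Tendsto (fun n => ∫ x, transport ζ β L v (G n) x) atTop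
      (𝓝 (∫ x, transport ζ β L v g x)) := by
  have hζm := hζ.continuous.measurable
  have hd := measurable_fderiv_apply_const' (w := ζ) v
  refine tendsto_integral_of_dominated_convergence _ (fun n => ?_)
    ((integrable_mul_fderiv hζ hc v).abs.mul_const _)
    (fun n => ae_of_all _ fun x => abs_transport_le hβ (hB n) v x) ?_
  · have := hG n
    unfold transport
    exact Measurable.aestronglyMeasurable (by fun_prop)
  · filter_upwards [hlim] with x hx
    have h : Continuous fun y : ℝ => ζ x * fderiv ℝ ζ x v * max (β * (y - L)) 0 ^ 2 *
        ((2 * y + L) / 3) := by fun_prop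
    exact (h.tendsto _).comp hx

lemma measurable_harmonicExt {α : Type*} [MeasurableSpace α] {H : α → Space N → ℝ}
    (hH : Measurable (Function.uncurry H)) :
    Measurable fun q : α × (Space N × ℝ) => harmonicExt (H q.1) q.2 := by
  unfold harmonicExt
  refine Measurable.ite (measurableSet_lt measurable_const (by fun_prop)) ?_ ?_
  · refine (StronglyMeasurable.integral_prod_right
      (f := fun (q : α × (Space N × ℝ)) y => poissonKernel (q.2.1 - y) q.2.2 * H q.1 y)
      ?_).measurable
    refine Measurable.stronglyMeasurable (Measurable.mul ?_ ?_)
    · exact measurable_poissonKernel.comp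
        (f := fun q : (α × (Space N × ℝ)) × Space N => (q.1.2.2, q.1.2.1 - q.2)) (by fun_prop)
    · exact hH.comp (f := fun q : (α × (Space N × ℝ)) × Space N => (q.1.1, q.2)) (by fun_prop)
  · exact hH.comp (f := fun q : α × (Space N × ℝ) => (q.1, q.2.1)) (by fun_prop)

lemma IsCutoff.exists_gradSq_le (hη : IsCutoff η) :
    ∃ C, 0 ≤ C ∧ ∀ᵐ p ∂volume.restrict (B4star N), gradSq η p ≤ C := by
  obtain ⟨C, hC⟩ := IsTest.gradSq_le (N := N) (R := cutRadius N) (Z := 5) hη.contDiff_one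
  refine ⟨max C 0, le_max_right _ _, ?_⟩
  filter_upwards [ae_restrict_mem (measurableSet_B4star N),
    ae_restrict_of_ae ae_height_ne_zero] with p hp hp'
  exact (hC p (mem_slab_of_mem_B4star hp hp')).trans (le_max_left _ _)

lemma volume_B4star_ne_top (N : ℕ) : volume (B4star N) ≠ ⊤ := by
  rw [B4star, Measure.volume_eq_prod, Measure.prod_prod, volume_B4, Real.volume_Icc]
  finiteness

lemma IsCutoff.exists_abs_cutoffError_le (hη : IsCutoff η) (B : ℝ) :
    ∃ K, ∀ g : Space N → ℝ, (∀ x, |g x| ≤ B) → |cutoffError η g| ≤ K := by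
  obtain ⟨C, hC0, hC⟩ := hη.exists_gradSq_le
  refine ⟨∫ p in B4star N, C * B ^ 2, fun g hB => ?_⟩
  refine norm_integral_le_of_norm_le
    (f := fun p => gradSq η p * max (harmonicExt g p) 0 ^ 2)
    (integrableOn_const (volume_B4star_ne_top N)) ?_
  filter_upwards [hC] with p hp
  rw [norm_mul, Real.norm_of_nonneg (gradSq_nonneg _ _), norm_pow]
  refine mul_le_mul hp ?_ (by positivity) hC0
  exact pow_le_pow_left₀ (abs_nonneg _) ((abs_posPart_le _).trans (abs_harmonicExt_le hB p)) 2

lemma cutoffError_nonneg (η : Space N × ℝ → ℝ) (g : Space N → ℝ) : 0 ≤ cutoffError η g :=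
  integral_nonneg fun _ => mul_nonneg (gradSq_nonneg _ _) (sq_nonneg _)

lemma tendsto_cutoffError (hη : IsCutoff η) (hG : ∀ n, Continuous (G n))
    (hB : ∀ n x, |G n x| ≤ B) (hlim : ∀ᵐ x, Tendsto (fun n => G n x) atTop (𝓝 (g x))) :
    Tendsto (fun n => cutoffError η (G n)) atTop (𝓝 (cutoffError η g)) := by
  obtain ⟨C, hC0, hC⟩ := hη.exists_gradSq_le
  refine tendsto_integral_of_dominated_convergence (fun _ => C * B ^ 2) (fun n => ?_)
    (integrableOn_const (volume_B4star_ne_top N)) (fun n => ?_) ?_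
  · have h1 := measurable_gradSq hη.smooth.continuous
    have h2 := (continuous_harmonicExt (hG n) (hB n)).measurable
    exact Measurable.aestronglyMeasurable (by fun_prop)
  · filter_upwards [hC] with p hp
    rw [norm_mul, Real.norm_of_nonneg (gradSq_nonneg _ _), norm_pow]
    refine mul_le_mul hp ?_ (by positivity) hC0
    exact pow_le_pow_left₀ (abs_nonneg _)
      ((abs_posPart_le _).trans (abs_harmonicExt_le (hB n) p)) 2
  · filter_upwards [ae_restrict_mem (measurableSet_B4star N),
      ae_restrict_of_ae ae_height_ne_zero] with p hp hp'
    have h1 := tendsto_harmonicExt (fun n => (hG n).measurable) hB hlim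
      (lt_of_le_of_ne hp.2.1 hp'.symm)
    have h : Continuous fun y : ℝ => gradSq η p * max y 0 ^ 2 := by fun_prop
    exact (h.tendsto _).comp h1

lemma gradSq_posPart_le_liminf (hη : ContDiff ℝ 1 η) (hG : ∀ n, Measurable (G n))
    (hB : ∀ n x, |G n x| ≤ B) (hg : Measurable g) (hgB : ∀ x, |g x| ≤ B)
    (hlim : ∀ᵐ x, Tendsto (fun n => G n x) atTop (𝓝 (g x))) {p : Space N × ℝ} (hz : 0 < p.2) :
    ENNReal.ofReal (gradSq (fun q => η q * max (harmonicExt g q) 0) p) ≤ liminf (fun n =>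
      ENNReal.ofReal (gradSq (fun q => η q * max (harmonicExt (G n) q) 0) p)) atTop := by
  have h1 := tendsto_harmonicExt hG hB hlim hz
  have h2 := tendsto_extDx hG hB hlim hz
  have h3 := tendsto_extDz hG hB hlim hz
  rw [gradSq_mul_posPart hη hg hgB hz]
  split_ifs with h
  · have hcont : Continuous fun q : ℝ × Space N × ℝ =>
        ‖η p • innerSL ℝ q.2.1 + q.1 • fderiv ℝ (fun x => η (x, p.2)) p.1‖ ^ 2
          + (η p * q.2.2 + q.1 * deriv (fun z => η (p.1, z)) p.2) ^ 2 := by fun_prop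
    have h4 := (hcont.tendsto _).comp (h1.prodMk_nhds (h2.prodMk_nhds h3))
    refine le_of_eq (Tendsto.liminf_eq ?_).symm
    refine ENNReal.tendsto_ofReal (h4.congr' ?_)
    filter_upwards [h1.eventually (lt_mem_nhds h)] with n hn
    rw [gradSq_mul_posPart hη (hG n) (hB n) hz, if_pos hn]
    rfl
  · simp

/-- The dissipation is lower semicontinuous under bounded convergence. -/
lemma dissipation_le_liminf (hη : IsCutoff η) (hG : ∀ n, Continuous (G n))
    (hB : ∀ n x, |G n x| ≤ B) (hg : Measurable g) (hgB : ∀ x, |g x| ≤ B)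
    (hlim : ∀ᵐ x, Tendsto (fun n => G n x) atTop (𝓝 (g x))) :
    dissipation η g ≤ liminf (fun n => dissipation η (G n)) atTop := by
  refine le_trans (lintegral_mono_ae ?_) (lintegral_liminf_le' fun n => ?_)
  · filter_upwards [ae_restrict_mem (measurableSet_B4star N),
      ae_restrict_of_ae ae_height_ne_zero] with p hp hp'
    exact gradSq_posPart_le_liminf hη.contDiff_one (fun n => (hG n).measurable) hB hg hgB hlim
      (lt_of_le_of_ne hp.2.1 hp'.symm)
  · have h1 := hη.smooth.continuous
    have h2 := continuous_harmonicExt (hG n) (hB n)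
    exact (measurable_gradSq (by fun_prop)).ennreal_ofReal.aemeasurable

/-- The Gagliardo seminorm is lower semicontinuous under convergence almost everywhere. -/
lemma hHalfSq_le_liminf (hG : ∀ n, Measurable (G n))
    (hlim : ∀ᵐ x, Tendsto (fun n => G n x) atTop (𝓝 (g x))) :
    hHalfSq g ≤ liminf (fun n => hHalfSq (G n)) atTop := by
  have h1 : ∀ᵐ x, incrEnergy g x ≤ liminf (fun n => incrEnergy (G n) x) atTop := by
    filter_upwards [hlim] with x hx
    refine le_trans (lintegral_mono_ae ?_) (lintegral_liminf_le' fun n => ?_)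
    · filter_upwards [hlim] with y hy
      exact (ENNReal.tendsto_ofReal (((hx.sub hy).pow 2).div_const _)).liminf_eq.ge
    · have := hG n
      exact Measurable.aemeasurable (by fun_prop)
  simp_rw [hHalfSq_eq_lintegral_incrEnergy]
  rw [ENNReal.liminf_const_mul_of_ne_top ENNReal.ofReal_ne_top]
  exact mul_le_mul_right ((lintegral_mono_ae h1).trans
    (lintegral_liminf_le' fun n => (measurable_incrEnergy (hG n)).aemeasurable)) _

end Limits

/-! ### The local energy inequality between two times -/

section MeasurableInTime

variable {F : ℝ → Space N → ℝ} {ζ : Space N → ℝ} {B C δ : ℝ} {η : Space N × ℝ → ℝ}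

lemma measurable_integral_transport (hζ : Continuous ζ) (hF : Measurable (Function.uncurry F))
    (β L : ℝ) (v : Space N) : Measurable fun s => ∫ x, transport ζ β L v (F s) x := by
  have h0 := hζ.measurable
  have h1 := measurable_fderiv_apply_const' (w := ζ) v
  refine (StronglyMeasurable.integral_prod_right (f := fun s x => transport ζ β L v (F s) x)
    (Measurable.stronglyMeasurable ?_)).measurable
  have h2 : Measurable fun p : ℝ × Space N => F p.1 p.2 := hF
  unfold transport Function.uncurry
  fun_prop

lemma measurable_cutoffError (hη : Continuous η) (hF : Measurable (Function.uncurry F)) :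
    Measurable fun s => cutoffError η (F s) := by
  have h1 := measurable_gradSq hη
  have h2 := measurable_harmonicExt hF
  refine (StronglyMeasurable.integral_prod_right (ν := volume.restrict (B4star N))
    (f := fun s p => gradSq η p * max (harmonicExt (F s) p) 0 ^ 2)
    (Measurable.stronglyMeasurable ?_)).measurable
  unfold Function.uncurry
  fun_prop

lemma IsMollifier.measurable_transportRate {m : Space N → ℝ} (hm : IsMollifier C δ m)
    (hζ : Continuous ζ) (hF : Measurable (Function.uncurry F)) (hB : ∀ s x, |F s x| ≤ B)
    (β L : ℝ) : Measurable fun s => transportRate ζ β L m (F s) := by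
  have h0 := hζ.measurable
  have h1 := measurable_smear hm.smooth.continuous.measurable hF
  have h2 := measurable_smear (F := fun s y => F s y ^ 2)
    (measurable_fderiv_apply_const' (w := m) (diag N)) (hF.pow_const 2)
  refine Measurable.const_mul (StronglyMeasurable.integral_prod_right
    (f := fun s x => ζ x ^ 2 * max (β * (smear m (F s) x - L)) 0 *
      fderiv ℝ (smear m fun y => F s y ^ 2) x (diag N))
    (Measurable.stronglyMeasurable ?_)).measurable _
  simp_rw [fun s x => fderiv_smear_eq_smear hm.smooth hm.compact
    ((hF.of_uncurry_left (x := s)).pow_const 2) (abs_sq_le (hB s)) x (diag N)]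
  unfold Function.uncurry
  fun_prop

lemma measurable_lintegral_incrEnergy (hF : Measurable (Function.uncurry F)) :
    Measurable fun s => ∫⁻ x, incrEnergy (F s) x := by
  have h2 : Measurable fun p : ℝ × Space N => F p.1 p.2 := hF
  have h : Measurable fun p : ℝ × Space N => incrEnergy (F p.1) p.2 := by
    refine Measurable.lintegral_prod_right' (f := fun q : (ℝ × Space N) × Space N =>
      ENNReal.ofReal ((F q.1.1 q.1.2 - F q.1.1 q.2) ^ 2 / ‖q.1.2 - q.2‖ ^ (N + 1))) ?_
    fun_prop
  exact h.lintegral_prod_right'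

end MeasurableInTime

lemma lintegral_le_of_le_liminf {α : Type*} [MeasurableSpace α] {μ : Measure α}
    {Q : ℕ → α → ℝ} {A : α → ℝ≥0∞} {Y : ℝ} (hQ : ∀ n, Integrable (Q n) μ)
    (h0 : ∀ n s, 0 ≤ Q n s) (hY : Tendsto (fun n => ∫ s, Q n s ∂μ) atTop (𝓝 Y))
    (hA : ∀ᵐ s ∂μ, A s ≤ liminf (fun n => ENNReal.ofReal (Q n s)) atTop) :
    ∫⁻ s, A s ∂μ ≤ ENNReal.ofReal Y := by
  refine (lintegral_mono_ae hA).trans ((lintegral_liminf_le' fun n =>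
    (hQ n).aestronglyMeasurable.aemeasurable.ennreal_ofReal).trans ?_)
  simp_rw [← fun n => ofReal_integral_eq_lintegral_ofReal (hQ n) (ae_of_all _ (h0 n))]
  exact (ENNReal.tendsto_ofReal hY).liminf_eq.le

lemma ofReal_integral_le {α : Type*} [MeasurableSpace α] {μ : Measure α} {f : α → ℝ}
    (hf : ∀ x, 0 ≤ f x) : ENNReal.ofReal (∫ x, f x ∂μ) ≤ ∫⁻ x, ENNReal.ofReal (f x) ∂μ := by
  have h := enorm_integral_le_lintegral_enorm (μ := μ) f
  rw [Real.enorm_eq_ofReal (integral_nonneg hf)] at h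
  refine h.trans_eq (lintegral_congr fun x => ?_)
  rw [Real.enorm_eq_ofReal (hf x)]

section Core

variable {η : Space N × ℝ → ℝ}

lemma IsCutoff.contDiff_trace (hη : IsCutoff η) : ContDiff ℝ 1 fun x => η (x, 0) :=
  hη.contDiff_one.comp (contDiff_id.prodMk contDiff_const)

lemma IsCutoff.trace_eq_zero (hη : IsCutoff η) {x : Space N} (hx : x ∉ B4 N) : η (x, 0) = 0 :=
  hη.support (x, 0) le_rfl fun h => hx h.1

lemma IsCutoff.hasCompactSupport_trace (hη : IsCutoff η) :
    HasCompactSupport fun x => η (x, 0) :=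
  HasCompactSupport.of_support_subset_isCompact
    (isCompact_closedBall (0 : Space N) (cutRadius N)) fun x hx => by
      by_contra hx'
      refine hx (hη.trace_eq_zero fun hm => hx' ?_)
      simpa using (norm_lt_of_mem_B4 hm).le

lemma ofReal_integral_eq_lintegral_B4 (hη : IsCutoff η) {g : Space N → ℝ} {B β L : ℝ}
    (hβ : 0 ≤ β) (hg : Measurable g) (hB : ∀ x, |g x| ≤ B) :
    ENNReal.ofReal (∫ x, η (x, 0) ^ 2 * max (β * (g x - L)) 0 ^ 2) =
      ∫⁻ x in B4 N, ENNReal.ofReal ((η (x, 0) * max (β * (g x - L)) 0) ^ 2) := by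
  rw [ofReal_integral_eq_lintegral_ofReal, setLIntegral_eq_of_support_subset]
  · simp_rw [mul_pow]
  · intro x hx
    by_contra h
    exact hx (by simp [hη.trace_eq_zero h])
  · refine integrable_mul_of_bdd (B := (β * (B + |L|)) ^ 2) (integrable_sq_of_contDiff
      hη.contDiff_trace hη.hasCompactSupport_trace) (by fun_prop) fun x => ?_
    rw [abs_pow]
    exact pow_le_pow_left₀ (abs_nonneg _)
      ((abs_posPart_le _).trans (abs_mul_sub_le hβ hB x)) 2
  · exact ae_of_all _ fun x => by positivity

theorem local_energy_inequality_of_evolves (hN : 2 ≤ N) {θ : ℝ → Space N → ℝ} {B σ t : ℝ}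
    (hθ : Measurable (Function.uncurry θ)) (hB : ∀ s x, |θ s x| ≤ B) (hσt : σ ≤ t)
    (hfin : ∫⁻ s in Ioc σ t, hHalfSq (θ s) ≠ ⊤) {a b : Space N → ℝ} (ha : Measurable a)
    (hb : Measurable b) (haB : ∀ x, |a x| ≤ B) (hbB : ∀ x, |b x| ≤ B)
    {C : ℝ} {δ : ℕ → ℝ} {m : ℕ → Space N → ℝ} (hδ : ∀ n, 0 < δ n) (hδ1 : ∀ n, δ n ≤ 1)
    (hδlim : Tendsto δ atTop (𝓝 0)) (hm : ∀ n, IsMollifier C (δ n) (m n))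
    (hev : ∀ n, Evolves (m n) θ σ t a b) (hη : IsCutoff η) {β : ℝ} (hβ : 0 ≤ β) (L : ℝ) :
    1 / 2 * (∫⁻ s in Ioc σ t, dissipation η fun x => β * (θ s x - L))
      + 1 / 2 * (∫⁻ x in B4 N, ENNReal.ofReal ((η (x, 0) * max (β * (b x - L)) 0) ^ 2))
    ≤ 1 / 2 * (∫⁻ x in B4 N, ENNReal.ofReal ((η (x, 0) * max (β * (a x - L)) 0) ^ 2))
      + 2 * N * sobolevConst N * (ENNReal.ofReal |L| + ENNReal.ofReal B) ^ 2 *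
        (∫⁻ s in Ioc σ t, ∫⁻ x in B4 N, ENNReal.ofReal
          (‖fderiv ℝ (fun y => η (y, 0)) x‖ ^ 2 * max (β * (θ s x - L)) 0 ^ 2))
      + ∫⁻ s in Ioc σ t, ∫⁻ p in B4star N, ENNReal.ofReal
          (gradSq η p * max (harmonicExt (fun x => β * (θ s x - L)) p) 0 ^ 2) := by
  have hN0 : 0 < N := by omega
  set ζ : Space N → ℝ := fun x => η (x, 0) with hζdef
  have hζ : ContDiff ℝ 1 ζ := hη.contDiff_trace
  have hc : HasCompactSupport ζ := hη.hasCompactSupport_trace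
  set μ : Measure ℝ := volume.restrict (Ioc σ t) with hμ
  have hθs : ∀ s, Measurable (θ s) := fun s => hθ.of_uncurry_left
  have hfB : ∀ n s x, |smear (m n) (θ s) x| ≤ B := fun n s => (hm n).abs_smear_le (hB s)
  have hfl : ∀ n s, ∃ K, LipschitzWith K (smear (m n) (θ s)) := fun n s =>
    exists_lipschitz_smear (hm n).smooth (hm n).compact (hθs s) (hB s)
  have hfm : ∀ n s, Measurable (smear (m n) (θ s)) := fun n s =>
    (hfl n s).choose_spec.continuous.measurable
  have hfu : ∀ n, Measurable (Function.uncurry fun s => smear (m n) (θ s)) := fun n =>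
    measurable_smear (hm n).smooth.continuous.measurable hθ
  have hflim : ∀ s, ∀ᵐ x, Tendsto (fun n => smear (m n) (θ s) x) atTop (𝓝 (θ s x)) := fun s =>
    tendsto_smear hδ hδlim hm (hθs s) (hB s)
  have huB : ∀ n s x, |β * (smear (m n) (θ s) x - L)| ≤ β * (B + |L|) := fun n s =>
    abs_mul_sub_le hβ (hfB n s)
  have hul : ∀ n s, ∃ K, LipschitzWith K fun x => β * (smear (m n) (θ s) x - L) := fun n s =>
    ⟨_, lipschitz_mul_sub (hfl n s).choose_spec⟩
  have huu : ∀ n, Measurable (Function.uncurry fun s x => β * (smear (m n) (θ s) x - L)) :=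
    fun n => ((hfu n).sub_const L).const_mul β
  have hulim : ∀ s, ∀ᵐ x, Tendsto (fun n => β * (smear (m n) (θ s) x - L)) atTop
      (𝓝 (β * (θ s x - L))) := fun s => by
    filter_upwards [hflim s] with x hx
    exact (hx.sub_const L).const_mul β
  obtain ⟨KT, hKT⟩ := exists_abs_integral_transport_le hζ hc hβ B L (diag N)
  obtain ⟨KG, hKG⟩ := hη.exists_abs_cutoffError_le (β * (B + |L|))
  obtain ⟨KR, hKR0, hKR⟩ := exists_remainder_le hζ hc hβ C B L (diag N)
  set T : ℕ → ℝ → ℝ := fun n s => ∫ x, transport ζ β L (diag N) (smear (m n) (θ s)) x with hT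
  set R : ℕ → ℝ → ℝ := fun n s => transportRate ζ β L (m n) (θ s) - T n s with hR
  set G : ℕ → ℝ → ℝ := fun n s => cutoffError η fun x => β * (smear (m n) (θ s) x - L) with hG
  set P : ℕ → ℝ → ℝ := fun n s => energyRate ζ β L (m n) (θ s) with hP
  set Q : ℕ → ℝ → ℝ := fun n s => T n s + R n s + G n s - P n s with hQ
  set T' : ℝ → ℝ := fun s => ∫ x, transport ζ β L (diag N) (θ s) x with hT'
  set G' : ℝ → ℝ := fun s => cutoffError η fun x => β * (θ s x - L) with hG'
  have hTm : ∀ n, Measurable (T n) := fun n =>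
    measurable_integral_transport hζ.continuous (hfu n) β L (diag N)
  have hGm : ∀ n, Measurable (G n) := fun n => measurable_cutoffError hη.smooth.continuous (huu n)
  have hRm : ∀ n, Measurable (R n) := fun n =>
    ((hm n).measurable_transportRate hζ.continuous hθ hB β L).sub (hTm n)
  have hQd : ∀ n s, 0 ≤ Q n s ∧
      dissipation η (fun x => β * (smear (m n) (θ s) x - L)) = ENNReal.ofReal (Q n s) := by
    intro n s
    obtain ⟨K, hK⟩ := hul n s
    have h1 := dissipation_eq hN0 hη hK (huB n s)
    have h2 : Q n s = energyForm (fun x => β * (smear (m n) (θ s) x - L))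
        (fun x => η (x, 0) ^ 2 * max (β * (smear (m n) (θ s) x - L)) 0)
        + cutoffError η fun x => β * (smear (m n) (θ s) x - L) := by
      simp only [hQ, hR, hP, hG]
      rw [(hm n).energyRate_eq hN0 hζ hc hβ (hθs s) (hB s)]
      ring
    rw [h2]
    exact h1
  have hRb : ∀ n s, ENNReal.ofReal |R n s| ≤ remainderBound KR (δ n) (θ s) := by
    intro n s
    have h1 := integral_mul_fderiv_smear_sq (L := L) hζ hc hβ (hm n) (hθs s) (hB s) (diag N)
    have h2 : R n s = β / 2 * ∫ x, fderiv ℝ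
        (fun x => ζ x ^ 2 * max (β * (smear (m n) (θ s) x - L)) 0) x (diag N) *
          variance (m n) (θ s) x := by
      simp only [hR, hT, transportRate]
      rw [h1]
      ring
    rw [h2]
    exact hKR _ _ _ (hδ n) (hm n) (hθs s) (hB s)
  have hTi : ∀ n, Integrable (T n) μ := fun n =>
    Measure.integrableOn_of_bounded (M := KT) (by rw [Real.volume_Ioc]; finiteness)
      (hTm n).aestronglyMeasurable (ae_of_all _ fun s => hKT _ (hfB n s))
  have hGi : ∀ n, Integrable (G n) μ := fun n =>
    Measure.integrableOn_of_bounded (M := KG) (by rw [Real.volume_Ioc]; finiteness)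
      (hGm n).aestronglyMeasurable (ae_of_all _ fun s => hKG _ (huB n s))
  -- the remainder vanishes in the limit
  set W : ℝ → ℝ≥0∞ := fun s => ∫⁻ x, incrEnergy (θ s) x with hW
  have hWm : Measurable W := measurable_lintegral_incrEnergy hθ
  have hWfin : ∫⁻ s, W s ∂μ ≠ ⊤ := by
    intro h
    apply hfin
    simp_rw [hHalfSq_eq_lintegral_incrEnergy]
    rw [lintegral_const_mul' _ _ ENNReal.ofReal_ne_top, h, ENNReal.mul_top]
    have := poissonConst_pos N
    simpa using this
  set cR : ℝ≥0∞ := ENNReal.ofReal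
    (KR * (2 * B * volume.real (Metric.closedBall (0 : Space N) 1) + 1)) with hcR
  have hbound : Integrable (fun s => (cR * W s).toReal) μ := by
    refine integrable_toReal_of_lintegral_ne_top (hWm.const_mul _).aemeasurable ?_
    rw [lintegral_const_mul' _ _ ENNReal.ofReal_ne_top]
    exact ENNReal.mul_ne_top ENNReal.ofReal_ne_top hWfin
  have hWae : ∀ᵐ s ∂μ, W s ≠ ⊤ := (ae_lt_top hWm hWfin).mono fun _ h => h.ne
  have hRle : ∀ n, ∀ᵐ s ∂μ, ‖R n s‖ ≤ (cR * W s).toReal := fun n => by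
    filter_upwards [hWae] with s hs
    rw [Real.norm_eq_abs, ← ENNReal.ofReal_le_iff_le_toReal
      (ENNReal.mul_ne_top ENNReal.ofReal_ne_top hs)]
    exact (hRb n s).trans (remainderBound_le hKR0 (hδ n) (hδ1 n) (hθs s) (hB s))
  have hRi : ∀ n, Integrable (R n) μ := fun n =>
    hbound.mono' (hRm n).aestronglyMeasurable (hRle n)
  have hRlim : Tendsto (fun n => ∫ s, R n s ∂μ) atTop (𝓝 0) := by
    have h := tendsto_integral_of_dominated_convergence (μ := μ) (F := R) (f := fun _ => 0)
      (fun s => (cR * W s).toReal) (fun n => (hRm n).aestronglyMeasurable) hbound hRle ?_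
    · simpa using h
    filter_upwards [hWae] with s hs
    rw [tendsto_zero_iff_abs_tendsto_zero]
    have h1 : Tendsto (fun n => ENNReal.ofReal |R n s|) atTop (𝓝 0) :=
      tendsto_of_tendsto_of_tendsto_of_le_of_le tendsto_const_nhds
        (tendsto_remainderBound hKR0 hδ hδ1 hδlim (hθs s) (hB s) hs) (fun _ => zero_le)
        (fun n => hRb n s)
    have h2 := (ENNReal.tendsto_toReal ENNReal.zero_ne_top).comp h1
    refine h2.congr fun n => ?_
    simp
  have hTlim : Tendsto (fun n => ∫ s, T n s ∂μ) atTop (𝓝 (∫ s, T' s ∂μ)) :=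
    tendsto_integral_of_dominated_convergence (fun _ => KT)
      (fun n => (hTm n).aestronglyMeasurable) (integrable_const _)
      (fun n => ae_of_all _ fun s => hKT _ (hfB n s))
      (ae_of_all _ fun s => tendsto_integral_transport hζ hc hβ (fun n => hfm n s)
        (fun n => hfB n s) (hflim s) _)
  have hGlim : Tendsto (fun n => ∫ s, G n s ∂μ) atTop (𝓝 (∫ s, G' s ∂μ)) :=
    tendsto_integral_of_dominated_convergence (fun _ => KG)
      (fun n => (hGm n).aestronglyMeasurable) (integrable_const _)
      (fun n => ae_of_all _ fun s => hKG _ (huB n s))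
      (ae_of_all _ fun s => tendsto_cutoffError hη
        (fun n => (hul n s).choose_spec.continuous) (fun n => huB n s) (hulim s))
  have hPi : ∀ n, Integrable (P n) μ := fun n =>
    (hm n).integrable_energyRate hN0 hζ hc hβ hθ hB L σ t
  have hE : ∀ g : Space N → ℝ, Measurable g → (∀ x, |g x| ≤ B) →
      Tendsto (fun n => ∫ x, ζ x ^ 2 * max (β * (smear (m n) g x - L)) 0 ^ 2) atTop
        (𝓝 (∫ x, ζ x ^ 2 * max (β * (g x - L)) 0 ^ 2)) := fun g hg hgB =>
    tendsto_integral_sq_mul_posPart_sq hζ hc hβ (fun n => by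
        obtain ⟨K, hK⟩ := exists_lipschitz_smear (hm n).smooth (hm n).compact hg hgB
        exact hK.continuous.measurable)
      (fun n => (hm n).abs_smear_le hgB) (tendsto_smear hδ hδlim hm hg hgB)
  have hPlim : Tendsto (fun n => ∫ s, P n s ∂μ) atTop
      (𝓝 (1 / 2 * (∫ x, ζ x ^ 2 * max (β * (b x - L)) 0 ^ 2)
        - 1 / 2 * (∫ x, ζ x ^ 2 * max (β * (a x - L)) 0 ^ 2))) := by
    refine (((hE b hb hbB).const_mul (1 / 2)).sub ((hE a ha haB).const_mul (1 / 2))).congr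
      fun n => ?_
    exact (hm n).energy_balance hN0 hζ hc hβ hθ hB hσt ha hb haB hbB (hev n)
  set ea : ℝ := ∫ x, ζ x ^ 2 * max (β * (a x - L)) 0 ^ 2 with hea
  set eb : ℝ := ∫ x, ζ x ^ 2 * max (β * (b x - L)) 0 ^ 2 with heb
  have hQi : ∀ n, Integrable (Q n) μ := fun n => (((hTi n).add (hRi n)).add (hGi n)).sub (hPi n)
  obtain ⟨Y, hY⟩ : ∃ Y, Y = (∫ s, T' s ∂μ) + 0 + (∫ s, G' s ∂μ) - (1 / 2 * eb - 1 / 2 * ea) :=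
    ⟨_, rfl⟩
  have hQlim : Tendsto (fun n => ∫ s, Q n s ∂μ) atTop (𝓝 Y) := by
    rw [hY]
    refine (((hTlim.add hRlim).add hGlim).sub hPlim).congr fun n => ?_
    have h1 : Integrable (fun s => T n s + R n s) μ := (hTi n).add (hRi n)
    have h2 : Integrable (fun s => T n s + R n s + G n s) μ := h1.add (hGi n)
    rw [← integral_add (hTi n) (hRi n), ← integral_add h1 (hGi n), ← integral_sub h2 (hPi n)]
  have hQ0 : ∀ n s, 0 ≤ Q n s := fun n s => (hQd n s).1
  have hY0 : 0 ≤ Y := ge_of_tendsto' hQlim fun n => integral_nonneg (hQ0 n)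
  have hus : ∀ s, Measurable fun x => β * (θ s x - L) := fun s =>
    ((hθs s).sub_const L).const_mul β
  have hD : ∫⁻ s, dissipation η (fun x => β * (θ s x - L)) ∂μ ≤ ENNReal.ofReal Y :=
    lintegral_le_of_le_liminf hQi hQ0 hQlim (ae_of_all _ fun s => by
      have h := dissipation_le_liminf hη (fun n => (hul n s).choose_spec.continuous)
        (fun n => huB n s) (hus s) (abs_mul_sub_le hβ (hB s)) (hulim s)
      simp_rw [fun n => (hQd n s).2] at h
      exact h)
  have hH : ∫⁻ s, hHalfSq (fun x => ζ x * max (β * (θ s x - L)) 0) ∂μ ≤ ENNReal.ofReal Y :=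
    lintegral_le_of_le_liminf hQi hQ0 hQlim (ae_of_all _ fun s => by
      have hζm := hζ.continuous.measurable
      refine (hHalfSq_le_liminf
        (G := fun n x => ζ x * max (β * (smear (m n) (θ s) x - L)) 0) (fun n => ?_) ?_).trans ?_
      · have := hfm n s
        fun_prop
      · filter_upwards [hulim s] with x hx
        have hcont : Continuous fun y : ℝ => ζ x * max y 0 := by fun_prop
        exact (hcont.tendsto _).comp hx
      · refine liminf_le_liminf (Eventually.of_forall fun n => ?_)
        rw [← (hQd n s).2]
        exact hHalfSq_trace_le hN0 hη (hul n s).choose_spec (huB n s))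
  set Kc : ℝ≥0∞ := 2 * N * sobolevConst N * (ENNReal.ofReal |L| + ENNReal.ofReal B) ^ 2 with hKc
  set S : ℝ → ℝ≥0∞ := fun s => ∫⁻ x in B4 N, ENNReal.ofReal
    (‖fderiv ℝ ζ x‖ ^ 2 * max (β * (θ s x - L)) 0 ^ 2) with hS
  have hSm : Measurable S := by
    have h1 : Measurable fun x => fderiv ℝ ζ x := measurable_fderiv ℝ ζ
    have h2 : Measurable fun p : ℝ × Space N => θ p.1 p.2 := hθ
    exact Measurable.lintegral_prod_right' (ν := volume.restrict (B4 N))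
      (f := fun p : ℝ × Space N => ENNReal.ofReal
        (‖fderiv ℝ ζ p.2‖ ^ 2 * max (β * (θ p.1 p.2 - L)) 0 ^ 2)) (by fun_prop)
  have hTle : ENNReal.ofReal |∫ s, T' s ∂μ| ≤
      1 / 2 * ENNReal.ofReal Y + Kc * ∫⁻ s, S s ∂μ := by
    rw [← Real.enorm_eq_ofReal_abs]
    calc ‖∫ s, T' s ∂μ‖ₑ ≤ ∫⁻ s, ‖T' s‖ₑ ∂μ := enorm_integral_le_lintegral_enorm _
      _ ≤ ∫⁻ s, (1 / 2 * hHalfSq (fun x => ζ x * max (β * (θ s x - L)) 0) + Kc * S s) ∂μ := by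
          refine lintegral_mono fun s => ?_
          rw [Real.enorm_eq_ofReal_abs]
          exact abs_integral_transport_le hN hζ (fun x hx => hη.trace_eq_zero hx) hβ (hθs s) (hB s)
      _ = 1 / 2 * (∫⁻ s, hHalfSq (fun x => ζ x * max (β * (θ s x - L)) 0) ∂μ)
            + Kc * ∫⁻ s, S s ∂μ := by
          rw [lintegral_add_right _ (hSm.const_mul _), lintegral_const_mul _ hSm,
            lintegral_const_mul' _ _ (by norm_num)]
      _ ≤ _ := by gcongr
  have hGle : ENNReal.ofReal (∫ s, G' s ∂μ) ≤ ∫⁻ s, (∫⁻ p in B4star N, ENNReal.ofReal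
      (gradSq η p * max (harmonicExt (fun x => β * (θ s x - L)) p) 0 ^ 2)) ∂μ :=
    (ofReal_integral_le fun s => cutoffError_nonneg _ _).trans (lintegral_mono fun s =>
      ofReal_integral_le fun p => mul_nonneg (gradSq_nonneg _ _) (sq_nonneg _))
  rw [← ofReal_integral_eq_lintegral_B4 hη hβ hb hbB,
    ← ofReal_integral_eq_lintegral_B4 hη hβ ha haB]
  refine le_trans ?_ (add_le_add le_rfl hGle)
  have hG0 : 0 ≤ ∫ s, G' s ∂μ := integral_nonneg fun s => cutoffError_nonneg _ _
  have hea0 : 0 ≤ ea := integral_nonneg fun x => by positivity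
  have heb0 : 0 ≤ eb := integral_nonneg fun x => by positivity
  have half : ∀ r : ℝ, 0 ≤ r → 1 / 2 * ENNReal.ofReal r = ENNReal.ofReal (1 / 2 * r) := by
    intro r hr
    rw [ENNReal.ofReal_mul (by norm_num)]
    congr 1
    rw [ENNReal.ofReal_div_of_pos (by norm_num)]
    simp
  rcases eq_or_ne (Kc * ∫⁻ s, S s ∂μ) ⊤ with htop | htop
  · rw [htop]
    simp
  · refine (add_le_add (mul_le_mul_right hD (1 / 2)) le_rfl).trans ?_
    rw [← ENNReal.ofReal_toReal htop] at hTle ⊢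
    have hκ : 0 ≤ (Kc * ∫⁻ s, S s ∂μ).toReal := ENNReal.toReal_nonneg
    rw [half _ hY0, ← ENNReal.ofReal_add (by positivity) hκ,
      ENNReal.ofReal_le_ofReal_iff (by positivity)] at hTle
    rw [half _ hY0, half _ heb0, half _ hea0, ← ENNReal.ofReal_add (by positivity) (by positivity),
      ← ENNReal.ofReal_add (by positivity) hκ, ← ENNReal.ofReal_add (by positivity) hG0]
    refine ENNReal.ofReal_le_ofReal ?_
    have := le_abs_self (∫ s, T' s ∂μ)
    linarith

end Core

/-! ### The fundamental lemma in time -/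

section FundamentalLemma

variable {a b R : ℝ} {f F h : ℝ → ℝ}

lemma locallyIntegrable_of_bdd (hf : Measurable f) (hR : ∀ s, |f s| ≤ R) : LocallyIntegrable f :=
  (locallyIntegrable_const R).mono hf.aestronglyMeasurable
    (ae_of_all _ fun s => (hR s).trans (le_abs_self R))

lemma setIntegral_Icc_eq_integral {g : ℝ → ℝ} (hg : tsupport g ⊆ Ioo a b) (k : ℝ → ℝ) :
    ∫ s in Icc a b, g s * k s = ∫ s, g s * k s := by
  refine setIntegral_eq_integral_of_forall_compl_eq_zero fun s hs => ?_
  have : s ∉ tsupport g := fun h => hs (Ioo_subset_Icc_self (hg h))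
  rw [image_eq_zero_of_notMem_tsupport this, zero_mul]

/-- A function of mean zero with compact support in an interval is the derivative of one. -/
lemma exists_primitive {ψ : ℝ → ℝ} (hψ : ContDiff ℝ (⊤ : ℕ∞) ψ) (hc : HasCompactSupport ψ)
    (hs : tsupport ψ ⊆ Ioo a b) (h0 : ∫ s, ψ s = 0) :
    ∃ χ : ℝ → ℝ, ContDiff ℝ (⊤ : ℕ∞) χ ∧ HasCompactSupport χ ∧ tsupport χ ⊆ Ioo a b ∧
      deriv χ = ψ := by
  rcases (tsupport ψ).eq_empty_or_nonempty with he | hne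
  · have : ψ = 0 := tsupport_eq_empty_iff.mp he
    exact ⟨0, contDiff_const, HasCompactSupport.zero, by simp, by rw [this]; funext; simp⟩
  have hK : IsCompact (tsupport ψ) := hc
  set c := sInf (tsupport ψ)
  set d := sSup (tsupport ψ)
  have hca : a < c := (hs (hK.sInf_mem hne)).1
  have hdb : d < b := (hs (hK.sSup_mem hne)).2
  have hsub : tsupport ψ ⊆ Icc c d := fun s hs' =>
    ⟨csInf_le hK.bddBelow hs', le_csSup hK.bddAbove hs'⟩
  have hd : ∀ s, HasDerivAt (fun s => ∫ r in a..s, ψ r) (ψ s) s := fun s =>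
    intervalIntegral.integral_hasDerivAt_right (hψ.continuous.intervalIntegrable _ _)
      hψ.continuous.stronglyMeasurable.stronglyMeasurableAtFilter hψ.continuous.continuousAt
  have hderiv : deriv (fun s => ∫ r in a..s, ψ r) = ψ := funext fun s => (hd s).deriv
  have hz : ∀ s, s ∉ Icc c d → ∫ r in a..s, ψ r = 0 := by
    intro s hs'
    rw [mem_Icc, not_and_or, not_le, not_le] at hs'
    rcases hs' with h | h
    · refine intervalIntegral.integral_zero_ae (ae_of_all _ fun r hr => ?_)
      refine image_eq_zero_of_notMem_tsupport fun hr' => ?_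
      have h1 := (hsub hr').1
      have h2 := hr.2
      rcases le_max_iff.mp h2 with h3 | h3 <;> linarith
    · rw [intervalIntegral.integral_eq_integral_of_support_subset, h0]
      intro r hr
      have h1 := hsub (subset_tsupport ψ hr)
      exact ⟨hca.trans_le h1.1, h1.2.trans h.le⟩
  have hts : tsupport (fun s => ∫ r in a..s, ψ r) ⊆ Icc c d :=
    closure_minimal (fun s hs' => by
      by_contra h
      exact hs' (hz s h)) isClosed_Icc
  refine ⟨_, contDiff_infty_iff_deriv.mpr ⟨fun s => (hd s).differentiableAt, by rwa [hderiv]⟩,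
    isCompact_Icc.of_isClosed_subset (isClosed_tsupport _) hts,
    hts.trans fun s hs' => ⟨hca.trans_le hs'.1, hs'.2.trans_lt hdb⟩, hderiv⟩

/-- The lemma of du Bois-Reymond. -/
lemma ae_eq_const_of_integral_deriv_mul_eq_zero (hab : a < b) (hh : Measurable h)
    (hR : ∀ s, |h s| ≤ R) (h0 : ∀ χ : ℝ → ℝ, ContDiff ℝ (⊤ : ℕ∞) χ → HasCompactSupport χ →
      tsupport χ ⊆ Ioo a b → ∫ s in Icc a b, deriv χ s * h s = 0) :
    ∃ c, ∀ᵐ s ∂volume.restrict (Icc a b), h s = c := by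
  let β : ContDiffBump ((a + b) / 2) := ⟨(b - a) / 8, (b - a) / 4, by linarith, by linarith⟩
  set ψ₀ : ℝ → ℝ := β.normed volume with hψ₀
  have hs₀ : ContDiff ℝ (⊤ : ℕ∞) ψ₀ := β.contDiff_normed
  have hc₀ : HasCompactSupport ψ₀ := β.hasCompactSupport_normed
  have ht₀ : tsupport ψ₀ ⊆ Ioo a b := by
    rw [hψ₀, β.tsupport_normed_eq, Real.closedBall_eq_Icc]
    have : β.rOut = (b - a) / 4 := rfl
    intro s hs
    rw [this] at hs
    constructor <;> linarith [hs.1, hs.2]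
  have hi₀ : ∫ s, ψ₀ s = 1 := β.integral_normed
  set c : ℝ := ∫ s, ψ₀ s * h s with hc
  have hloc : LocallyIntegrable fun s => h s - c := locallyIntegrable_of_bdd (R := R + |c|)
    (hh.sub_const c) fun s => (abs_sub _ _).trans (add_le_add (hR s) le_rfl)
  have hmul : ∀ g : ℝ → ℝ, Continuous g → HasCompactSupport g →
      Integrable fun s => g s * h s := fun g hg hgc =>
    (hg.integrable_of_hasCompactSupport hgc).mul_bdd (c := R) hh.aestronglyMeasurable
      (ae_of_all _ hR)
  have key : ∀ᵐ s, s ∈ Ioo a b → h s - c = 0 := by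
    refine isOpen_Ioo.ae_eq_zero_of_integral_contDiff_smul_eq_zero
      (hloc.locallyIntegrableOn _) fun g hg hgc hgt => ?_
    have hψ : ContDiff ℝ (⊤ : ℕ∞) fun s => g s - (∫ r, g r) * ψ₀ s :=
      hg.sub (contDiff_const.mul hs₀)
    have hts : tsupport (fun s => g s - (∫ r, g r) * ψ₀ s) ⊆ tsupport g ∪ tsupport ψ₀ := by
      refine closure_minimal (fun s hs => ?_) ((isClosed_tsupport _).union (isClosed_tsupport _))
      by_contra hn
      rw [mem_union, not_or] at hn
      refine hs ?_
      simp only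
      rw [image_eq_zero_of_notMem_tsupport hn.1, image_eq_zero_of_notMem_tsupport hn.2]
      simp
    have hgi : Integrable g := hg.continuous.integrable_of_hasCompactSupport hgc
    have hi0 : Integrable ψ₀ := hs₀.continuous.integrable_of_hasCompactSupport hc₀
    obtain ⟨χ, h1, h2, h3, h4⟩ := exists_primitive (a := a) (b := b) hψ
      ((hgc.isCompact.union hc₀.isCompact).of_isClosed_subset (isClosed_tsupport _) hts)
      (hts.trans (union_subset hgt ht₀)) (by
        rw [integral_sub hgi (hi0.const_mul _), integral_const_mul, hi₀]
        ring)
    have h5 := h0 χ h1 h2 h3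
    rw [h4, setIntegral_Icc_eq_integral (hts.trans (union_subset hgt ht₀))] at h5
    have e1 : ∀ s, (g s - (∫ r, g r) * ψ₀ s) * h s = g s * h s - (∫ r, g r) * (ψ₀ s * h s) :=
      fun s => by ring
    simp_rw [e1] at h5
    rw [integral_sub (hmul g hg.continuous hgc) ((hmul ψ₀ hs₀.continuous hc₀).const_mul _),
      integral_const_mul, ← hc] at h5
    simp_rw [smul_eq_mul, mul_sub]
    rw [integral_sub (hmul g hg.continuous hgc) (hgi.mul_const c), integral_mul_const]
    exact h5
  refine ⟨c, ?_⟩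
  rw [← restrict_Ioo_eq_restrict_Icc, ae_restrict_iff' measurableSet_Ioo]
  filter_upwards [key] with s hs hs'
  linarith [hs hs']

lemma integral_mul_eq_neg_integral_deriv_mul_primitive (hab : a ≤ b) (hF : Measurable F)
    (hR : ∀ s, |F s| ≤ R) {χ : ℝ → ℝ} (hχ : ContDiff ℝ (⊤ : ℕ∞) χ) (hc : HasCompactSupport χ)
    (hs : tsupport χ ⊆ Ioo a b) :
    ∫ s in Icc a b, χ s * F s = - ∫ s in Icc a b, deriv χ s * ∫ r in a..s, F r := by
  have hloc := locallyIntegrable_of_bdd hF hR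
  have hint : IntervalIntegrable F volume a b := intervalIntegrable_iff.mpr
    ((hloc.integrableOn_isCompact isCompact_uIcc).mono_set uIoc_subset_uIcc)
  obtain ⟨K, hK⟩ := ContDiff.lipschitzWith_of_hasCompactSupport hc hχ (by simp)
  have h1 := (hK.lipschitzOnWith (s := uIcc a b)).absolutelyContinuousOnInterval
  have h2 := hint.absolutelyContinuousOnInterval_intervalIntegral (c := a) left_mem_uIcc
  have h3 := h1.integral_mul_deriv_eq_deriv_mul h2
  have hχa : χ a = 0 := image_eq_zero_of_notMem_tsupport fun h => lt_irrefl _ (hs h).1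
  have hχb : χ b = 0 := image_eq_zero_of_notMem_tsupport fun h => lt_irrefl _ (hs h).2
  rw [hχa, hχb, zero_mul, zero_mul, sub_zero, zero_sub, intervalIntegral.integral_of_le hab,
    intervalIntegral.integral_of_le hab] at h3
  rw [integral_Icc_eq_integral_Ioc, integral_Icc_eq_integral_Ioc, ← h3]
  refine integral_congr_ae (ae_restrict_of_ae ?_)
  filter_upwards [LocallyIntegrable.ae_hasDerivAt_integral hloc] with s hs'
  rw [(hs' a).deriv]

/-- A bounded function whose weak derivative is bounded is a primitive of it. -/
lemma exists_ae_eq_const_add_primitive (hab : a < b) (hf : Measurable f) (hF : Measurable F)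
    (hR : ∀ s, |f s| ≤ R) (hR' : ∀ s, |F s| ≤ R)
    (hw : ∀ χ : ℝ → ℝ, ContDiff ℝ (⊤ : ℕ∞) χ → HasCompactSupport χ →
      tsupport χ ⊆ Ioo a b → ∫ s in Icc a b, (deriv χ s * f s + χ s * F s) = 0) :
    ∃ c, ∀ᵐ s ∂volume.restrict (Icc a b), f s = c + ∫ r in a..s, F r := by
  have hR0 : 0 ≤ R := (abs_nonneg _).trans (hR a)
  have hloc := locallyIntegrable_of_bdd hF hR'
  have hint : ∀ c d, IntervalIntegrable F volume c d := fun c d => intervalIntegrable_iff.mpr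
    ((hloc.integrableOn_isCompact isCompact_uIcc).mono_set uIoc_subset_uIcc)
  set Φ : ℝ → ℝ := fun s => ∫ r in a..s, F r with hΦ
  have hΦc : Continuous Φ := intervalIntegral.continuous_primitive hint a
  set p : ℝ → ℝ := fun s => max a (min b s) with hp
  have hpm : ∀ s ∈ Icc a b, p s = s := fun s hs => by
    rw [hp]
    simp only
    rw [min_eq_right hs.2, max_eq_right hs.1]
  have hΦb : ∀ s, |Φ (p s)| ≤ R * |b - a| := fun s => by
    refine (intervalIntegral.norm_integral_le_of_norm_le_const (f := F) fun x _ => hR' x).trans ?_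
    have h1 : a ≤ p s := le_max_left _ _
    have h2 : p s ≤ b := max_le hab.le (min_le_left _ _)
    gcongr
  obtain ⟨c, hc⟩ := ae_eq_const_of_integral_deriv_mul_eq_zero (h := fun s => f s - Φ (p s))
    (R := R + R * |b - a|) hab
    (hf.sub ((hΦc.comp (by fun_prop)).measurable))
    (fun s => (abs_sub _ _).trans (add_le_add (hR s) (hΦb s))) fun χ hχ hcs hts => by
      have h1 := hw χ hχ hcs hts
      have h2 := integral_mul_eq_neg_integral_deriv_mul_primitive hab.le hF hR' hχ hcs hts
      have hd : Integrable (deriv χ) (volume.restrict (Icc a b)) :=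
        ((hχ.continuous_deriv (by simp)).integrable_of_hasCompactSupport hcs.deriv).integrableOn
      have i1 : Integrable (fun s => deriv χ s * f s) (volume.restrict (Icc a b)) :=
        hd.mul_bdd (c := R) hf.aestronglyMeasurable (ae_of_all _ hR)
      have i2 : Integrable (fun s => χ s * F s) (volume.restrict (Icc a b)) :=
        (hχ.continuous.integrable_of_hasCompactSupport hcs).integrableOn.mul_bdd (c := R)
          hF.aestronglyMeasurable (ae_of_all _ hR')
      have i3 : Integrable (fun s => deriv χ s * Φ (p s)) (volume.restrict (Icc a b)) :=
        hd.mul_bdd (c := R * |b - a|) (hΦc.comp (by fun_prop)).aestronglyMeasurable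
          (ae_of_all _ hΦb)
      have e : ∫ s in Icc a b, deriv χ s * Φ (p s) = ∫ s in Icc a b, deriv χ s * Φ s :=
        setIntegral_congr_fun measurableSet_Icc fun s hs => by
          rw [hpm s hs]
      rw [integral_add i1 i2, h2, ← e] at h1
      simp_rw [mul_sub]
      rw [integral_sub i1 i3]
      linarith
  refine ⟨c, ?_⟩
  filter_upwards [hc, ae_restrict_mem measurableSet_Icc] with s hs hs'
  rw [hpm s hs'] at hs
  linarith

end FundamentalLemma

/-! ### The mollified equation -/

section MollifiedEquation

variable {a b B C δ σ t : ℝ} {θ θ' : ℝ → Space N → ℝ} {m f : Space N → ℝ}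

lemma fderiv_const_mul_comp_sub (hm : ContDiff ℝ (⊤ : ℕ∞) m) (c : ℝ) (x y v : Space N) :
    fderiv ℝ (fun y => c * m (x - y)) y v = -(c * fderiv ℝ m (x - y) v) := by
  have h := (hm.differentiable (by simp) (x - y)).hasFDerivAt.comp y
    ((hasFDerivAt_id y).const_sub x)
  have h2 : HasFDerivAt (fun y => c * m (x - y)) _ y := h.const_mul c
  rw [h2.fderiv]
  simp

lemma halfLaplacian_const_mul (c : ℝ) (g : Space N → ℝ) (x : Space N) :
    halfLaplacian (fun y => c * g y) x = c * halfLaplacian g x := by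
  have e : ∀ y, (2 * (c * g x) - c * g (x + y) - c * g (x - y)) / ‖y‖ ^ (N + 1) =
      c * ((2 * g x - g (x + y) - g (x - y)) / ‖y‖ ^ (N + 1)) := fun y => by ring
  simp only [halfLaplacian, e]
  rw [integral_const_mul]
  ring

/-- The weak formulation, tested with a product. -/
lemma integral_test_eq (hN : 0 < N) (hm : ContDiff ℝ (⊤ : ℕ∞) m) (hc : HasCompactSupport m)
    (hf : Measurable f) (hB : ∀ x, |f x| ≤ B) (x : Space N) (c c' : ℝ) :
    ∫ y, (f y * (c' * m (x - y)) + f y ^ 2 / 2 *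
        ∑ j : Fin N, fderiv ℝ (fun y => c * m (x - y)) y (EuclideanSpace.single j 1)
        - f y * halfLaplacian (fun y => c * m (x - y)) y)
      = c' * smear m f x + c * smearedFlux m f x := by
  have e : ∀ y, f y * (c' * m (x - y)) + f y ^ 2 / 2 *
        ∑ j : Fin N, fderiv ℝ (fun y => c * m (x - y)) y (EuclideanSpace.single j 1)
        - f y * halfLaplacian (fun y => c * m (x - y)) y
      = c' * (m (x - y) * f y) - c / 2 * (f y ^ 2 * fderiv ℝ m (x - y) (diag N))
        - c * (f y * halfLaplacian (fun y => m (x - y)) y) := by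
    intro y
    rw [← map_sum, ← diag, fderiv_const_mul_comp_sub hm, halfLaplacian_const_mul]
    ring
  have i1 : Integrable fun y => c' * (m (x - y) * f y) :=
    (integrable_kernel_mul (integrable_of_smooth hm hc) hf hB x).const_mul c'
  have i2 : Integrable fun y => c / 2 * (f y ^ 2 * fderiv ℝ m (x - y) (diag N)) := by
    have := integrable_smul_fderiv hm hc (hf.pow_const 2) (abs_sq_le hB) x
    exact (this.apply_continuousLinearMap (diag N)).const_mul (c / 2)
  have i3 := (integrable_mul_halfLaplacian_comp hN hm hc hf hB x).const_mul c
  have i4 : Integrable fun y => c' * (m (x - y) * f y)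
    - c / 2 * (f y ^ 2 * fderiv ℝ m (x - y) (diag N)) := i1.sub i2
  simp_rw [e]
  rw [integral_sub i4 i3, integral_sub i1 i2, integral_const_mul, integral_const_mul,
    integral_const_mul, integral_mul_halfLaplacian_comp hN hm hc hf hB x, smearedFlux,
    fderiv_smear_apply hm hc (hf.pow_const 2) (abs_sq_le hB), smear]
  ring

lemma IsWeakSolution.integral_smear_eq_zero (hN : 0 < N) (hθ : IsWeakSolution a b θ)
    (hθ' : Measurable (Function.uncurry θ')) (hB : ∀ s x, |θ' s x| ≤ B)
    (hae : ∀ᵐ s ∂volume.restrict (Icc a b), θ s =ᵐ[volume] θ' s)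
    (hm : ContDiff ℝ (⊤ : ℕ∞) m) (hc : HasCompactSupport m) (x : Space N) {χ : ℝ → ℝ}
    (hχ : ContDiff ℝ (⊤ : ℕ∞) χ) (hχc : HasCompactSupport χ) (hχs : tsupport χ ⊆ Ioo a b) :
    ∫ s in Icc a b, (deriv χ s * smear m (θ' s) x + χ s * smearedFlux m (θ' s) x) = 0 := by
  obtain ⟨r, hr0, hr⟩ := exists_support_radius hc
  have hsub : tsupport (fun p : ℝ × Space N => χ p.1 * m (x - p.2)) ⊆
      tsupport χ ×ˢ Metric.closedBall x r := by
    refine closure_minimal (fun p hp => ?_)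
      ((isClosed_tsupport _).prod Metric.isClosed_closedBall)
    have hp' : χ p.1 * m (x - p.2) ≠ 0 := hp
    refine ⟨subset_tsupport χ (left_ne_zero_of_mul hp'), ?_⟩
    by_contra h
    rw [mem_closedBall_iff_norm', not_le] at h
    exact right_ne_zero_of_mul hp' (hr _ h)
  have h := hθ.weak_eq (fun p => χ p.1 * m (x - p.2))
    ((hχ.comp contDiff_fst).mul (hm.comp (contDiff_const.sub contDiff_snd)))
    ((hχc.isCompact.prod (isCompact_closedBall x r)).of_isClosed_subset (isClosed_tsupport _) hsub)
    (hsub.trans (prod_mono hχs (subset_univ _)))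
  rw [← h]
  refine integral_congr_ae ?_
  filter_upwards [hae] with s hs
  rw [← integral_test_eq hN hm hc hθ'.of_uncurry_left (hB s) x (χ s) (deriv χ s)]
  refine integral_congr_ae ?_
  filter_upwards [hs] with y hy
  have hd : deriv (fun s => χ s * m (x - y)) s = deriv χ s * m (x - y) :=
    deriv_mul_const (hχ.differentiable (by simp) s) _
  simp only [hd, hy]

/-- The mollified equation in integrated form. -/
lemma IsWeakSolution.exists_smear_eq (hN : 0 < N) (hab : a < b) (hθ : IsWeakSolution a b θ)
    (hθ' : Measurable (Function.uncurry θ')) (hB : ∀ s x, |θ' s x| ≤ B)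
    (hae : ∀ᵐ s ∂volume.restrict (Icc a b), θ s =ᵐ[volume] θ' s) (hm : IsMollifier C δ m) :
    ∃ c : Space N → ℝ,
      (∀ x, ∀ᵐ s ∂volume.restrict (Icc a b),
        smear m (θ' s) x = c x + ∫ r in a..s, smearedFlux m (θ' r) x) ∧
      ∀ᵐ s ∂volume.restrict (Icc a b), ∀ᵐ x,
        smear m (θ' s) x = c x + ∫ r in a..s, smearedFlux m (θ' r) x := by
  obtain ⟨R, hR⟩ := hm.exists_abs_smearedFlux_le hN B
  have hF := hm.measurable_smearedFlux hθ' hB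
  have hS := measurable_smear hm.smooth.continuous.measurable hθ'
  have hSu : Measurable (Function.uncurry fun s x => smear m (θ' s) x) := hS
  set Φ : ℝ → Space N → ℝ := fun s x =>
    ∫ r in Ioc a b, (Iic s).indicator (fun r => smearedFlux m (θ' r) x) r with hΦ
  have hΦm : Measurable fun p : ℝ × Space N => Φ p.1 p.2 := by
    refine (StronglyMeasurable.integral_prod_right (ν := volume.restrict (Ioc a b))
      (f := fun (p : ℝ × Space N) r =>
        (Iic p.1).indicator (fun r => smearedFlux m (θ' r) p.2) r)
      (Measurable.stronglyMeasurable ?_)).measurable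
    have : (Function.uncurry fun (p : ℝ × Space N) r =>
        (Iic p.1).indicator (fun r => smearedFlux m (θ' r) p.2) r) =
        fun q : (ℝ × Space N) × ℝ =>
          if q.2 ≤ q.1.1 then smearedFlux m (θ' q.2) q.1.2 else 0 := by
      funext q
      simp [Function.uncurry, indicator]
    rw [this]
    refine Measurable.ite (measurableSet_le (by fun_prop) (by fun_prop)) ?_ measurable_const
    exact hF.comp (f := fun q : (ℝ × Space N) × ℝ => (q.2, q.1.2)) (by fun_prop)
  have hΦe : ∀ s ∈ Icc a b, ∀ x, Φ s x = ∫ r in a..s, smearedFlux m (θ' r) x := by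
    intro s hs x
    rw [hΦ, intervalIntegral.integral_of_le hs.1]
    simp only
    rw [setIntegral_indicator measurableSet_Iic]
    congr 2
    ext r
    simp only [mem_inter_iff, mem_Ioc, mem_Iic]
    exact ⟨fun h => ⟨h.1.1, h.2⟩, fun h => ⟨⟨h.1, h.2.trans hs.2⟩, h.2⟩⟩
  set c : Space N → ℝ := fun x =>
    (b - a)⁻¹ * ∫ s in Icc a b, (smear m (θ' s) x - Φ s x) with hcdef
  have hcm : Measurable c := by
    refine Measurable.const_mul (StronglyMeasurable.integral_prod_left'
      (μ := volume.restrict (Icc a b)) (f := fun p : ℝ × Space N =>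
        smear m (θ' p.1) p.2 - Φ p.1 p.2) ?_).measurable _
    exact (hS.sub hΦm).stronglyMeasurable
  have h1 : ∀ x, ∀ᵐ s ∂volume.restrict (Icc a b), smear m (θ' s) x = c x + Φ s x := by
    intro x
    obtain ⟨k, hk⟩ := exists_ae_eq_const_add_primitive (R := max B R) hab
      (hSu.of_uncurry_right (y := x)) (hF.of_uncurry_right (y := x))
      (fun s => (hm.abs_smear_le (hB s) x).trans (le_max_left _ _))
      (fun s => (hR _ hθ'.of_uncurry_left (hB s) x).trans (le_max_right _ _))
      fun χ h1 h2 h3 => hθ.integral_smear_eq_zero hN hθ' hB hae hm.smooth hm.compact x h1 h2 h3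
    have hk' : ∀ᵐ s ∂volume.restrict (Icc a b), smear m (θ' s) x - Φ s x = k := by
      filter_upwards [hk, ae_restrict_mem measurableSet_Icc] with s hs hs'
      rw [hs, hΦe s hs' x]
      ring
    have hck : c x = k := by
      have hba : b - a ≠ 0 := by linarith
      simp only [hcdef]
      rw [integral_congr_ae hk', setIntegral_const, Real.volume_real_Icc_of_le hab.le]
      field_simp
      rw [smul_eq_mul]
    filter_upwards [hk'] with s hs
    linarith
  refine ⟨c, fun x => ?_, ?_⟩
  · filter_upwards [h1 x, ae_restrict_mem measurableSet_Icc] with s hs hs'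
    rw [hs, hΦe s hs' x]
  · have h2 := (Measure.ae_ae_comm (μ := volume) (ν := volume.restrict (Icc a b))
      (p := fun x s => smear m (θ' s) x = c x + Φ s x) ?_).mp (ae_of_all _ h1)
    · filter_upwards [h2, ae_restrict_mem measurableSet_Icc] with s hs hs'
      filter_upwards [hs] with x hx
      rw [hx, hΦe s hs' x]
    · exact measurableSet_eq_fun (hS.comp measurable_swap)
        ((hcm.comp measurable_fst).add (hΦm.comp measurable_swap))

lemma evolves_of_smear_eq (hN : 0 < N) (hθ' : Measurable (Function.uncurry θ'))
    (hB : ∀ s x, |θ' s x| ≤ B) (hm : IsMollifier C δ m) {c : Space N → ℝ}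
    (hc : ∀ x, ∀ᵐ s ∂volume.restrict (Icc a b),
        smear m (θ' s) x = c x + ∫ r in a..s, smearedFlux m (θ' r) x)
    (hσ : σ ∈ Icc a b) (ht : t ∈ Icc a b) {g h : Space N → ℝ}
    (hg : ∀ᵐ x, smear m g x = c x + ∫ r in a..σ, smearedFlux m (θ' r) x)
    (hh : ∀ᵐ x, smear m h x = c x + ∫ r in a..t, smearedFlux m (θ' r) x) :
    Evolves m θ' σ t g h := by
  obtain ⟨R, hR⟩ := hm.exists_abs_smearedFlux_le hN B
  have hF := hm.measurable_smearedFlux hθ' hB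
  filter_upwards [hg, hh] with x hgx hhx
  have hloc : LocallyIntegrable fun r => smearedFlux m (θ' r) x :=
    locallyIntegrable_of_bdd (hF.of_uncurry_right (y := x))
      (fun s => hR _ hθ'.of_uncurry_left (hB s) x)
  have hint : ∀ c d, IntervalIntegrable (fun r => smearedFlux m (θ' r) x) volume c d :=
    fun c d => intervalIntegrable_iff.mpr
      ((hloc.integrableOn_isCompact isCompact_uIcc).mono_set uIoc_subset_uIcc)
  have key : ∀ s, (∫ r in a..σ, smearedFlux m (θ' r) x) + ∫ r in σ..s, smearedFlux m (θ' r) x =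
      ∫ r in a..s, smearedFlux m (θ' r) x := fun s =>
    intervalIntegral.integral_add_adjacent_intervals (hint _ _) (hint _ _)
  refine ⟨?_, ?_⟩
  · have hsub : Ioc σ t ⊆ Icc a b := fun s hs => ⟨hσ.1.trans hs.1.le, hs.2.trans ht.2⟩
    filter_upwards [ae_restrict_of_ae_restrict_of_subset hsub (hc x)] with s hs
    rw [hs, hgx, add_assoc, key]
  · rw [hhx, hgx, add_assoc, key]

end MollifiedEquation

/-! ### Bounded representatives -/

section Representatives

variable {a b M : ℝ} {θ : ℝ → Space N → ℝ} {g g' : Space N → ℝ} {η : Space N × ℝ → ℝ}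

lemma exists_measurable_abs_le {α : Type*} [MeasurableSpace α] {μ : Measure α} {f : α → ℝ}
    (hf : AEStronglyMeasurable f μ) (hM : 0 ≤ M) (h : ∀ᵐ x ∂μ, |f x| ≤ M) :
    ∃ g : α → ℝ, Measurable g ∧ (∀ x, |g x| ≤ M) ∧ f =ᵐ[μ] g := by
  refine ⟨fun x => max (-M) (min M (hf.mk f x)), ?_, fun x => ?_, ?_⟩
  · exact measurable_const.max (measurable_const.min hf.stronglyMeasurable_mk.measurable)
  · exact abs_le.mpr ⟨le_max_left _ _, max_le (by linarith) (min_le_left _ _)⟩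
  · filter_upwards [h, hf.ae_eq_mk] with x hx hx'
    rw [← hx', min_eq_right (abs_le.mp hx).2, max_eq_right (abs_le.mp hx).1]

lemma exists_bounded_representative
    (hθ : AEStronglyMeasurable (Function.uncurry θ) (volume.restrict (Icc a b ×ˢ univ)))
    (hbdd : supNorm a b θ < ⊤) :
    ∃ θ' : ℝ → Space N → ℝ, Measurable (Function.uncurry θ') ∧
      (∀ s x, |θ' s x| ≤ (supNorm a b θ).toReal) ∧
      ∀ᵐ s ∂volume.restrict (Icc a b), θ s =ᵐ[volume] θ' s := by
  have h : ∀ᵐ p ∂(volume.restrict (Icc a b ×ˢ univ) : Measure (ℝ × Space N)),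
      |Function.uncurry θ p| ≤ (supNorm a b θ).toReal := by
    have := ae_le_eLpNormEssSup (f := Function.uncurry θ)
      (μ := (volume.restrict (Icc a b ×ˢ univ) : Measure (ℝ × Space N)))
    filter_upwards [this] with p hp
    rw [← eLpNorm_exponent_top] at hp
    have h2 := ENNReal.toReal_mono hbdd.ne hp
    simpa using h2
  obtain ⟨G, h1, h2, h3⟩ := exists_measurable_abs_le hθ ENNReal.toReal_nonneg h
  refine ⟨fun s x => G (s, x), h1, fun s x => h2 _, ?_⟩
  rw [Measure.volume_eq_prod, ← Measure.prod_restrict, Measure.restrict_univ] at h3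
  exact Measure.ae_ae_of_ae_prod h3

lemma harmonicExt_congr_ae (h : g =ᵐ[volume] g') {p : Space N × ℝ} (hz : 0 < p.2) :
    harmonicExt g p = harmonicExt g' p := by
  rw [harmonicExt_of_pos g hz, harmonicExt_of_pos g' hz]
  refine integral_congr_ae ?_
  filter_upwards [h] with y hy
  rw [hy]

lemma gradSq_posPart_congr_ae (h : g =ᵐ[volume] g') {p : Space N × ℝ} (hz : 0 < p.2) :
    gradSq (fun q => η q * max (harmonicExt g q) 0) p =
      gradSq (fun q => η q * max (harmonicExt g' q) 0) p := by
  have h1 : (fun x => η (x, p.2) * max (harmonicExt g (x, p.2)) 0) =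
      fun x => η (x, p.2) * max (harmonicExt g' (x, p.2)) 0 := by
    funext x
    rw [harmonicExt_congr_ae h (p := (x, p.2)) hz]
  have h2 : (fun z => η (p.1, z) * max (harmonicExt g (p.1, z)) 0) =ᶠ[𝓝 p.2]
      fun z => η (p.1, z) * max (harmonicExt g' (p.1, z)) 0 := by
    filter_upwards [lt_mem_nhds hz] with z hz'
    rw [harmonicExt_congr_ae h (p := (p.1, z)) hz']
  simp only [gradSq]
  rw [h1, h2.deriv_eq]

lemma ae_B4star_height_pos : ∀ᵐ p ∂volume.restrict (B4star N), 0 < p.2 := by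
  filter_upwards [ae_restrict_mem (isClosed_B4star N).measurableSet,
    ae_restrict_of_ae ae_height_ne_zero] with p hp hp'
  exact lt_of_le_of_ne hp.2.1 hp'.symm

lemma dissipation_congr_ae (h : g =ᵐ[volume] g') : dissipation η g = dissipation η g' := by
  refine lintegral_congr_ae ?_
  filter_upwards [ae_B4star_height_pos] with p hp
  rw [gradSq_posPart_congr_ae h hp]

lemma hHalfSq_congr_ae (h : g =ᵐ[volume] g') : hHalfSq g = hHalfSq g' := by
  unfold hHalfSq
  congr 1
  refine lintegral_congr_ae ?_
  filter_upwards [h] with x hx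
  refine lintegral_congr_ae ?_
  filter_upwards [h] with y hy
  rw [hx, hy]

/-- The local energy inequality depends only on the equivalence classes of the solution and of
its values at the two end points. -/
lemma localEnergyInequality_of_ae_eq {u u' : ℝ → Space N → ℝ} {K : ℝ≥0∞} {σ t : ℝ}
    (h : ∀ᵐ s ∂volume.restrict (Ioc σ t), u s =ᵐ[volume] u' s) {v w : Space N → ℝ}
    (hv : u σ =ᵐ[volume] v) (hw : u t =ᵐ[volume] w)
    (hE : 1 / 2 * (∫⁻ s in Ioc σ t, dissipation η (u' s))
      + 1 / 2 * (∫⁻ x in B4 N, ENNReal.ofReal ((η (x, 0) * max (w x) 0) ^ 2))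
      ≤ 1 / 2 * (∫⁻ x in B4 N, ENNReal.ofReal ((η (x, 0) * max (v x) 0) ^ 2))
        + K * (∫⁻ s in Ioc σ t, ∫⁻ x in B4 N,
            ENNReal.ofReal (‖fderiv ℝ (fun y => η (y, 0)) x‖ ^ 2 * max (u' s x) 0 ^ 2))
        + ∫⁻ s in Ioc σ t, ∫⁻ p in B4star N,
            ENNReal.ofReal (gradSq η p * max (harmonicExt (u' s) p) 0 ^ 2)) :
    LocalEnergyInequality u η K σ t := by
  have e1 : ∫⁻ s in Icc σ t, ∫⁻ p in B4star N,
      ENNReal.ofReal (gradSq (fun q => η q * max (harmonicExt (u s) q) 0) p) =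
      ∫⁻ s in Ioc σ t, dissipation η (u' s) := by
    rw [setLIntegral_congr Ioc_ae_eq_Icc.symm]
    refine lintegral_congr_ae ?_
    filter_upwards [h] with s hs
    exact dissipation_congr_ae hs
  have e2 : ∀ {f f' : Space N → ℝ}, f =ᵐ[volume] f' →
      ∫⁻ x in B4 N, ENNReal.ofReal ((η (x, 0) * max (f x) 0) ^ 2) =
      ∫⁻ x in B4 N, ENNReal.ofReal ((η (x, 0) * max (f' x) 0) ^ 2) := by
    intro f f' hf
    refine lintegral_congr_ae ?_
    filter_upwards [ae_restrict_of_ae hf] with x hx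
    rw [hx]
  have e3 : ∫⁻ s in Icc σ t, ∫⁻ x in B4 N,
      ENNReal.ofReal (‖fderiv ℝ (fun y => η (y, 0)) x‖ ^ 2 * max (u s x) 0 ^ 2) =
      ∫⁻ s in Ioc σ t, ∫⁻ x in B4 N,
      ENNReal.ofReal (‖fderiv ℝ (fun y => η (y, 0)) x‖ ^ 2 * max (u' s x) 0 ^ 2) := by
    rw [setLIntegral_congr Ioc_ae_eq_Icc.symm]
    refine lintegral_congr_ae ?_
    filter_upwards [h] with s hs
    refine lintegral_congr_ae ?_
    filter_upwards [ae_restrict_of_ae hs] with x hx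
    rw [hx]
  have e4 : ∫⁻ s in Icc σ t, ∫⁻ p in B4star N,
      ENNReal.ofReal (gradSq η p * max (harmonicExt (u s) p) 0 ^ 2) =
      ∫⁻ s in Ioc σ t, ∫⁻ p in B4star N,
      ENNReal.ofReal (gradSq η p * max (harmonicExt (u' s) p) 0 ^ 2) := by
    rw [setLIntegral_congr Ioc_ae_eq_Icc.symm]
    refine lintegral_congr_ae ?_
    filter_upwards [h] with s hs
    refine lintegral_congr_ae ?_
    filter_upwards [ae_B4star_height_pos] with p hp
    rw [harmonicExt_congr_ae hs hp]
  rw [LocalEnergyInequality, e1, e2 hw, e2 hv, e3, e4]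
  exact hE

end Representatives

/-! ### Admissible times -/

section Times

variable {a b B C σ t : ℝ} {θ θ' : ℝ → Space N → ℝ} {δ : ℕ → ℝ} {m c : ℕ → Space N → ℝ}

/-- The function `f` is bounded by `B` and is attained at time `t` by the mollified equations. -/
def IsValueAt (m c : ℕ → Space N → ℝ) (θ' : ℝ → Space N → ℝ) (a B t : ℝ) (f : Space N → ℝ) :
    Prop :=
  ∃ g : Space N → ℝ, Measurable g ∧ (∀ x, |g x| ≤ B) ∧ f =ᵐ[volume] g ∧
    ∀ n, ∀ᵐ x, smear (m n) g x = c n x + ∫ r in a..t, smearedFlux (m n) (θ' r) x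

lemma localEnergyInequality_of_isValueAt (hN : 2 ≤ N) (hθ : IsWeakSolution a b θ)
    (hθ' : Measurable (Function.uncurry θ')) (hB : ∀ s x, |θ' s x| ≤ B)
    (hae : ∀ᵐ s ∂volume.restrict (Icc a b), θ s =ᵐ[volume] θ' s)
    (hδ : ∀ n, 0 < δ n) (hδ1 : ∀ n, δ n ≤ 1) (hδlim : Tendsto δ atTop (𝓝 0))
    (hm : ∀ n, IsMollifier C (δ n) (m n))
    (hc : ∀ n x, ∀ᵐ s ∂volume.restrict (Icc a b),
        smear (m n) (θ' s) x = c n x + ∫ r in a..s, smearedFlux (m n) (θ' r) x)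
    (hσ : σ ∈ Icc a b) (ht : t ∈ Icc a b) (hσt : σ ≤ t)
    (hvσ : IsValueAt m c θ' a B σ (θ σ)) (hvt : IsValueAt m c θ' a B t (θ t))
    {β : ℝ} (hβ : 0 ≤ β) (L : ℝ) {η : Space N × ℝ → ℝ} (hη : IsCutoff η) :
    LocalEnergyInequality (fun s x => β * (θ s x - L)) η
      (2 * N * sobolevConst N * (ENNReal.ofReal |L| + ENNReal.ofReal B) ^ 2) σ t := by
  obtain ⟨v, hv, hvB, hve, hvs⟩ := hvσ
  obtain ⟨w, hw, hwB, hwe, hws⟩ := hvt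
  have hsub : Ioc σ t ⊆ Icc a b := fun s hs => ⟨hσ.1.trans hs.1.le, hs.2.trans ht.2⟩
  have hae' := ae_restrict_of_ae_restrict_of_subset hsub hae
  have haff : ∀ {f f' : Space N → ℝ}, f =ᵐ[volume] f' →
      (fun x => β * (f x - L)) =ᵐ[volume] fun x => β * (f' x - L) := by
    intro f f' hf
    filter_upwards [hf] with x hx
    rw [hx]
  have hfin : ∫⁻ s in Ioc σ t, hHalfSq (θ' s) ≠ ⊤ := by
    have e : ∫⁻ s in Ioc σ t, hHalfSq (θ' s) = ∫⁻ s in Ioc σ t, hHalfSq (θ s) := by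
      refine lintegral_congr_ae ?_
      filter_upwards [hae'] with s hs
      exact (hHalfSq_congr_ae hs).symm
    rw [e]
    exact ((lintegral_mono_set hsub).trans_lt hθ.finite_dissipation).ne
  refine localEnergyInequality_of_ae_eq (hae'.mono fun s hs => haff hs) (haff hve) (haff hwe) ?_
  exact local_energy_inequality_of_evolves hN hθ' hB hσt hfin hv hw hvB hwB hδ hδ1 hδlim hm
    (fun n => evolves_of_smear_eq (by omega) hθ' hB (hm n) (hc n) hσ ht (hvs n) (hws n))
    hη hβ L

end Times

/-! ### Weakly continuous solutions -/

section WeakContinuity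

variable {a b B C σ t : ℝ} {θ θ' : ℝ → Space N → ℝ} {δ : ℕ → ℝ} {m c : ℕ → Space N → ℝ}

lemma le_on_Icc_of_ae_le (hab : a < b) {F : ℝ → ℝ} (hF : ContinuousOn F (Icc a b))
    (h : ∀ᵐ s ∂volume.restrict (Icc a b), F s ≤ B) (ht : t ∈ Icc a b) : F t ≤ B := by
  have e := Measure.eqOn_Icc_of_ae_eq (μ := volume) hab.ne (f := fun s => min (F s) B) (g := F)
    (h.mono fun s hs => min_eq_left hs) (hF.inf continuousOn_const) hF ht
  exact min_eq_left_iff.mp e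

lemma WeaklyContinuous.abs_setIntegral_le (hw : WeaklyContinuous a b θ) (hab : a < b)
    (hB : ∀ s x, |θ' s x| ≤ B)
    (hae : ∀ᵐ s ∂volume.restrict (Icc a b), θ s =ᵐ[volume] θ' s) (ht : t ∈ Icc a b)
    {A : Set (Space N)} (hA : MeasurableSet A) (hfin : volume A < ⊤) :
    |∫ x in A, θ t x| ≤ B * volume.real A := by
  have e : ∀ s, ∫ x in A, θ s x = ∫ x, θ s x * A.indicator (fun _ => (1 : ℝ)) x := by
    intro s
    rw [← integral_indicator hA]
    congr 1
    funext x
    by_cases hx : x ∈ A <;> simp [hx]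
  have hcont := hw.2 _ (memLp_indicator_const 2 hA (1 : ℝ) (Or.inr hfin.ne))
  simp_rw [← e] at hcont
  refine le_on_Icc_of_ae_le (F := fun s => |∫ x in A, θ s x|) hab hcont.abs ?_ ht
  filter_upwards [hae] with s hs
  rw [← Real.norm_eq_abs]
  refine norm_setIntegral_le_of_norm_le_const_ae (f := θ s) hfin (ae_restrict_of_ae ?_)
  filter_upwards [hs] with x hx
  rw [hx]
  exact hB s x

lemma WeaklyContinuous.ae_abs_le (hw : WeaklyContinuous a b θ) (hab : a < b)
    (hB : ∀ s x, |θ' s x| ≤ B)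
    (hae : ∀ᵐ s ∂volume.restrict (Icc a b), θ s =ᵐ[volume] θ' s) (ht : t ∈ Icc a b) :
    ∀ᵐ x, |θ t x| ≤ B := by
  have hint : ∀ A : Set (Space N), MeasurableSet A → volume A < ⊤ →
      IntegrableOn (θ t) A := by
    intro A _ hfin
    have : IsFiniteMeasure (volume.restrict A) := ⟨by simpa using hfin⟩
    exact (MemLp.restrict A (hw.1 t ht)).integrable one_le_two
  have hconst : ∀ A : Set (Space N), volume A < ⊤ → IntegrableOn (fun _ => B) A :=
    fun A hfin => integrableOn_const hfin.ne
  have h1 : 0 ≤ᵐ[volume] fun x => B - θ t x := by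
    refine ae_nonneg_of_forall_setIntegral_nonneg_of_sigmaFinite
      (fun A hA hfin => (hconst A hfin).sub (hint A hA hfin)) fun A hA hfin => ?_
    rw [integral_sub (hconst A hfin) (hint A hA hfin), setIntegral_const, smul_eq_mul]
    have := (abs_le.mp (hw.abs_setIntegral_le hab hB hae ht hA hfin)).2
    linarith
  have h2 : 0 ≤ᵐ[volume] fun x => B + θ t x := by
    refine ae_nonneg_of_forall_setIntegral_nonneg_of_sigmaFinite
      (fun A hA hfin => (hconst A hfin).add (hint A hA hfin)) fun A hA hfin => ?_
    rw [integral_add (hconst A hfin) (hint A hA hfin), setIntegral_const, smul_eq_mul]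
    have := (abs_le.mp (hw.abs_setIntegral_le hab hB hae ht hA hfin)).1
    linarith
  filter_upwards [h1, h2] with x hx1 hx2
  simp only [Pi.zero_apply] at hx1 hx2
  exact abs_le.mpr ⟨by linarith, by linarith⟩

lemma smear_congr_ae {k f g : Space N → ℝ} (h : f =ᵐ[volume] g) (x : Space N) :
    smear k f x = smear k g x := by
  refine integral_congr_ae ?_
  filter_upwards [h] with y hy
  rw [hy]

lemma WeaklyContinuous.continuousOn_smear (hw : WeaklyContinuous a b θ) {r : ℝ} {k : Space N → ℝ}
    (hk : IsMollifier C r k) (x : Space N) :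
    ContinuousOn (fun s => smear k (θ s) x) (Icc a b) := by
  have hcont : Continuous fun y => k (x - y) :=
    hk.smooth.continuous.comp (continuous_const.sub continuous_id)
  have hcomp : HasCompactSupport fun y => k (x - y) :=
    hk.compact.comp_homeomorph (Homeomorph.subLeft x)
  have h := hw.2 _ (hcont.memLp_of_hasCompactSupport hcomp)
  simpa only [smear, mul_comm] using h

lemma WeaklyContinuous.isValueAt (hN : 0 < N) (hw : WeaklyContinuous a b θ) (hab : a < b)
    (hB0 : 0 ≤ B) (hθ' : Measurable (Function.uncurry θ')) (hB : ∀ s x, |θ' s x| ≤ B)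
    (hae : ∀ᵐ s ∂volume.restrict (Icc a b), θ s =ᵐ[volume] θ' s)
    (hm : ∀ n, IsMollifier C (δ n) (m n))
    (hc : ∀ n x, ∀ᵐ s ∂volume.restrict (Icc a b),
        smear (m n) (θ' s) x = c n x + ∫ r in a..s, smearedFlux (m n) (θ' r) x)
    (ht : t ∈ Icc a b) : IsValueAt m c θ' a B t (θ t) := by
  obtain ⟨g, hg, hgB, hge⟩ := exists_measurable_abs_le (hw.1 t ht).aestronglyMeasurable hB0
    (hw.ae_abs_le hab hB hae ht)
  refine ⟨g, hg, hgB, hge, fun n => ae_of_all _ fun x => ?_⟩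
  obtain ⟨R, hR⟩ := (hm n).exists_abs_smearedFlux_le hN B
  have hloc : LocallyIntegrable fun r => smearedFlux (m n) (θ' r) x :=
    locallyIntegrable_of_bdd (((hm n).measurable_smearedFlux hθ' hB).of_uncurry_right (y := x))
      (fun s => hR _ hθ'.of_uncurry_left (hB s) x)
  have hint : IntegrableOn (fun r => smearedFlux (m n) (θ' r) x) (Icc a b) :=
    hloc.integrableOn_isCompact isCompact_Icc
  rw [← smear_congr_ae hge x]
  refine Measure.eqOn_Icc_of_ae_eq (μ := volume) hab.ne (f := fun s => smear (m n) (θ s) x)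
    (g := fun s => c n x + ∫ r in a..s, smearedFlux (m n) (θ' r) x) ?_
    (hw.continuousOn_smear (hm n) x) (continuousOn_const.add ?_) ht
  · filter_upwards [hae, hc n x] with s hs hs'
    rw [smear_congr_ae hs x, hs']
  · exact (intervalIntegral.continuousOn_primitive_interval
      (by rwa [uIcc_of_le hab.le])).mono Icc_subset_uIcc

end WeakContinuity

/-- The local energy inequality for bounded weak solutions on a time interval `[a, b]`. -/
theorem IsWeakSolution.localEnergyInequality (hN : 2 ≤ N) {a b : ℝ} (hab : a < b)
    {θ : ℝ → Space N → ℝ} (hθ : IsWeakSolution a b θ) (hbdd : supNorm a b θ < ⊤) :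
    ∃ P : ℝ → Prop, (∀ᵐ t ∂volume.restrict (Icc a b), P t) ∧
      (WeaklyContinuous a b θ → ∀ t ∈ Icc a b, P t) ∧
      ∀ σ ∈ Icc a b, ∀ t ∈ Icc a b, P σ → P t → σ ≤ t →
        ∀ β L : ℝ, 0 < β → ∀ η : Space N × ℝ → ℝ, IsCutoff η →
          LocalEnergyInequality (fun s x => β * (θ s x - L)) η
            (2 * N * sobolevConst N * (ENNReal.ofReal |L| + supNorm a b θ) ^ 2) σ t := by
  obtain ⟨θ', hθ', hB, hae⟩ := exists_bounded_representative hθ.measurable hbdd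
  obtain ⟨C, -, hmoll⟩ := exists_isMollifier N
  have hδ : ∀ n : ℕ, 0 < 1 / ((n : ℝ) + 1) := fun n => Nat.one_div_pos_of_nat
  have hδ1 : ∀ n : ℕ, 1 / ((n : ℝ) + 1) ≤ 1 := fun n => by
    rw [div_le_one (by positivity)]
    linarith [(Nat.cast_nonneg n : (0 : ℝ) ≤ n)]
  choose m hm using fun n : ℕ => hmoll _ (hδ n)
  choose c hc hc' using fun n =>
    hθ.exists_smear_eq (by omega) hab hθ' hB hae (hm n)
  refine ⟨fun t => IsValueAt m c θ' a (supNorm a b θ).toReal t (θ t), ?_, fun hw t ht => ?_, ?_⟩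
  · filter_upwards [hae, ae_all_iff.mpr hc'] with t h1 h2
    exact ⟨θ' t, hθ'.of_uncurry_left, hB t, h1, h2⟩
  · exact hw.isValueAt (by omega) hab ENNReal.toReal_nonneg hθ' hB hae hm hc ht
  · intro σ hσ t ht hPσ hPt hσt β L hβ η hη
    have h := localEnergyInequality_of_isValueAt hN hθ hθ' hB hae hδ hδ1
      tendsto_one_div_add_atTop_nhds_zero_nat hm hc hσ ht hσt hPσ hPt hβ.le L hη
    rwa [ENNReal.ofReal_toReal hbdd.ne] at h

end CriticalBurgers

end

theorem mainTheorem4 (N : ℕ) (hN : 2 ≤ N)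
    (θ : ℝ → Space N → ℝ)
    (hθ : IsWeakSolution (-4) 0 θ)
    (hbdd : supNorm (-4) 0 θ < ⊤) :
    -- the inequality between all times outside one null set
    (∃ S ⊆ Icc (-4 : ℝ) 0, volume (Icc (-4 : ℝ) 0 \ S) = 0 ∧
      ∀ σ ∈ S, ∀ t ∈ S, σ ≤ t →
        ∀ (β L : ℝ), 0 < β →
          ∀ η : Space N × ℝ → ℝ, IsCutoff η →
            LocalEnergyInequality (fun s x => β * (θ s x - L)) η
              (2 * N * sobolevConst N *
                (ENNReal.ofReal |L| + supNorm (-4) 0 θ) ^ 2) σ t) ∧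
    -- between all times, for the weakly continuous representative
    (WeaklyContinuous (-4) 0 θ →
      ∀ σ t : ℝ, -4 ≤ σ → σ ≤ t → t ≤ 0 →
        ∀ (β L : ℝ), 0 < β →
          ∀ η : Space N × ℝ → ℝ, IsCutoff η →
            LocalEnergyInequality (fun s x => β * (θ s x - L)) η
              (2 * N * sobolevConst N *
                (ENNReal.ofReal |L| + supNorm (-4) 0 θ) ^ 2) σ t) := by
  obtain ⟨P, hae, hcont, hP⟩ := hθ.localEnergyInequality hN (by norm_num) hbdd
  refine ⟨⟨{t | t ∈ Icc (-4 : ℝ) 0 ∧ P t}, fun t ht => ht.1, ?_, ?_⟩, ?_⟩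
  · rw [ae_restrict_iff' measurableSet_Icc, ae_iff] at hae
    convert hae using 2
    ext t
    simp only [mem_sdiff, mem_ofPred_eq, Classical.not_imp]
    tauto
  · exact fun σ hσ t ht => hP σ hσ.1 t ht.1 hσ.2 ht.2
  · intro hw σ t hσ hσt ht
    have h1 : σ ∈ Icc (-4 : ℝ) 0 := ⟨hσ, hσt.trans ht⟩
    have h2 : t ∈ Icc (-4 : ℝ) 0 := ⟨hσ.trans hσt, ht⟩
    exact hP σ h1 t h2 (hcont hw σ h1) (hcont hw t h2) hσt
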